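/- **Notation.** Let $S_{\mathbb Z}$ be the group of permutations of $\mathbb Z$ generated by the simple reflections $s_i=(i\;\,i+1)$, $i\in\mathbb Z$, with length function $\ell$; let $S_+$ (resp. $S_-$) be the subgroup generated by the $s_i$ with $i>0$ (resp. $i<0$), and $S_{\neq0}=S_-\times S_+$. Write $w\doteq uv$ if $u,v\in S_{\mathbb Z}$, $w=uv$ and $\ell(w)=\ell(u)+\ell(v)$. Put $\mathbb Q[a]=\mathbb Q[a_i\mid i\in\mathbb Z]$ and $\mathbb Q[x,a]=\mathbb Q[x_i,a_i\mid i\in\mathbb Z]$. For $w\in S_n\subset S_+$ the double Schubert polynomial $\mathfrak S_w(x;a)$ is determined by $\mathfrak S_{w_0^{(n)}}(x;a)=\prod_{i,j\ge1,\;i+j\le n}(x_i-a_j)$ for the longest element $w_0^{(n)}$ of $S_n$, and $\mathfrak S_w=A_i\mathfrak S_{ws_i}$ if $1\le i<n$ and $\ell(ws_i)>\ell(w)$, where $A_i f=(f-s_if)/(x_i-x_{i+1})$ with $s_i$ exchanging $x_i$ and $x_{i+1}$. Let $\omega$ be the automorphism of $S_{\mathbb Z}$ with $s_i\mapsto s_{-i}$,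 and also the automorphism of $\mathbb Q[x,a]$ with $x_i\mapsto-x_{1-i}$, $a_i\mapsto -a_{1-i}$. For $u\in S_-$ put $\mathfrak S_u(x;a)=\omega(\mathfrak S_{\omega(u)}(x;a))$, and for $w=uv$ with $u\in S_-$, $v\in S_+$ put $\mathfrak S_w(x;a)=\mathfrak S_u(x;a)\,\mathfrak S_v(x;a)$. Let $p_k(x||a)=\sum_{i\le0}(x_i^k-a_i^k)$ for $k\ge1$, and let $\Lambda(x||a)$ be the polynomial $\mathbb Q[a]$-algebra generated by $p_1(x||a),p_2(x||a),\dots$; it is a Hopf algebra over $\mathbb Q[a]$ in which every $p_k(x||a)$ is primitive. Let $\overleftarrow R(x;a)=\Lambda(x||a)\otimes_{\mathbb Q[a]}\mathbb Q[x,a]$, which maps to formal power series in the $x_i,a_i$ by multiplication. Let $\Delta:\overleftarrow R(x;a)\to\Lambda(x||a)\otimes_{\mathbb Q[a]}\overleftarrow R(x;a)$ be the coaction given by the comultiplication of the first factor $\Lambda(x||a)$, and let $\eta_a:\overleftarrow R(x;a)\to\Lambda(x||a)$ be the $\mathbb Q[a]$-algebra homomorphism that is the identity on $\Lambda(x||a)$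 and sends $x_i\in\mathbb Q[x,a]$ to $a_i$. For $w\in S_{\mathbb Z}$ and an interval $[p,q]$ containing all integers moved by $w$, let $\mathfrak S^{[p,q]}_w(x;a)=\gamma^{p-1}\bigl(\mathfrak S_{\gamma^{1-p}(w)}(x;a)\bigr)$, where $\gamma$ is the shift $s_i\mapsto s_{i+1}$, $x_i\mapsto x_{i+1}$, $a_i\mapsto a_{i+1}$. The back stable double Schubert polynomial is the coefficientwise limit $\overleftarrow{\mathfrak S}_w(x;a)=\lim_{p\to-\infty,\,q\to\infty}\mathfrak S^{[p,q]}_w(x;a)$, and the double Stanley symmetric function is $F_w(x||a)=\eta_a(\overleftarrow{\mathfrak S}_w(x;a))\in\Lambda(x||a)$. **Theorem.** The map from $\overleftarrow R(x;a)$ to formal power series is injective. For every $w\in S_{\mathbb Z}$ the limit $\overleftarrow{\mathfrak S}_w(x;a)$ exists and lies in $\overleftarrow R(x;a)$, and $$\Delta\bigl(\overleftarrow{\mathfrak S}_w(x;a)\bigr)=\sum_{w\doteq uv}F_u(x||a)\otimes\overleftarrow{\mathfrak S}_v(x;a),$$ $$\overleftarrow{\mathfrak S}_w(x;a)=\sum_{\substack{w\doteq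 uv\\ v\in S_{\neq0}}}F_u(x||a)\,\mathfrak S_v(x;a).$$ -/

import Mathlib

open scoped TensorProduct
open Filter

namespace BackStable

noncomputable section

/-! ### Permutations of the integers -/

/-- The simple reflection `s_i`, exchanging `i` and `i + 1`. -/
def s (i : ℤ) : Equiv.Perm ℤ := Equiv.swap i (i + 1)

/-- `S_ℤ`: the group generated by all `s_i`, `i ∈ ℤ`. -/
def SZ : Subgroup (Equiv.Perm ℤ) := Subgroup.closure {w | ∃ i : ℤ, w = s i}

/-- `S_+`: the group generated by `s_1, s_2, …`. -/
def SPlus : Subgroup (Equiv.Perm ℤ) := Subgroup.closure {w | ∃ i : ℤ, 0 < i ∧ w = s i}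

/-- `S_-`: the group generated by `s_{-1}, s_{-2}, …`. -/
def SMinus : Subgroup (Equiv.Perm ℤ) := Subgroup.closure {w | ∃ i : ℤ, i < 0 ∧ w = s i}

/-- `S_{≠0} = S_- × S_+`, the internal product inside the permutations of `ℤ`. -/
def SNonzero : Set (Equiv.Perm ℤ) := {w | ∃ u ∈ SMinus, ∃ v ∈ SPlus, w = u * v}

/-- The set of inversions of a permutation. -/
def inversions (w : Equiv.Perm ℤ) : Set (ℤ × ℤ) := {p | p.1 < p.2 ∧ w p.2 < w p.1}

/-- The length `ℓ(w)`, as the number of inversions. -/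
def len (w : Equiv.Perm ℤ) : ℕ := (inversions w).ncard

/-- The automorphism of the permutation group with `s_i ↦ s_{i+m}`
(the `m`-th power of the shift). -/
def shiftPerm (m : ℤ) (w : Equiv.Perm ℤ) : Equiv.Perm ℤ :=
  Equiv.addRight m * w * (Equiv.addRight m)⁻¹

/-- The automorphism of the permutation group with `s_i ↦ s_{-i}`. -/
def omegaPerm (w : Equiv.Perm ℤ) : Equiv.Perm ℤ :=
  Equiv.subLeft 1 * w * (Equiv.subLeft 1)⁻¹

theorem shiftPerm_s (m i : ℤ) : shiftPerm m (s i) = s (i + m) := by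
  unfold shiftPerm s
  rw [Equiv.mul_swap_eq_swap_mul, mul_assoc, mul_inv_cancel, mul_one]
  simp only [Equiv.coe_addRight]
  congr 1
  ring

theorem omegaPerm_s (i : ℤ) : omegaPerm (s i) = s (-i) := by
  unfold omegaPerm s
  rw [Equiv.mul_swap_eq_swap_mul, mul_assoc, mul_inv_cancel, mul_one, Equiv.swap_comm]
  simp only [Equiv.subLeft_apply]
  congr 1 <;> ring

/-- The length-additive factorizations `w ≐ uv` in `S_ℤ`. -/
def factorizationSet (w : Equiv.Perm ℤ) : Set (Equiv.Perm ℤ × Equiv.Perm ℤ) :=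
  {p | p.1 ∈ SZ ∧ p.2 ∈ SZ ∧ w = p.1 * p.2 ∧ len w = len p.1 + len p.2}

theorem exists_bound {w : Equiv.Perm ℤ} (hw : w ∈ SZ) :
    ∃ N : ℤ, ∀ i, (i < -N ∨ N < i) → w i = i := by
  induction hw using Subgroup.closure_induction with
  | mem x hx =>
    obtain ⟨j, rfl⟩ := hx
    refine ⟨|j| + 1, fun i hi => ?_⟩
    have h1 := le_abs_self j
    have h2 := neg_abs_le j
    exact Equiv.swap_apply_of_ne_of_ne (by omega) (by omega)
  | one => exact ⟨0, fun _ _ => rfl⟩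
  | mul x y _ _ hx hy =>
    obtain ⟨N, hN⟩ := hx
    obtain ⟨M, hM⟩ := hy
    refine ⟨max N M, fun i hi => ?_⟩
    have h1 := le_max_left N M
    have h2 := le_max_right N M
    rw [Equiv.Perm.mul_apply, hM i (by omega), hN i (by omega)]
  | inv x _ hx =>
    obtain ⟨N, hN⟩ := hx
    exact ⟨N, fun i hi => by rw [Equiv.Perm.inv_eq_iff_eq, hN i hi]⟩

theorem inversions_finite {w : Equiv.Perm ℤ} (hw : w ∈ SZ) : (inversions w).Finite := by
  obtain ⟨N, hN⟩ := exists_bound hw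
  refine ((Set.finite_Icc (-N) N).prod (Set.finite_Icc (-N) N)).subset ?_
  rintro ⟨i, j⟩ ⟨hij, hw'⟩
  simp only at hij hw'
  have hi : -N ≤ i := by
    by_contra h
    have e1 := hN i (by omega)
    have e2 := w.injective (hN (w j) (by omega))
    omega
  have hj : j ≤ N := by
    by_contra h
    have e1 := hN j (by omega)
    have e2 := w.injective (hN (w i) (by omega))
    omega
  simp only [Set.mem_prod, Set.mem_Icc]
  omega

theorem inversions_injOn : Set.InjOn inversions (SZ : Set (Equiv.Perm ℤ)) := by
  intro v hv v' hv' h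
  have hg : v' * v⁻¹ ∈ SZ := SZ.mul_mem hv' (SZ.inv_mem hv)
  obtain ⟨N, hN⟩ := exists_bound hg
  set g := v' * v⁻¹ with hgdef
  have hgv : ∀ i, g (v i) = v' i := fun i => by simp [hgdef]
  have mono : ∀ i j, i < j → g i < g j := by
    intro i j hij
    obtain ⟨a, rfl⟩ := v.surjective i
    obtain ⟨b, rfl⟩ := v.surjective j
    rw [hgv, hgv]
    rcases lt_trichotomy a b with hab | hab | hab
    · by_contra hc
      have hne : v' a ≠ v' b := fun e => hab.ne (v'.injective e)
      have : (a, b) ∈ inversions v' := ⟨hab, by simp only; omega⟩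
      rw [← h] at this
      have h2 : v b < v a := this.2
      omega
    · subst hab; omega
    · have : (b, a) ∈ inversions v := ⟨hab, hij⟩
      rw [h] at this
      exact this.2
  have up : ∀ k : ℕ, ∀ i, i = -|N| - 1 + k → i ≤ g i := by
    intro k
    induction k with
    | zero =>
      intro i hi
      have := le_abs_self N
      exact (hN i (Or.inl (by push_cast at hi; omega))).ge
    | succ k ih =>
      intro i hi
      have h1 := ih (i - 1) (by push_cast at hi; omega)
      have h2 := mono (i - 1) i (by omega)
      omega
  have down : ∀ k : ℕ, ∀ i, i = |N| + 1 - k → g i ≤ i := by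
    intro k
    induction k with
    | zero =>
      intro i hi
      have := le_abs_self N
      exact (hN i (Or.inr (by push_cast at hi; omega))).le
    | succ k ih =>
      intro i hi
      have h1 := ih (i + 1) (by push_cast at hi; omega)
      have h2 := mono i (i + 1) (by omega)
      omega
  have hle := le_abs_self N
  have gid : ∀ i, g i = i := by
    intro i
    by_cases h1 : i < -|N|
    · exact hN i (Or.inl (by omega))
    by_cases h2 : |N| < i
    · exact hN i (Or.inr (by omega))
    have a1 := up (i + |N| + 1).toNat i (by omega)
    have a2 := down (|N| + 1 - i).toNat i (by omega)
    omega
  ext i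
  rw [← hgv, gid]

theorem factorizationSet_finite (w : Equiv.Perm ℤ) : (factorizationSet w).Finite := by
  by_cases hw : w ∈ SZ
  swap
  · refine Set.Finite.subset Set.finite_empty ?_
    rintro ⟨u, v⟩ ⟨hu, hv, e, -⟩
    exact hw (e ▸ SZ.mul_mem hu hv)
  have key : ∀ p ∈ factorizationSet w, inversions p.2 ⊆ inversions w := by
    rintro ⟨u, v⟩ ⟨hu, hv, e, hl⟩
    simp only at hu hv e hl
    subst e
    have fv := inversions_finite hv
    have fu := inversions_finite hu
    have sub : inversions (u * v) ⊆
        (inversions v ∩ inversions (u * v)) ∪ Prod.map (v⁻¹ : Equiv.Perm ℤ) (v⁻¹ : Equiv.Perm ℤ) '' inversions u := by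
      rintro ⟨i, j⟩ ⟨hij, h⟩
      simp only [Equiv.Perm.mul_apply] at hij h
      rcases lt_trichotomy (v i) (v j) with hv' | hv' | hv'
      · exact Or.inr ⟨(v i, v j), ⟨hv', h⟩, by simp⟩
      · exact absurd (v.injective hv') hij.ne
      · exact Or.inl ⟨⟨hij, hv'⟩, ⟨hij, h⟩⟩
    have c1 := Set.ncard_le_ncard sub ((fv.subset Set.inter_subset_left).union (fu.image _))
    have c2 := Set.ncard_union_le (inversions v ∩ inversions (u * v))
      (Prod.map (v⁻¹ : Equiv.Perm ℤ) (v⁻¹ : Equiv.Perm ℤ) '' inversions u)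
    have c3 := Set.ncard_image_le (f := Prod.map (v⁻¹ : Equiv.Perm ℤ) (v⁻¹ : Equiv.Perm ℤ)) fu
    have c4 : (inversions v).ncard ≤ (inversions v ∩ inversions (u * v)).ncard := by
      unfold len at hl
      omega
    have := Set.eq_of_subset_of_ncard_le Set.inter_subset_left c4 fv
    exact Set.inter_eq_left.mp this
  refine Set.Finite.of_finite_image (f := fun p => inversions p.2)
    ((inversions_finite hw).finite_subsets.subset ?_) ?_
  · rintro _ ⟨p, hp, rfl⟩
    exact key p hp
  · rintro ⟨u, v⟩ ⟨_, hv, e, _⟩ ⟨u', v'⟩ ⟨_, hv', e', _⟩ h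
    simp only at hv hv' e e' h
    obtain rfl := inversions_injOn hv hv' h
    rw [e] at e'
    rw [mul_right_cancel e']

/-- The finite set of length-additive factorizations `w ≐ uv` in `S_ℤ`. -/
def factorizations (w : Equiv.Perm ℤ) : Finset (Equiv.Perm ℤ × Equiv.Perm ℤ) :=
  (factorizationSet_finite w).toFinset

theorem mem_factorizations {w : Equiv.Perm ℤ} {uv : Equiv.Perm ℤ × Equiv.Perm ℤ} :
    uv ∈ factorizations w ↔
      uv.1 ∈ SZ ∧ uv.2 ∈ SZ ∧ w = uv.1 * uv.2 ∧ len w = len uv.1 + len uv.2 :=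
  Set.Finite.mem_toFinset _

open Classical in
/-- The length-additive factorizations `w ≐ uv` in `S_ℤ` with `v ∈ S_{≠0}`. -/
def factorizationsNonzero (w : Equiv.Perm ℤ) : Finset (Equiv.Perm ℤ × Equiv.Perm ℤ) :=
  (factorizations w).filter fun uv => uv.2 ∈ SNonzero

/-! ### Polynomial rings and divided differences -/

/-- `ℚ[a]`, polynomials in `a_i`, `i ∈ ℤ`. -/
abbrev Qa : Type := MvPolynomial ℤ ℚ

/-- `ℚ[x,a]`, as polynomials in `x_i`, `i ∈ ℤ`, over `ℚ[a]`. -/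
abbrev Qxa : Type := MvPolynomial ℤ Qa

/-- The variable `x_i` in `ℚ[x,a]`. -/
def x (i : ℤ) : Qxa := MvPolynomial.X i

/-- The variable `a_i` in `ℚ[x,a]`. -/
def a (i : ℤ) : Qxa := MvPolynomial.C (MvPolynomial.X i)

/-- The permutation action of `w` on the `x`-variables. -/
def permX (w : Equiv.Perm ℤ) : Qxa →ₐ[Qa] Qxa := MvPolynomial.rename w

theorem sub_dvd (i : ℤ) (f : Qxa) : x i - x (i + 1) ∣ f - permX (s i) f := by
  induction f using MvPolynomial.induction_on with
  | C c => simp [permX]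
  | add f g hf hg =>
    rw [map_add, add_sub_add_comm]
    exact dvd_add hf hg
  | mul_X f j hf =>
    have e : f * MvPolynomial.X j - permX (s i) (f * MvPolynomial.X j) =
        (f - permX (s i) f) * MvPolynomial.X j +
          permX (s i) f * (MvPolynomial.X j - permX (s i) (MvPolynomial.X j)) := by
      rw [map_mul]; ring
    rw [e]
    refine dvd_add (hf.mul_right _) (Dvd.dvd.mul_left ?_ _)
    simp only [permX, MvPolynomial.rename_X, s, x]
    by_cases h1 : j = i
    · subst h1; simp
    by_cases h2 : j = i + 1
    · subst h2
      rw [Equiv.swap_apply_right]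
      exact ⟨-1, by ring⟩
    · rw [Equiv.swap_apply_of_ne_of_ne h1 h2]; simp

/-- The divided difference operator `A_i f = (f - s_i f) / (x_i - x_{i+1})`
in the `x`-variables. -/
def dividedDiff (i : ℤ) (f : Qxa) : Qxa := (sub_dvd i f).choose

theorem dividedDiff_spec (i : ℤ) (f : Qxa) :
    (x i - x (i + 1)) * dividedDiff i f = f - permX (s i) f :=
  (sub_dvd i f).choose_spec.symm

/-! ### Double Schubert polynomials -/

/-- The double Schubert polynomial of the longest element of `S_n`:
the product of `x_i - a_j` over `i, j ≥ 1` with `i + j ≤ n`. -/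
def topSchub (n : ℕ) : Qxa :=
  ∏ i ∈ Finset.Icc 1 n, ∏ j ∈ Finset.Icc 1 n,
    if i + j ≤ n then x (i : ℤ) - a (j : ℤ) else 1

open Classical in
/-- The descending recursion `𝔖_w = A_i 𝔖_{w s_i}` for `w ∈ S_n` and some `1 ≤ i < n` with
`w s_i > w`, started at the longest element (the only one in `S_n` without such an `i`).
The number of recursion steps allowed is the third argument; `n (n - 1) / 2` is enough. -/
def doubleSchubAux (n : ℕ) : ℕ → Equiv.Perm ℤ → Qxa
  | 0, _ => topSchub n
  | k + 1, w =>
    if h : ∃ i : ℤ, 1 ≤ i ∧ i < n ∧ len w < len (w * s i) then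
      dividedDiff h.choose (doubleSchubAux n k (w * s h.choose))
    else topSchub n

/-- The least `n` such that `w` fixes all integers greater than `n`
(so `w ∈ S_+` lies in `S_n`). -/
def rank (w : Equiv.Perm ℤ) : ℕ := sInf {n : ℕ | ∀ i : ℤ, (n : ℤ) < i → w i = i}

/-- The double Schubert polynomial `𝔖_w(x;a)`, meant for `w ∈ S_+`. -/
def doubleSchub (w : Equiv.Perm ℤ) : Qxa :=
  doubleSchubAux (rank w) ((rank w).choose 2) w

/-- The automorphism `x_i ↦ x_{i+m}`, `a_i ↦ a_{i+m}` of `ℚ[x,a]`. -/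
def shiftPoly (m : ℤ) : Qxa →+* Qxa :=
  MvPolynomial.eval₂Hom
    ((MvPolynomial.aeval fun i : ℤ => a (i + m) : Qa →ₐ[ℚ] Qxa) : Qa →+* Qxa)
    fun i : ℤ => x (i + m)

/-- The automorphism `x_i ↦ -x_{1-i}`, `a_i ↦ -a_{1-i}` of `ℚ[x,a]`. -/
def omegaPoly : Qxa →+* Qxa :=
  MvPolynomial.eval₂Hom
    ((MvPolynomial.aeval fun i : ℤ => -a (1 - i) : Qa →ₐ[ℚ] Qxa) : Qa →+* Qxa)
    fun i : ℤ => -x (1 - i)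

/-- The negative double Schubert polynomial, meant for `w ∈ S_-`. -/
def negDoubleSchub (w : Equiv.Perm ℤ) : Qxa := omegaPoly (doubleSchub (omegaPerm w))

open Classical in
/-- The double Schubert polynomial `𝔖_w(x;a) = 𝔖_u(x;a) 𝔖_v(x;a)` for `w = uv ∈ S_{≠0}`,
`u ∈ S_-`, `v ∈ S_+` (`u` and `v` are determined by `w`). -/
def nonzeroDoubleSchub (w : Equiv.Perm ℤ) : Qxa :=
  if h : ∃ p : Equiv.Perm ℤ × Equiv.Perm ℤ, p.1 ∈ SMinus ∧ p.2 ∈ SPlus ∧ w = p.1 * p.2 then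
    negDoubleSchub h.choose.1 * doubleSchub h.choose.2
  else 0

/-- `𝔖_w^{[p,q]}(x;a)`, meant for `w` fixing all integers outside `[p,q]`: shift `w` so that the
interval starts at `1`, take the double Schubert polynomial, and shift the variables back.
The number `q` does not enter the formula. -/
def intervalSchub (p _q : ℤ) (w : Equiv.Perm ℤ) : Qxa :=
  shiftPoly (p - 1) (doubleSchub (shiftPerm (1 - p) w))

/-! ### Double symmetric functions and back symmetric double power series -/

/-- `Λ(x||a)`: the polynomial `ℚ[a]`-algebra on the double power sums `p_k(x||a)`, `k ≥ 1`. -/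
abbrev DoubleSym : Type := MvPolynomial ℕ+ Qa

/-- The back symmetric double power series ring `Λ(x||a) ⊗_{ℚ[a]} ℚ[x,a]`. -/
abbrev BackSym : Type := DoubleSym ⊗[Qa] Qxa

/-- The generator `p_k(x||a)` of `Λ(x||a)`. -/
def p (k : ℕ+) : DoubleSym := MvPolynomial.X k

/-- Formal power series in the variables `x_i` (index `inl i`) and `a_i` (index `inr i`). -/
abbrev Series : Type := MvPowerSeries (ℤ ⊕ ℤ) ℚ

/-- The inclusion `ℚ[a] → ℚ[[x,a]]`. -/
def aToSeries : Qa →ₐ[ℚ] Series := MvPolynomial.aeval fun i => MvPowerSeries.X (Sum.inr i)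

instance instAlgebraQaSeries : Algebra Qa Series := aToSeries.toRingHom.toAlgebra

/-- The inclusion `ℚ[x,a] → ℚ[[x,a]]`. -/
def polyToSeries : Qxa →ₐ[Qa] Series := MvPolynomial.aeval fun i => MvPowerSeries.X (Sum.inl i)

open Classical in
/-- The formal power series `p_k(x||a) = ∑_{i ≤ 0} (x_i^k - a_i^k)`, for `k ≥ 1`. -/
def pSeries (k : ℕ+) : Series := fun m =>
  if ∃ i : ℤ, i ≤ 0 ∧ m = Finsupp.single (Sum.inl i) (k : ℕ) then 1
  else if ∃ i : ℤ, i ≤ 0 ∧ m = Finsupp.single (Sum.inr i) (k : ℕ) then -1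
  else 0

/-- The realization `Λ(x||a) → ℚ[[x,a]]`. -/
def symToSeries : DoubleSym →ₐ[Qa] Series := MvPolynomial.aeval pSeries

/-- The realization `Λ(x||a) ⊗_{ℚ[a]} ℚ[x,a] → ℚ[[x,a]]`, `f ⊗ g ↦ f g`. -/
def toSeries : BackSym →ₐ[Qa] Series := Algebra.TensorProduct.productMap symToSeries polyToSeries

/-- The comultiplication of `Λ(x||a)`, for which each `p_k(x||a)` is primitive. -/
def comul : DoubleSym →ₐ[Qa] DoubleSym ⊗[Qa] DoubleSym :=
  MvPolynomial.aeval fun k => p k ⊗ₜ[Qa] 1 + 1 ⊗ₜ[Qa] p k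

/-- The coaction of `Λ(x||a)` on the back symmetric double power series ring: comultiplication on
the first tensor factor. -/
def coaction : BackSym →ₐ[Qa] DoubleSym ⊗[Qa] BackSym :=
  (Algebra.TensorProduct.assoc Qa Qa Qa DoubleSym DoubleSym Qxa).toAlgHom.comp
    (Algebra.TensorProduct.map comul (AlgHom.id Qa Qxa))

/-- The map `η_a`: the identity on `Λ(x||a)`, and `x_i ↦ a_i` on `ℚ[x,a]`. -/
def eta : BackSym →ₐ[Qa] DoubleSym :=
  Algebra.TensorProduct.productMap (AlgHom.id Qa DoubleSym)
    (MvPolynomial.aeval fun i => algebraMap Qa DoubleSym (MvPolynomial.X i))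

/-! ### Back stable double Schubert polynomials and double Stanley symmetric functions -/

/-- The power series `f` is the limit of `𝔖_w^{[p,q]}(x;a)` for `p → -∞`, `q → ∞`:
every coefficient eventually stabilizes at that of `f`. -/
def IsBackStableLimit (w : Equiv.Perm ℤ) (f : Series) : Prop :=
  ∀ m : (ℤ ⊕ ℤ) →₀ ℕ, ∀ᶠ pq in (atBot ×ˢ atTop : Filter (ℤ × ℤ)),
    MvPowerSeries.coeff m (polyToSeries (intervalSchub pq.1 pq.2 w)) = MvPowerSeries.coeff m f

open Classical in
/-- The back stable double Schubert polynomial of `w ∈ S_ℤ`: the element of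
`Λ(x||a) ⊗_{ℚ[a]} ℚ[x,a]` whose power series is the limit of `𝔖_w^{[p,q]}(x;a)`. -/
def backStable (w : Equiv.Perm ℤ) : BackSym :=
  if h : ∃ f : BackSym, IsBackStableLimit w (toSeries f) then h.choose else 0

/-- The double Stanley symmetric function `F_w(x||a)`. -/
def doubleStanley (w : Equiv.Perm ℤ) : DoubleSym := eta (backStable w)

end

end BackStable

/-!
The polynomials `𝔖_w^{[p,q]}`, the polynomials `𝔖_w` with `w ∈ S_{≠0}` and the power series
`←𝔖_w` are three families with two properties in common: a divided difference `A_i` maps the member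
of `w` to that of `w s_i` if `w` has a descent at `i`, and to `0` otherwise; and the substitution
`x_i ↦ a_i` maps the member of `w` to `1` if `w = 1`, and to `0` otherwise. As the joint kernel of
the `A_i` consists of the constants in `ℚ[a]`, these properties determine a family by induction on
the length. Everything below is a comparison of families in this way.

*Double Schubert polynomials.* The two properties of `𝔖_w`, `w ∈ S_+`, in particular that the
recursion does not depend on the order of its steps, follow from localization. A polynomial of
degree at most `d` in `x_1, x_2, …` is determined by its values under the substitutions
`x_i ↦ a_{u(i)}` with `ℓ(u) ≤ d` (`eq_zero_of_eps_eq_zero`), and `𝔖_w` is the polynomial of degree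
`ℓ(w)` that vanishes at all `u ≠ w` with `ℓ(u) ≤ ℓ(w)` and has the value
`∏ (a_{w(i)} - a_{w(j)})` over the inversions of `w` at `u = w` (`IsDoubleSchub`). For the longest
element this is a count of inversions (`eq_of_forall_staircase_ne`), and `A_i` preserves it. Shifts
and `ω` carry the properties over to intervals and to `S_{≠0}`.

*Back symmetric power series.* On `Λ(x||a) ⊗ ℚ[x,a]` the reflection `s_0` acts by
`p_k ↦ p_k + x_1^k - x_0^k`, and the other `s_i` act on the second factor only. This gives divided
differences `dB i`, with joint kernel `ℚ[a]` (`exists_smul_one_of_dB`). The truncation `trunc p`,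
which replaces `p_k` by the sum of the `x_i^k - a_i^k` with `p ≤ i ≤ 0`, commutes with `dB i` for
`i ≥ p`. An element annihilated by all `dB j` with `j < m` is determined by its truncation if its
degree is at most `m - p + 1` (`eq_zero_of_trunc_eq_zero`): otherwise some `dB i`
with `i ≥ m` would give a counterexample of smaller degree, symmetric below `m - 1`. Conversely a polynomial in the `x_i`, `i ≥ p`, that is
symmetric in those with `i ≤ m` is such a truncation (`exists_trunc_eq`), as symmetric polynomials
over `ℚ` are polynomials in the power sums. So `𝔖_w^{[p,q]}` lifts to an element `backLimit w`, which
does not depend on `p` (`IsLift.unique`). Truncation keeps the coefficients of all monomials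
without indices below `p` (`coeff_toSeries_eq`), whence `backLimit w` is the limit, and the
realization by power series is injective.

*The two formulas.* They are the cases `M = Λ(x||a) ⊗ ℚ[x,a]` and `M = ℚ[x,a]` of one expansion in
`Λ(x||a) ⊗ M` (`eq_sum_factorizations`). Both sides have the same divided differences in the factor
`M`, because the factorizations `w ≐ uv` such that `v` has a descent at `i` correspond to the
factorizations of `w s_i` (`mem_factorizations_mul_s`), and they have the same image under
`x_i ↦ a_i`, `p_k ↦ 0` in the factor `M`. For the coproduct formula this uses that the coaction
commutes with divided differences.
-/

open scoped TensorProduct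
open Filter

namespace BackStable

noncomputable section

/-! ### Length and descents -/

theorem s_apply_left (i : ℤ) : s i i = i + 1 := Equiv.swap_apply_left _ _

theorem s_apply_right (i : ℤ) : s i (i + 1) = i := Equiv.swap_apply_right _ _

theorem s_apply_of_ne {i j : ℤ} (h₁ : j ≠ i) (h₂ : j ≠ i + 1) : s i j = j :=
  Equiv.swap_apply_of_ne_of_ne h₁ h₂

theorem s_apply (i j : ℤ) : s i j = if j = i then i + 1 else if j = i + 1 then i else j :=
  Equiv.swap_apply_def _ _ _

theorem s_mul_self (i : ℤ) : s i * s i = 1 := Equiv.swap_mul_self _ _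

theorem s_s_apply (i j : ℤ) : s i (s i j) = j := Equiv.swap_apply_self _ _ _

theorem mul_s_mul_s (w : Equiv.Perm ℤ) (i : ℤ) : w * s i * s i = w := by
  rw [mul_assoc, s_mul_self, mul_one]

theorem s_comm {i j : ℤ} (h : j + 1 < i) : s i * s j = s j * s i := by
  ext k
  simp only [Equiv.Perm.mul_apply, s_apply]
  split_ifs <;> omega

theorem s_mem_SZ (i : ℤ) : s i ∈ SZ := Subgroup.subset_closure ⟨i, rfl⟩

theorem mul_s_mem_SZ {w : Equiv.Perm ℤ} (hw : w ∈ SZ) (i : ℤ) : w * s i ∈ SZ :=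
  SZ.mul_mem hw (s_mem_SZ i)

theorem SPlus_le_SZ : SPlus ≤ SZ :=
  Subgroup.closure_mono fun _ ⟨i, _, h⟩ => ⟨i, h⟩

theorem SMinus_le_SZ : SMinus ≤ SZ :=
  Subgroup.closure_mono fun _ ⟨i, _, h⟩ => ⟨i, h⟩

theorem SPlus_apply {w : Equiv.Perm ℤ} (hw : w ∈ SPlus) : ∀ i ≤ 0, w i = i := by
  induction hw using Subgroup.closure_induction with
  | mem x hx =>
    obtain ⟨j, hj, rfl⟩ := hx
    exact fun i hi => s_apply_of_ne (by omega) (by omega)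
  | one => exact fun _ _ => rfl
  | mul x y _ _ hx hy =>
    intro i hi
    rw [Equiv.Perm.mul_apply, hy i hi, hx i hi]
  | inv x _ hx =>
    intro i hi
    rw [Equiv.Perm.inv_eq_iff_eq, hx i hi]

theorem SMinus_apply {w : Equiv.Perm ℤ} (hw : w ∈ SMinus) : ∀ i, 0 < i → w i = i := by
  induction hw using Subgroup.closure_induction with
  | mem x hx =>
    obtain ⟨j, hj, rfl⟩ := hx
    exact fun i hi => s_apply_of_ne (by omega) (by omega)
  | one => exact fun _ _ => rfl
  | mul x y _ _ hx hy =>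
    intro i hi
    rw [Equiv.Perm.mul_apply, hy i hi, hx i hi]
  | inv x _ hx =>
    intro i hi
    rw [Equiv.Perm.inv_eq_iff_eq, hx i hi]

theorem s_lt_s {i j k : ℤ} (hjk : j < k) (h : ¬(j = i ∧ k = i + 1)) : s i j < s i k := by
  simp only [s_apply]
  split_ifs <;> omega

theorem inversions_mul_s_of_lt {w : Equiv.Perm ℤ} {i : ℤ} (h : w i < w (i + 1)) :
    inversions (w * s i) = insert (i, i + 1) (Prod.map (s i) (s i) '' inversions w) := by
  ext ⟨j, k⟩
  simp only [Set.mem_insert_iff, Prod.mk.injEq, Set.mem_image, Prod.exists, Prod.map_apply,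
    inversions, Set.mem_ofPred_eq, Equiv.Perm.mul_apply]
  constructor
  · rintro ⟨h1, h2⟩
    by_cases hc : j = i ∧ k = i + 1
    · exact Or.inl hc
    · exact Or.inr ⟨s i j, s i k, ⟨s_lt_s h1 hc, h2⟩, s_s_apply _ _, s_s_apply _ _⟩
  · rintro (⟨rfl, rfl⟩ | ⟨j', k', ⟨h1, h2⟩, rfl, rfl⟩)
    · exact ⟨by omega, by rwa [s_apply_left, s_apply_right]⟩
    · refine ⟨s_lt_s h1 ?_, by rwa [s_s_apply, s_s_apply]⟩
      rintro ⟨rfl, rfl⟩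
      omega

theorem pair_notMem_image_inversions (w : Equiv.Perm ℤ) (i : ℤ) :
    (i, i + 1) ∉ Prod.map (s i) (s i) '' inversions w := by
  rintro ⟨⟨j, k⟩, ⟨h1, -⟩, h2⟩
  simp only [Prod.map_apply, Prod.mk.injEq] at h1 h2
  have e1 : j = i + 1 := by rw [← s_s_apply i j, h2.1, s_apply_left]
  have e2 : k = i := by rw [← s_s_apply i k, h2.2, s_apply_right]
  omega

theorem len_mul_s_of_lt {w : Equiv.Perm ℤ} (hw : w ∈ SZ) {i : ℤ} (h : w i < w (i + 1)) :
    len (w * s i) = len w + 1 := by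
  unfold len
  rw [inversions_mul_s_of_lt h, Set.ncard_insert_of_notMem (pair_notMem_image_inversions w i)
    ((inversions_finite hw).image _),
    Set.ncard_image_of_injective _ ((s i).injective.prodMap (s i).injective)]

theorem len_mul_s_of_gt {w : Equiv.Perm ℤ} (hw : w ∈ SZ) {i : ℤ} (h : w (i + 1) < w i) :
    len (w * s i) + 1 = len w := by
  have h' : (w * s i) i < (w * s i) (i + 1) := by
    simpa only [Equiv.Perm.mul_apply, s_apply_left, s_apply_right] using h
  have := len_mul_s_of_lt (mul_s_mem_SZ hw i) h'
  rwa [mul_s_mul_s, eq_comm] at this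

theorem lt_or_gt_succ (w : Equiv.Perm ℤ) (i : ℤ) : w i < w (i + 1) ∨ w (i + 1) < w i :=
  lt_or_gt_of_ne fun e => by have := w.injective e; omega

theorem len_mul_s_lt_iff {w : Equiv.Perm ℤ} (hw : w ∈ SZ) (i : ℤ) :
    len w < len (w * s i) ↔ w i < w (i + 1) := by
  rcases lt_or_gt_succ w i with h | h
  · have := len_mul_s_of_lt hw h
    omega
  · have := len_mul_s_of_gt hw h
    omega

theorem len_mul_le {u v : Equiv.Perm ℤ} (hu : u ∈ SZ) (hv : v ∈ SZ) :
    len (u * v) ≤ len u + len v := by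
  have fv := inversions_finite hv
  have fu := inversions_finite hu
  have sub : inversions (u * v) ⊆ inversions v ∪
      Prod.map (v⁻¹ : Equiv.Perm ℤ) (v⁻¹ : Equiv.Perm ℤ) '' inversions u := by
    rintro ⟨i, j⟩ ⟨hij, h⟩
    simp only [Equiv.Perm.mul_apply] at hij h
    rcases lt_trichotomy (v i) (v j) with hv' | hv' | hv'
    · exact Or.inr ⟨(v i, v j), ⟨hv', h⟩, by simp⟩
    · exact absurd (v.injective hv') hij.ne
    · exact Or.inl ⟨hij, hv'⟩
  have c1 := Set.ncard_le_ncard sub (fv.union (fu.image _))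
  have c2 := Set.ncard_union_le (inversions v)
    (Prod.map (v⁻¹ : Equiv.Perm ℤ) (v⁻¹ : Equiv.Perm ℤ) '' inversions u)
  have c3 := Set.ncard_image_le (f := Prod.map (v⁻¹ : Equiv.Perm ℤ) (v⁻¹ : Equiv.Perm ℤ)) fu
  unfold len
  omega

theorem len_one : len 1 = 0 := by
  have : inversions 1 = ∅ := by
    ext ⟨i, j⟩
    simp only [inversions, Equiv.Perm.one_apply, Set.mem_ofPred_eq, Set.mem_empty_iff_false,
      iff_false]
    omega
  rw [len, this, Set.ncard_empty]

/-- A factorization `w ≐ uv` whose right factor has a descent at `i` restricts to a factorization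
of `w sᵢ`, and every factorization of `w sᵢ` arises this way when `w` has a descent at `i`. -/
theorem mem_factorizations_mul_s {w : Equiv.Perm ℤ} (hw : w ∈ SZ) {i : ℤ}
    (u v : Equiv.Perm ℤ) :
    ((u, v) ∈ factorizations w ∧ v (i + 1) < v i) ↔
      ((u, v * s i) ∈ factorizations (w * s i) ∧ w (i + 1) < w i) := by
  simp only [mem_factorizations]
  constructor
  · rintro ⟨⟨hu, hv, e, hl⟩, hd⟩
    have h1 := len_mul_s_of_gt hv hd
    have h2 := len_mul_le hu (mul_s_mem_SZ hv i)
    rw [← mul_assoc, ← e] at h2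
    rcases lt_or_gt_succ w i with h | h
    · have := len_mul_s_of_lt hw h
      omega
    · have := len_mul_s_of_gt hw h
      exact ⟨⟨hu, mul_s_mem_SZ hv i, by rw [e, mul_assoc], by omega⟩, h⟩
  · rintro ⟨⟨hu, hv, e, hl⟩, hd⟩
    have hv' : v ∈ SZ := by simpa only [mul_s_mul_s] using mul_s_mem_SZ hv i
    have e' : w = u * v := by rw [← mul_assoc] at e; exact mul_right_cancel e
    have h1 := len_mul_s_of_gt hw hd
    have h2 := len_mul_le hu hv'
    rw [← e'] at h2
    rcases lt_or_gt_succ v i with h | h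
    · have := len_mul_s_of_lt hv' h
      omega
    · have := len_mul_s_of_gt hv' h
      exact ⟨⟨hu, hv', e', by omega⟩, h⟩

/-! ### Divided differences of polynomials -/

theorem permX_x (w : Equiv.Perm ℤ) (j : ℤ) : permX w (x j) = x (w j) :=
  MvPolynomial.rename_X _ _

theorem x_sub_x_ne_zero (i : ℤ) : x i - x (i + 1) ≠ 0 := by
  rw [sub_ne_zero]
  intro h
  have := MvPolynomial.X_injective h
  omega

theorem dividedDiff_eq_of {i : ℤ} {f g : Qxa} (h : (x i - x (i + 1)) * g = f - permX (s i) f) :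
    dividedDiff i f = g :=
  mul_left_cancel₀ (x_sub_x_ne_zero i) ((dividedDiff_spec i f).trans h.symm)

/-- The divided difference as a `ℚ[a]`-linear map. -/
def dividedDiffL (i : ℤ) : Qxa →ₗ[Qa] Qxa where
  toFun := dividedDiff i
  map_add' f g := dividedDiff_eq_of (by
    rw [mul_add, dividedDiff_spec, dividedDiff_spec, map_add]; ring)
  map_smul' c f := dividedDiff_eq_of (by
    rw [RingHom.id_apply, mul_smul_comm, dividedDiff_spec, map_smul, smul_sub])

theorem dividedDiffL_apply (i : ℤ) (f : Qxa) : dividedDiffL i f = dividedDiff i f := rfl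

theorem dividedDiff_eq_zero_iff {i : ℤ} {f : Qxa} :
    dividedDiff i f = 0 ↔ permX (s i) f = f := by
  have h := dividedDiff_spec i f
  constructor
  · intro e
    rw [e, mul_zero] at h
    exact (sub_eq_zero.mp h.symm).symm
  · intro e
    exact dividedDiff_eq_of (by rw [e, sub_self, mul_zero])

theorem dividedDiff_mul_left {i : ℤ} {g : Qxa} (hg : permX (s i) g = g) (f : Qxa) :
    dividedDiff i (g * f) = g * dividedDiff i f :=
  dividedDiff_eq_of (by
    rw [mul_left_comm, dividedDiff_spec, map_mul, hg, mul_sub])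

theorem dividedDiff_mul_right {i : ℤ} {g : Qxa} (hg : permX (s i) g = g) (f : Qxa) :
    dividedDiff i (f * g) = dividedDiff i f * g := by
  rw [mul_comm, dividedDiff_mul_left hg, mul_comm]

/-- A ring homomorphism that intertwines `s_i` and `s_j` and respects the denominators intertwines
the divided differences. -/
theorem map_dividedDiff (φ : Qxa →+* Qxa) {i j : ℤ}
    (hφ : ∀ f, φ (permX (s i) f) = permX (s j) (φ f))
    (hx : φ (x i - x (i + 1)) = x j - x (j + 1)) (f : Qxa) :
    φ (dividedDiff i f) = dividedDiff j (φ f) :=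
  (dividedDiff_eq_of (by rw [← hx, ← map_mul, dividedDiff_spec, map_sub, hφ])).symm

/-- The substitution `x_j ↦ 0` for `j < p`; its fixed points are the polynomials in the `x_j`
with `p ≤ j`. -/
def killBelow (p : ℤ) : Qxa →ₐ[Qa] Qxa :=
  MvPolynomial.aeval fun j => if p ≤ j then x j else 0

theorem killBelow_x (p j : ℤ) : killBelow p (x j) = if p ≤ j then x j else 0 :=
  MvPolynomial.aeval_X _ _

theorem killBelow_permX {p i : ℤ} (hi : p ≤ i) (f : Qxa) :
    killBelow p (permX (s i) f) = permX (s i) (killBelow p f) := by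
  suffices h : (killBelow p).comp (permX (s i)) = (permX (s i)).comp (killBelow p) from
    DFunLike.congr_fun h f
  refine MvPolynomial.algHom_ext fun j => ?_
  change killBelow p (permX (s i) (x j)) = permX (s i) (killBelow p (x j))
  rw [permX_x, killBelow_x, killBelow_x, apply_ite (permX (s i)), map_zero, permX_x, s_apply]
  split_ifs <;> first | rfl | omega

theorem killBelow_dividedDiff {p i : ℤ} (hi : p ≤ i) {f : Qxa} (hf : killBelow p f = f) :
    killBelow p (dividedDiff i f) = dividedDiff i f := by
  have := map_dividedDiff (killBelow p).toRingHom (i := i) (j := i)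
    (fun f => killBelow_permX hi f)
    (by
      change killBelow p (x i - x (i + 1)) = _
      rw [map_sub, killBelow_x, killBelow_x, if_pos hi, if_pos (by omega)]) f
  change killBelow p (dividedDiff i f) = dividedDiff i (killBelow p f) at this
  rw [this, hf]

theorem le_of_mem_vars_of_killBelow {p : ℤ} {f : Qxa} (hf : killBelow p f = f) {j : ℤ}
    (hj : j ∈ f.vars) : p ≤ j := by
  have key : ∀ g : Qxa, killBelow p g ∈ MvPolynomial.supported Qa {j | p ≤ j} := by
    intro g
    induction g using MvPolynomial.induction_on with
    | C c =>
      rw [MvPolynomial.algHom_C]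
      exact (MvPolynomial.supported Qa {j : ℤ | p ≤ j}).algebraMap_mem c
    | add g h hg hh => rw [map_add]; exact add_mem hg hh
    | mul_X g j hg =>
      rw [map_mul]
      refine mul_mem hg ?_
      change killBelow p (x j) ∈ _
      rw [killBelow_x]
      split_ifs with h
      · exact MvPolynomial.X_mem_supported.mpr h
      · exact zero_mem _
  have := key f
  rw [hf, MvPolynomial.mem_supported] at this
  exact this hj

theorem s_apply_mem_vars {i : ℤ} {f : Qxa} (hf : permX (s i) f = f) {j : ℤ} (hj : j ∈ f.vars) :
    s i j ∈ f.vars := by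
  rw [← hf] at hj
  obtain ⟨k, hk, rfl⟩ := MvPolynomial.mem_vars_rename _ _ hj
  rwa [s_s_apply]

/-- If `f` is invariant under all `s_i` with `i ∈ I`, then moving the largest or the smallest
variable of `f` out of the range of variables shows that `f` is constant. -/
theorem eq_C_of_forall_permX {I : Set ℤ} {f : Qxa} (hf : ∀ i ∈ I, permX (s i) f = f)
    (hI : ∀ j ∈ f.vars, (∀ k, j ≤ k → k ∈ I) ∨ ∀ k, k < j → k ∈ I) :
    f = MvPolynomial.C (f.coeff 0) := by
  rw [← MvPolynomial.vars_eq_empty_iff_eq_C]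
  by_contra hne
  obtain ⟨j, hj⟩ := Finset.nonempty_iff_ne_empty.mpr hne
  rcases hI j hj with h | h
  · obtain ⟨m, hm, hmax⟩ := f.vars.exists_max_image id ⟨j, hj⟩
    have h2 := hmax _ (s_apply_mem_vars (hf m (h m (hmax j hj))) hm)
    rw [s_apply_left] at h2
    simp only [id] at h2
    omega
  · obtain ⟨m, hm, hmin⟩ := f.vars.exists_min_image id ⟨j, hj⟩
    have h1 : m ≤ j := hmin j hj
    have h2 := hmin _ (s_apply_mem_vars (hf (m - 1) (h _ (by omega))) hm)
    have h3 : s (m - 1) m = m - 1 := by simpa using s_apply_right (m - 1)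
    rw [h3] at h2
    simp only [id] at h2
    omega

theorem eq_C_of_dividedDiff_eq_zero {p : ℤ} {f : Qxa} (hf : killBelow p f = f)
    (h : ∀ i, p ≤ i → dividedDiff i f = 0) : f = MvPolynomial.C (f.coeff 0) :=
  eq_C_of_forall_permX (I := {i | p ≤ i}) (fun i hi => dividedDiff_eq_zero_iff.mp (h i hi))
    fun _ hj => Or.inl fun _ hk => (le_of_mem_vars_of_killBelow hf hj).trans hk

theorem eq_C_of_dividedDiff_eq_zero_of_ne_zero {f : Qxa}
    (h : ∀ i, i ≠ 0 → dividedDiff i f = 0) : f = MvPolynomial.C (f.coeff 0) := by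
  refine eq_C_of_forall_permX (I := {i | i ≠ 0})
    (fun i hi => dividedDiff_eq_zero_iff.mp (h i hi)) fun j _ => ?_
  rcases le_or_gt j 0 with hj | hj
  · exact Or.inr fun k hk => by simp only [Set.mem_ofPred_eq]; omega
  · exact Or.inl fun k hk => by simp only [Set.mem_ofPred_eq]; omega

theorem totalDegree_dividedDiff {i : ℤ} {f : Qxa} (h : dividedDiff i f ≠ 0) :
    (dividedDiff i f).totalDegree + 1 ≤ f.totalDegree := by
  have e := congrArg MvPolynomial.totalDegree (dividedDiff_spec i f)
  rw [MvPolynomial.totalDegree_mul_of_isDomain (x_sub_x_ne_zero i) h] at e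
  have h1 : (x i - x (i + 1)).totalDegree = 1 := by
    refine MvPolynomial.IsHomogeneous.totalDegree ?_ (x_sub_x_ne_zero i)
    exact (MvPolynomial.isHomogeneous_X _ _).sub (MvPolynomial.isHomogeneous_X _ _)
  have h2 := MvPolynomial.totalDegree_sub f (permX (s i) f)
  have h3 : (permX (s i) f).totalDegree ≤ f.totalDegree := MvPolynomial.totalDegree_rename_le _ _
  rw [max_eq_left h3] at h2
  omega

/-! ### Localization of double Schubert polynomials -/

/-- The permutations in `S_ℤ` that fix all integers `≤ 0`. -/
def PermPos : Set (Equiv.Perm ℤ) := {u | u ∈ SZ ∧ ∀ i ≤ 0, u i = i}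

theorem mul_s_mem_PermPos {u : Equiv.Perm ℤ} (hu : u ∈ PermPos) {i : ℤ} (hi : 1 ≤ i) :
    u * s i ∈ PermPos :=
  ⟨mul_s_mem_SZ hu.1 i, fun j hj => by
    rw [Equiv.Perm.mul_apply, s_apply_of_ne (by omega) (by omega), hu.2 j hj]⟩

theorem pos_apply_of_mem_PermPos {u : Equiv.Perm ℤ} (hu : u ∈ PermPos) {i : ℤ} (hi : 1 ≤ i) :
    1 ≤ u i := by
  by_contra h
  have := u.injective (hu.2 (u i) (by omega))
  omega

theorem len_mul_s_le {w : Equiv.Perm ℤ} (hw : w ∈ SZ) (i : ℤ) : len (w * s i) ≤ len w + 1 := by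
  rcases lt_or_gt_succ w i with h | h
  · exact (len_mul_s_of_lt hw h).le
  · have := len_mul_s_of_gt hw h
    omega

/-- Localization at `u`: the substitution `x_i ↦ a_{u(i)}`. -/
def eps (u : Equiv.Perm ℤ) : Qxa →ₐ[Qa] Qa := MvPolynomial.aeval fun i => MvPolynomial.X (u i)

theorem eps_x (u : Equiv.Perm ℤ) (i : ℤ) : eps u (x i) = MvPolynomial.X (u i) :=
  MvPolynomial.aeval_X _ _

theorem eps_a (u : Equiv.Perm ℤ) (i : ℤ) : eps u (a i) = MvPolynomial.X i :=
  MvPolynomial.aeval_C _ _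

theorem eps_C (u : Equiv.Perm ℤ) (c : Qa) : eps u (MvPolynomial.C c) = c :=
  MvPolynomial.aeval_C _ _

theorem eps_permX (u w : Equiv.Perm ℤ) (f : Qxa) : eps u (permX w f) = eps (u * w) f :=
  MvPolynomial.aeval_rename _ _ _

theorem eps_dividedDiff (u : Equiv.Perm ℤ) (i : ℤ) (f : Qxa) :
    (MvPolynomial.X (u i) - MvPolynomial.X (u (i + 1))) * eps u (dividedDiff i f) =
      eps u f - eps (u * s i) f := by
  rw [← eps_permX, ← map_sub, ← dividedDiff_spec, map_mul, map_sub, eps_x, eps_x]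

theorem X_sub_X_apply_ne_zero (u : Equiv.Perm ℤ) (i : ℤ) :
    (MvPolynomial.X (u i) - MvPolynomial.X (u (i + 1)) : Qa) ≠ 0 := by
  rw [sub_ne_zero]
  intro h
  have := u.injective (MvPolynomial.X_injective h)
  omega

theorem eps_dividedDiff_eq_zero {u : Equiv.Perm ℤ} {i : ℤ} {f : Qxa} (h₁ : eps u f = 0)
    (h₂ : eps (u * s i) f = 0) : eps u (dividedDiff i f) = 0 := by
  have h := eps_dividedDiff u i f
  rw [h₁, h₂, sub_zero] at h
  exact (mul_eq_zero.mp h).resolve_left (X_sub_X_apply_ne_zero u i)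

/-- A polynomial of degree at most `d` in `x_1, x_2, …` is determined by its localizations at the
permutations of the positive integers of length at most `d`. -/
theorem eq_zero_of_eps_eq_zero (d : ℕ) {f : Qxa} (hf : killBelow 1 f = f)
    (hd : f.totalDegree ≤ d) (h : ∀ u ∈ PermPos, len u ≤ d → eps u f = 0) : f = 0 := by
  induction d generalizing f with
  | zero =>
    rw [MvPolynomial.totalDegree_eq_zero_iff_eq_C.mp (Nat.le_zero.mp hd)] at h ⊢
    have := h 1 ⟨SZ.one_mem, fun _ _ => rfl⟩ len_one.le
    rw [eps_C] at this
    rw [this, map_zero]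
  | succ d ih =>
    have hC := eq_C_of_dividedDiff_eq_zero hf fun i hi => by
      by_contra hne
      have hdeg := totalDegree_dividedDiff hne
      refine hne (ih (killBelow_dividedDiff hi hf) (by omega) fun u hu hl => ?_)
      refine eps_dividedDiff_eq_zero (h u hu (by omega)) (h _ (mul_s_mem_PermPos hu hi) ?_)
      exact (len_mul_s_le hu.1 i).trans (by omega)
    have := h 1 ⟨SZ.one_mem, fun _ _ => rfl⟩ (by rw [len_one]; omega)
    rw [hC, eps_C] at this
    rw [hC, this, map_zero]

/-- The product of `a_{w(i)} - a_{w(j)}` over the inversions `(i, j)` of `w`, the localization at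
`w` of the double Schubert polynomial of `w`. -/
def invProd (w : Equiv.Perm ℤ) : Qa :=
  ∏ᶠ q ∈ inversions w, (MvPolynomial.X (w q.1) - MvPolynomial.X (w q.2))

theorem invProd_mul_s_of_lt {w : Equiv.Perm ℤ} (hw : w ∈ SZ) {i : ℤ} (h : w i < w (i + 1)) :
    invProd (w * s i) =
      (MvPolynomial.X (w (i + 1)) - MvPolynomial.X (w i)) * invProd w := by
  unfold invProd
  rw [inversions_mul_s_of_lt h, finprod_mem_insert _ (pair_notMem_image_inversions w i)
    ((inversions_finite hw).image _),
    finprod_mem_image (((s i).injective.prodMap (s i).injective).injOn)]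
  simp only [Equiv.Perm.mul_apply, s_apply_left, s_apply_right, Prod.map_fst, Prod.map_snd,
    s_s_apply]

theorem invProd_one : invProd 1 = 1 := by
  have h : inversions 1 = ∅ := by
    have := len_one
    rwa [len, Set.ncard_eq_zero (inversions_finite SZ.one_mem)] at this
  rw [invProd, h, finprod_mem_empty]

/-- The characterization of the double Schubert polynomial of `w`, a permutation fixing all
integers `≤ 0`, through its degree and its localizations at the permutations that are not longer
than `w`. -/
structure IsDoubleSchub (w : Equiv.Perm ℤ) (f : Qxa) : Prop where
  killBelow_eq : killBelow 1 f = f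
  totalDegree_le : f.totalDegree ≤ len w
  eps_eq_zero : ∀ u ∈ PermPos, len u ≤ len w → u ≠ w → eps u f = 0
  eps_self : eps w f = invProd w

theorem IsDoubleSchub.unique {w : Equiv.Perm ℤ} {f g : Qxa} (hf : IsDoubleSchub w f)
    (hg : IsDoubleSchub w g) : f = g := by
  rw [← sub_eq_zero]
  refine eq_zero_of_eps_eq_zero (len w) ?_ ?_ fun u hu hl => ?_
  · rw [map_sub, hf.killBelow_eq, hg.killBelow_eq]
  · exact (MvPolynomial.totalDegree_sub f g).trans (max_le hf.totalDegree_le hg.totalDegree_le)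
  · rw [map_sub, sub_eq_zero]
    by_cases h : u = w
    · rw [h, hf.eps_self, hg.eps_self]
    · rw [hf.eps_eq_zero u hu hl h, hg.eps_eq_zero u hu hl h]

theorem IsDoubleSchub.dividedDiff_of_gt {w : Equiv.Perm ℤ} (hw : w ∈ PermPos) {f : Qxa}
    (hf : IsDoubleSchub w f) {i : ℤ} (hi : 1 ≤ i) (h : w (i + 1) < w i) :
    IsDoubleSchub (w * s i) (dividedDiff i f) := by
  have hl := len_mul_s_of_gt hw.1 h
  have hv := mul_s_mem_PermPos hw hi
  refine ⟨killBelow_dividedDiff hi hf.killBelow_eq, ?_, fun u hu hlu hne => ?_, ?_⟩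
  · by_cases h0 : dividedDiff i f = 0
    · rw [h0, MvPolynomial.totalDegree_zero]; exact Nat.zero_le _
    · have := totalDegree_dividedDiff h0
      have := hf.totalDegree_le
      omega
  · have := len_mul_s_le hu.1 i
    refine eps_dividedDiff_eq_zero (hf.eps_eq_zero u hu (by omega) ?_)
      (hf.eps_eq_zero _ (mul_s_mem_PermPos hu hi) (by omega) ?_)
    · rintro rfl; omega
    · rintro rfl; exact hne (mul_s_mul_s u i).symm
  · have h' : (w * s i) i < (w * s i) (i + 1) := by
      simpa only [Equiv.Perm.mul_apply, s_apply_left, s_apply_right] using h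
    have e := eps_dividedDiff (w * s i) i f
    have e' := invProd_mul_s_of_lt hv.1 h'
    rw [mul_s_mul_s] at e e'
    rw [hf.eps_eq_zero _ hv (by omega) (by rintro e; rw [e] at hl; omega), hf.eps_self, e'] at e
    refine mul_left_cancel₀ (X_sub_X_apply_ne_zero (w * s i) i) (e.trans ?_)
    ring

/-- At an ascent of `w` the divided difference of `𝔖_w` has degree less than `ℓ(w)` and vanishes
under all localizations at permutations of smaller length than `w`. -/
theorem IsDoubleSchub.dividedDiff_of_lt {w : Equiv.Perm ℤ} (hw : w ∈ PermPos) {f : Qxa}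
    (hf : IsDoubleSchub w f) {i : ℤ} (hi : 1 ≤ i) (h : w i < w (i + 1)) :
    dividedDiff i f = 0 := by
  by_contra hne
  have hl := len_mul_s_of_lt hw.1 h
  have hdeg := totalDegree_dividedDiff hne
  have hd := hf.totalDegree_le
  obtain ⟨d, hd'⟩ : ∃ d, len w = d + 1 := ⟨len w - 1, by omega⟩
  refine hne (eq_zero_of_eps_eq_zero d (killBelow_dividedDiff hi hf.killBelow_eq) (by omega)
    fun u hu hlu => ?_)
  have := len_mul_s_le hu.1 i
  refine eps_dividedDiff_eq_zero (hf.eps_eq_zero u hu (by omega) ?_)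
    (hf.eps_eq_zero _ (mul_s_mem_PermPos hu hi) (by omega) ?_)
  · rintro rfl; omega
  · rintro rfl
    rw [mul_s_mul_s] at hl
    omega

open Classical in
theorem IsDoubleSchub.eps_one {w : Equiv.Perm ℤ} {f : Qxa} (hf : IsDoubleSchub w f) :
    eps 1 f = if w = 1 then 1 else 0 := by
  split_ifs with h
  · rw [h] at hf
    rw [hf.eps_self, invProd_one]
  · exact hf.eps_eq_zero 1 ⟨SZ.one_mem, fun _ _ => rfl⟩ (by rw [len_one]; omega) (Ne.symm h)

/-! ### The longest element -/

/-- The staircase of all `(i, j)` with `i, j ≥ 1` and `i + j ≤ n`. -/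
def staircase (n : ℕ) : Finset (ℕ × ℕ) :=
  (Finset.Icc 1 n ×ˢ Finset.Icc 1 n).filter fun q => q.1 + q.2 ≤ n

theorem mem_staircase {n : ℕ} {q : ℕ × ℕ} :
    q ∈ staircase n ↔ 1 ≤ q.1 ∧ 1 ≤ q.2 ∧ q.1 + q.2 ≤ n := by
  simp only [staircase, Finset.mem_filter, Finset.mem_product, Finset.mem_Icc]
  omega

theorem topSchub_eq_prod_staircase (n : ℕ) :
    topSchub n = ∏ q ∈ staircase n, (x (q.1 : ℤ) - a (q.2 : ℤ)) := by
  rw [staircase, Finset.prod_filter, Finset.prod_product, topSchub]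

/-- The map from a cell `(i, j)` to the positions of the values `u(i)` and `j` in `u`. -/
def cellPositions (u : Equiv.Perm ℤ) (q : ℕ × ℕ) : ℤ × ℤ := (q.1, u.symm q.2)

theorem cellPositions_injective (u : Equiv.Perm ℤ) : Function.Injective (cellPositions u) := by
  rintro ⟨i, j⟩ ⟨i', j'⟩ h
  simp only [cellPositions, Prod.mk.injEq] at h
  have h2 := u.symm.injective h.2
  simp only [Prod.mk.injEq]
  omega

/-- If `u(i) ≠ j` for all cells `(i, j)` of the staircase, then each cell gives an inversion of
`u`. -/
theorem image_cellPositions_subset {u : Equiv.Perm ℤ} (hu : u ∈ PermPos) {n : ℕ}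
    (h : ∀ q ∈ staircase n, u q.1 ≠ q.2) :
    cellPositions u '' (staircase n) ⊆ inversions u := by
  rintro _ ⟨⟨i, j⟩, hq, rfl⟩
  rw [Finset.mem_coe, mem_staircase] at hq
  simp only at hq
  have hne : ∀ i' j' : ℤ, 1 ≤ i' → 1 ≤ j' → i' + j' ≤ n → u i' ≠ j' := fun i' j' h1 h2 h3 => by
    have := h (i'.toNat, j'.toNat)
      (mem_staircase.mpr ⟨by simp only; omega, by simp only; omega, by simp only; omega⟩)
    simpa only [Int.toNat_of_nonneg (show 0 ≤ i' by omega),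
      Int.toNat_of_nonneg (show 0 ≤ j' by omega)] using this
  obtain ⟨k, hk⟩ : ∃ k, u.symm j = k := ⟨_, rfl⟩
  have hk' : u k = j := by rw [← hk, Equiv.apply_symm_apply]
  have hk1 : 1 ≤ k := by
    by_contra hc
    have := hu.2 k (by omega)
    omega
  have hi1 := pos_apply_of_mem_PermPos hu (i := i) (by omega)
  have hik : (i : ℤ) < k := by
    by_contra hc
    exact hne k j hk1 (by omega) (by omega) hk'
  have hlt : (j : ℤ) < u i := by
    by_contra hc
    exact hne i (u i) (by omega) hi1 (by omega) rfl
  change (i : ℤ) < u.symm j ∧ u (u.symm j) < u i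
  rw [hk, hk']
  exact ⟨hik, hlt⟩

/-- The longest element of `S_n`, as the permutation with descents at `1, …, n - 1` that fixes
everything outside `[1, n]`, is `i ↦ n + 1 - i` there. -/
theorem apply_eq_of_forall_gt {w : Equiv.Perm ℤ} {n : ℕ} (h₁ : ∀ i ≤ 0, w i = i)
    (h₂ : ∀ i : ℤ, n < i → w i = i) (h : ∀ i : ℤ, 1 ≤ i → i < n → w (i + 1) < w i) {i : ℤ}
    (hi : 1 ≤ i) (hin : i ≤ n) : w i = n + 1 - i := by
  have hmem : ∀ i : ℤ, 1 ≤ i → i ≤ n → 1 ≤ w i ∧ w i ≤ n := fun i hi hin => by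
    constructor
    · by_contra hc
      have := w.injective (h₁ (w i) (by omega))
      omega
    · by_contra hc
      have := w.injective (h₂ (w i) (by omega))
      omega
  have up : ∀ k : ℕ, ∀ i : ℤ, i = k + 1 → i ≤ n → w i ≤ n + 1 - i := by
    intro k
    induction k with
    | zero => exact fun i hi hin => by have := (hmem i (by omega) hin).2; omega
    | succ k ih =>
      intro i hi hin
      have h1 := ih (i - 1) (by push_cast at hi; omega) (by omega)
      have h2 := h (i - 1) (by push_cast at hi; omega) (by omega)
      rw [sub_add_cancel] at h2
      omega
  have down : ∀ k : ℕ, ∀ i : ℤ, i = n - k → 1 ≤ i → n + 1 - i ≤ w i := by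
    intro k
    induction k with
    | zero => exact fun i hi hin => by have := (hmem i hin (by omega)).1; push_cast at hi; omega
    | succ k ih =>
      intro i hi hin
      have h1 := ih (i + 1) (by push_cast at hi; omega) (by omega)
      have h2 := h i hin (by push_cast at hi; omega)
      omega
  have := up (i - 1).toNat i (by omega) hin
  have := down (n - i).toNat i (by omega) hi
  omega

theorem inversions_eq_image_cellPositions {w : Equiv.Perm ℤ} (hw : w ∈ PermPos) {n : ℕ}
    (h₂ : ∀ i : ℤ, n < i → w i = i) (h : ∀ i : ℤ, 1 ≤ i → i < n → w (i + 1) < w i) :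
    inversions w = cellPositions w '' (staircase n) := by
  have hval := fun i => apply_eq_of_forall_gt (i := i) hw.2 h₂ h
  refine Set.Subset.antisymm ?_ (image_cellPositions_subset hw ?_)
  · rintro ⟨i, k⟩ ⟨hik, hlt⟩
    simp only at hik hlt
    have hi : 1 ≤ i := by
      by_contra hc
      have e1 := hw.2 i (by omega)
      have e2 := w.injective (hw.2 (w k) (by omega))
      omega
    have hk : k ≤ n := by
      by_contra hc
      have e1 := h₂ k (by omega)
      have e2 := w.injective (h₂ (w i) (by omega))
      omega
    have ek := hval k (by omega) hk
    refine ⟨(i.toNat, (w k).toNat), ?_, ?_⟩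
    · rw [Finset.mem_coe, mem_staircase]
      simp only
      omega
    · simp only [cellPositions, Int.toNat_of_nonneg (show 0 ≤ i by omega),
        Int.toNat_of_nonneg (show 0 ≤ w k by omega), Equiv.symm_apply_apply]
  · intro q hq
    rw [mem_staircase] at hq
    have := hval q.1 (by omega) (by omega)
    omega

/-- A permutation that is not longer than the longest element `w` of `S_n` and avoids the
staircase has the inversions of `w`. -/
theorem eq_of_forall_staircase_ne {u w : Equiv.Perm ℤ} (hu : u ∈ PermPos) (hw : w ∈ PermPos)
    {n : ℕ} (h₂ : ∀ i : ℤ, n < i → w i = i)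
    (h : ∀ i : ℤ, 1 ≤ i → i < n → w (i + 1) < w i) (hl : len u ≤ len w)
    (hne : ∀ q ∈ staircase n, u q.1 ≠ q.2) : u = w := by
  have hval := fun i => apply_eq_of_forall_gt (i := i) hw.2 h₂ h
  have hinv := inversions_eq_image_cellPositions hw h₂ h
  have hinvu : cellPositions u '' (staircase n) = inversions u := by
    refine Set.eq_of_subset_of_ncard_le (image_cellPositions_subset hu hne) ?_
      (inversions_finite hu.1)
    rw [Set.ncard_image_of_injective _ (cellPositions_injective u),
      ← Set.ncard_image_of_injective _ (cellPositions_injective w), ← hinv]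
    exact hl
  have huval : ∀ k : ℕ, 1 ≤ k → k ≤ n → u k = n + 1 - k := by
    intro k
    induction k using Nat.strong_induction_on with
    | _ k ih =>
      intro hk hkn
      have hpos := pos_apply_of_mem_PermPos hu (i := k) (by omega)
      have hge : (n : ℤ) + 1 - k ≤ u k := by
        by_contra hc
        refine hne (k, (u k).toNat) (mem_staircase.mpr ?_) ?_
        · simp only; omega
        · simp only; omega
      by_contra hc
      obtain ⟨j, hj⟩ := u.surjective (n + 1 - k)
      have hj1 : 1 ≤ j := by
        by_contra hc'
        have := hu.2 j (by omega)
        omega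
      have hkj : (k : ℤ) < j := by
        by_contra hc'
        rcases eq_or_ne j k with e | e
        · subst e; omega
        · have := ih j.toNat (by omega) (by omega) (by omega)
          rw [Int.toNat_of_nonneg (by omega)] at this
          omega
      have hmem : ((k : ℤ), j) ∈ inversions u := ⟨hkj, by simp only; omega⟩
      rw [← hinvu] at hmem
      obtain ⟨q, hq, e⟩ := hmem
      simp only [cellPositions, Prod.mk.injEq, Equiv.symm_apply_eq] at e
      rw [Finset.mem_coe, mem_staircase] at hq
      omega
  refine inversions_injOn hu.1 hw.1 ?_
  rw [← hinvu, hinv]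
  refine Set.image_congr fun q hq => ?_
  rw [Finset.mem_coe, mem_staircase] at hq
  simp only [cellPositions, Prod.mk.injEq, true_and]
  rw [Equiv.symm_apply_eq, eq_comm]
  have e : w.symm q.2 = ((n + 1 - q.2 : ℕ) : ℤ) := by
    rw [Equiv.symm_apply_eq, hval _ (by omega) (by omega)]
    omega
  rw [e, huval _ (by omega) (by omega)]
  omega

theorem isDoubleSchub_topSchub {w : Equiv.Perm ℤ} (hw : w ∈ PermPos) {n : ℕ}
    (h₂ : ∀ i : ℤ, n < i → w i = i) (h : ∀ i : ℤ, 1 ≤ i → i < n → w (i + 1) < w i) :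
    IsDoubleSchub w (topSchub n) := by
  have hinv := inversions_eq_image_cellPositions hw h₂ h
  have hlen : len w = (staircase n).card := by
    rw [len, hinv, Set.ncard_image_of_injective _ (cellPositions_injective w),
      Set.ncard_coe_finset]
  rw [topSchub_eq_prod_staircase]
  refine ⟨?_, ?_, fun u hu hl hne => ?_, ?_⟩
  · rw [map_prod]
    refine Finset.prod_congr rfl fun q hq => ?_
    rw [mem_staircase] at hq
    rw [map_sub, killBelow_x, if_pos (by omega)]
    congr 1
    exact MvPolynomial.algHom_C _ _
  · refine (MvPolynomial.totalDegree_finsetProd _ _).trans ?_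
    rw [hlen, Finset.card_eq_sum_ones]
    refine Finset.sum_le_sum fun q _ => (MvPolynomial.totalDegree_sub _ _).trans (max_le ?_ ?_)
    · exact (MvPolynomial.totalDegree_X _).le
    · exact (MvPolynomial.totalDegree_C _).le.trans zero_le_one
  · contrapose! hne
    refine eq_of_forall_staircase_ne hu hw h₂ h hl fun q hq e => hne ?_
    rw [map_prod]
    exact Finset.prod_eq_zero hq (by rw [map_sub, eps_x, eps_a, e, sub_self])
  · rw [invProd, hinv, finprod_mem_image (cellPositions_injective w).injOn,
      finprod_mem_coe_finset, map_prod]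
    refine Finset.prod_congr rfl fun q _ => ?_
    rw [map_sub, eps_x, eps_a, cellPositions, Equiv.apply_symm_apply]

/-! ### The recursion for double Schubert polynomials -/

theorem len_le_choose {w : Equiv.Perm ℤ} {n : ℕ} (h₁ : ∀ i ≤ 0, w i = i)
    (h₂ : ∀ i : ℤ, n < i → w i = i) : len w ≤ n.choose 2 := by
  have hsub : inversions w ⊆
      ((Finset.range n).sigma fun j => Finset.range j).image
        fun q => ((q.2 : ℤ) + 1, (q.1 : ℤ) + 1) := by
    rintro ⟨i, k⟩ ⟨hik, hlt⟩
    simp only at hik hlt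
    have hi : 1 ≤ i := by
      by_contra hc
      have e1 := h₁ i (by omega)
      have e2 := w.injective (h₁ (w k) (by omega))
      omega
    have hk : k ≤ n := by
      by_contra hc
      have e1 := h₂ k (by omega)
      have e2 := w.injective (h₂ (w i) (by omega))
      omega
    rw [Finset.mem_coe, Finset.mem_image]
    refine ⟨⟨(k - 1).toNat, (i - 1).toNat⟩, ?_, ?_⟩
    · simp only [Finset.mem_sigma, Finset.mem_range]
      omega
    · simp only [Prod.mk.injEq]
      omega
  refine (Set.ncard_le_ncard hsub (Finset.finite_toSet _)).trans ?_
  rw [Set.ncard_coe_finset]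
  refine Finset.card_image_le.trans ?_
  simp only [Finset.card_sigma, Finset.card_range]
  rw [Finset.sum_range_id, Nat.choose_two_right]

/-- The hypothesis on `k` ensures that the recursion does not run out of steps. -/
theorem isDoubleSchub_doubleSchubAux {n : ℕ} (k : ℕ) {w : Equiv.Perm ℤ} (hw : w ∈ PermPos)
    (h₂ : ∀ i : ℤ, n < i → w i = i) (hk : n.choose 2 ≤ len w + k) :
    IsDoubleSchub w (doubleSchubAux n k w) := by
  have hstep : ∀ v : Equiv.Perm ℤ, v ∈ PermPos → (∀ i : ℤ, n < i → v i = i) → ∀ i : ℤ, 1 ≤ i →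
      i < n → ∀ j : ℤ, n < j → (v * s i) j = j := fun v hv hv2 i hi hin j hj => by
    rw [Equiv.Perm.mul_apply, s_apply_of_ne (by omega) (by omega), hv2 j hj]
  induction k generalizing w with
  | zero =>
    refine isDoubleSchub_topSchub hw h₂ fun i hi hin => ?_
    refine (lt_or_gt_succ w i).resolve_left fun hlt => ?_
    have h1 := len_mul_s_of_lt hw.1 hlt
    have h2 := len_le_choose (mul_s_mem_PermPos hw hi).2 (hstep w hw h₂ i hi hin)
    omega
  | succ k ih =>
    unfold doubleSchubAux
    split_ifs with h
    · obtain ⟨hi, hin, hl⟩ := h.choose_spec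
      set i := h.choose
      have hlt := (len_mul_s_lt_iff hw.1 i).mp hl
      have hl' := len_mul_s_of_lt hw.1 hlt
      have hv := mul_s_mem_PermPos hw hi
      have := (ih hv (hstep w hw h₂ i hi hin) (by omega)).dividedDiff_of_gt hv hi (by
        simpa only [Equiv.Perm.mul_apply, s_apply_left, s_apply_right] using hlt)
      rwa [mul_s_mul_s] at this
    · refine isDoubleSchub_topSchub hw h₂ fun i hi hin => ?_
      refine (lt_or_gt_succ w i).resolve_left fun hlt => h ⟨i, hi, hin, ?_⟩
      exact (len_mul_s_lt_iff hw.1 i).mpr hlt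

theorem isDoubleSchub_doubleSchub {w : Equiv.Perm ℤ} (hw : w ∈ PermPos) :
    IsDoubleSchub w (doubleSchub w) := by
  refine isDoubleSchub_doubleSchubAux _ hw ?_ (Nat.le_add_left _ _)
  have hne : {n : ℕ | ∀ i : ℤ, (n : ℤ) < i → w i = i}.Nonempty := by
    obtain ⟨N, hN⟩ := exists_bound hw.1
    exact ⟨N.toNat, fun i hi => hN i (by omega)⟩
  exact Nat.sInf_mem hne

theorem dividedDiff_doubleSchub {w : Equiv.Perm ℤ} (hw : w ∈ PermPos) {i : ℤ} (hi : 1 ≤ i) :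
    dividedDiff i (doubleSchub w) = if w (i + 1) < w i then doubleSchub (w * s i) else 0 := by
  have h := isDoubleSchub_doubleSchub hw
  split_ifs with hd
  · exact (h.dividedDiff_of_gt hw hi hd).unique
      (isDoubleSchub_doubleSchub (mul_s_mem_PermPos hw hi))
  · exact h.dividedDiff_of_lt hw hi ((lt_or_gt_succ w i).resolve_right hd)

/-! ### Shifted double Schubert polynomials -/

theorem shiftPerm_apply (m : ℤ) (w : Equiv.Perm ℤ) (i : ℤ) :
    shiftPerm m w i = w (i - m) + m := by
  simp [shiftPerm, sub_eq_add_neg]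

theorem shiftPerm_mul (m : ℤ) (u v : Equiv.Perm ℤ) :
    shiftPerm m (u * v) = shiftPerm m u * shiftPerm m v := by
  unfold shiftPerm
  group

theorem shiftPerm_mem_SZ (m : ℤ) {w : Equiv.Perm ℤ} (hw : w ∈ SZ) : shiftPerm m w ∈ SZ := by
  induction hw using Subgroup.closure_induction with
  | mem x hx =>
    obtain ⟨i, rfl⟩ := hx
    rw [shiftPerm_s]
    exact s_mem_SZ _
  | one =>
    have : shiftPerm m 1 = 1 := by unfold shiftPerm; group
    rw [this]
    exact SZ.one_mem
  | mul x y _ _ hx hy => rw [shiftPerm_mul]; exact SZ.mul_mem hx hy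
  | inv x _ hx =>
    have : shiftPerm m x⁻¹ = (shiftPerm m x)⁻¹ := by unfold shiftPerm; group
    rw [this]
    exact SZ.inv_mem hx

theorem len_shiftPerm (m : ℤ) (w : Equiv.Perm ℤ) : len (shiftPerm m w) = len w := by
  have h : inversions (shiftPerm m w) =
      Prod.map (Equiv.addRight m) (Equiv.addRight m) '' inversions w := by
    ext ⟨j, k⟩
    simp only [inversions, Set.mem_ofPred_eq, Set.mem_image, shiftPerm_apply, Prod.exists,
      Prod.map_apply, Prod.mk.injEq, Equiv.coe_addRight]
    constructor
    · rintro ⟨h1, h2⟩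
      exact ⟨j - m, k - m, ⟨by omega, by omega⟩, by omega, by omega⟩
    · rintro ⟨j', k', ⟨h1, h2⟩, rfl, rfl⟩
      rw [add_sub_cancel_right, add_sub_cancel_right]
      omega
  rw [len, h, Set.ncard_image_of_injective _
    ((Equiv.addRight m).injective.prodMap (Equiv.addRight m).injective), len]

theorem shiftPerm_eq_one_iff {m : ℤ} {w : Equiv.Perm ℤ} : shiftPerm m w = 1 ↔ w = 1 := by
  unfold shiftPerm
  rw [conj_eq_one_iff]

/-- The permutations in `S_ℤ` that fix all integers below `p`. -/
def PermGE (p : ℤ) : Set (Equiv.Perm ℤ) := {w | w ∈ SZ ∧ ∀ i < p, w i = i}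

theorem mul_s_mem_PermGE {p : ℤ} {w : Equiv.Perm ℤ} (hw : w ∈ PermGE p) {i : ℤ} (hi : p ≤ i) :
    w * s i ∈ PermGE p :=
  ⟨mul_s_mem_SZ hw.1 i, fun j hj => by
    rw [Equiv.Perm.mul_apply, s_apply_of_ne (by omega) (by omega), hw.2 j hj]⟩

theorem PermGE_anti {p p' : ℤ} (h : p' ≤ p) : PermGE p ⊆ PermGE p' :=
  fun _ hw => ⟨hw.1, fun i hi => hw.2 i (by omega)⟩

theorem shiftPerm_mem_PermPos {p : ℤ} {w : Equiv.Perm ℤ} (hw : w ∈ PermGE p) :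
    shiftPerm (1 - p) w ∈ PermPos :=
  ⟨shiftPerm_mem_SZ _ hw.1, fun i hi => by
    rw [shiftPerm_apply, hw.2 _ (by omega), sub_add_cancel]⟩

theorem shiftPoly_x (m i : ℤ) : shiftPoly m (x i) = x (i + m) :=
  MvPolynomial.eval₂Hom_X' _ _ _

theorem shiftPoly_C (m : ℤ) (c : Qa) :
    shiftPoly m (MvPolynomial.C c) = MvPolynomial.C (MvPolynomial.rename (· + m) c) := by
  have h : (MvPolynomial.aeval fun i : ℤ => a (i + m) : Qa →ₐ[ℚ] Qxa) =
      (IsScalarTower.toAlgHom ℚ Qa Qxa).comp (MvPolynomial.rename (· + m)) := by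
    refine MvPolynomial.algHom_ext fun i => ?_
    rw [MvPolynomial.aeval_X, AlgHom.comp_apply, MvPolynomial.rename_X]
    rfl
  refine (MvPolynomial.eval₂Hom_C _ _ _).trans ?_
  change (MvPolynomial.aeval fun i : ℤ => a (i + m) : Qa →ₐ[ℚ] Qxa) c = _
  rw [h]
  rfl

theorem shiftPoly_permX (m i : ℤ) (f : Qxa) :
    shiftPoly m (permX (s i) f) = permX (s (i + m)) (shiftPoly m f) := by
  suffices h : (shiftPoly m).comp (permX (s i)).toRingHom =
      (permX (s (i + m))).toRingHom.comp (shiftPoly m) from DFunLike.congr_fun h f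
  refine MvPolynomial.ringHom_ext (fun c => ?_) fun j => ?_
  · change shiftPoly m (permX (s i) (MvPolynomial.C c)) =
      permX (s (i + m)) (shiftPoly m (MvPolynomial.C c))
    rw [MvPolynomial.algHom_C, shiftPoly_C, MvPolynomial.algHom_C]
    exact shiftPoly_C m c
  · change shiftPoly m (permX (s i) (x j)) = permX (s (i + m)) (shiftPoly m (x j))
    rw [permX_x, shiftPoly_x, shiftPoly_x, permX_x, s_apply, s_apply]
    congr 1
    split_ifs <;> omega

theorem shiftPoly_dividedDiff (m i : ℤ) (f : Qxa) :
    shiftPoly m (dividedDiff i f) = dividedDiff (i + m) (shiftPoly m f) :=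
  map_dividedDiff _ (shiftPoly_permX m i)
    (by rw [map_sub, shiftPoly_x, shiftPoly_x, add_right_comm]) f

theorem killBelow_shiftPoly (p m : ℤ) (f : Qxa) :
    killBelow (p + m) (shiftPoly m f) = shiftPoly m (killBelow p f) := by
  suffices h : (killBelow (p + m)).toRingHom.comp (shiftPoly m) =
      (shiftPoly m).comp (killBelow p).toRingHom from DFunLike.congr_fun h f
  refine MvPolynomial.ringHom_ext (fun c => ?_) fun j => ?_
  · change killBelow (p + m) (shiftPoly m (MvPolynomial.C c)) =
      shiftPoly m (killBelow p (MvPolynomial.C c))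
    rw [MvPolynomial.algHom_C, shiftPoly_C, MvPolynomial.algHom_C]
    exact (shiftPoly_C m c).symm
  · change killBelow (p + m) (shiftPoly m (x j)) = shiftPoly m (killBelow p (x j))
    rw [shiftPoly_x, killBelow_x, killBelow_x, apply_ite (shiftPoly m), map_zero, shiftPoly_x]
    simp only [add_le_add_iff_right]

theorem totalDegree_shiftPoly_le (m : ℤ) (f : Qxa) :
    (shiftPoly m f).totalDegree ≤ f.totalDegree := by
  have h : shiftPoly m = ((MvPolynomial.rename (· + m) : Qxa →ₐ[Qa] Qxa) : Qxa →+* Qxa).comp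
      (MvPolynomial.map ((MvPolynomial.rename (· + m) : Qa →ₐ[ℚ] Qa) : Qa →+* Qa)) := by
    refine MvPolynomial.ringHom_ext (fun c => ?_) fun j => ?_
    · rw [shiftPoly_C, RingHom.comp_apply, MvPolynomial.map_C]
      exact (MvPolynomial.rename_C _ _).symm
    · rw [RingHom.comp_apply, MvPolynomial.map_X]
      change shiftPoly m (x j) = permX (Equiv.addRight m) (x j)
      rw [shiftPoly_x, permX_x, Equiv.coe_addRight]
  rw [h]
  exact (MvPolynomial.totalDegree_rename_le _ _).trans
    (MvPolynomial.totalDegree_le_of_support_subset (MvPolynomial.support_map_subset _ _))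

theorem eps_one_shiftPoly (m : ℤ) (f : Qxa) :
    eps 1 (shiftPoly m f) = MvPolynomial.rename (· + m) (eps 1 f) := by
  suffices h : (eps 1).toRingHom.comp (shiftPoly m) =
      ((MvPolynomial.rename (· + m) : Qa →ₐ[ℚ] Qa) : Qa →+* Qa).comp (eps 1).toRingHom from
    DFunLike.congr_fun h f
  refine MvPolynomial.ringHom_ext (fun c => ?_) fun j => ?_
  · change eps 1 (shiftPoly m (MvPolynomial.C c)) = MvPolynomial.rename _ (eps 1 (MvPolynomial.C c))
    rw [shiftPoly_C, eps_C, eps_C]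
  · change eps 1 (shiftPoly m (x j)) = MvPolynomial.rename _ (eps 1 (x j))
    rw [shiftPoly_x, eps_x, eps_x, MvPolynomial.rename_X]
    rfl

theorem dividedDiff_intervalSchub {p q : ℤ} {w : Equiv.Perm ℤ} (hw : w ∈ PermGE p) {i : ℤ}
    (hi : p ≤ i) : dividedDiff i (intervalSchub p q w) =
      if w (i + 1) < w i then intervalSchub p q (w * s i) else 0 := by
  have h := dividedDiff_doubleSchub (shiftPerm_mem_PermPos hw) (i := i - (p - 1)) (by omega)
  have h' := shiftPoly_dividedDiff (p - 1) (i - (p - 1)) (doubleSchub (shiftPerm (1 - p) w))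
  rw [sub_add_cancel] at h'
  rw [intervalSchub, ← h', h, apply_ite (shiftPoly (p - 1)), map_zero, intervalSchub,
    shiftPerm_mul, shiftPerm_s, shiftPerm_apply, shiftPerm_apply]
  have e1 : i - (p - 1) + 1 - (1 - p) = i + 1 := by ring
  have e2 : i - (p - 1) - (1 - p) = i := by ring
  have e3 : i - (p - 1) = i + (1 - p) := by ring
  exact if_congr (by rw [e1, e2, add_lt_add_iff_right]) (by rw [e3]) rfl

theorem killBelow_intervalSchub {p q : ℤ} {w : Equiv.Perm ℤ} (hw : w ∈ PermGE p) :
    killBelow p (intervalSchub p q w) = intervalSchub p q w := by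
  have h := killBelow_shiftPoly 1 (p - 1) (doubleSchub (shiftPerm (1 - p) w))
  rwa [(isDoubleSchub_doubleSchub (shiftPerm_mem_PermPos hw)).killBelow_eq,
    add_sub_cancel] at h

theorem totalDegree_intervalSchub_le {p q : ℤ} {w : Equiv.Perm ℤ} (hw : w ∈ PermGE p) :
    (intervalSchub p q w).totalDegree ≤ len w :=
  (totalDegree_shiftPoly_le _ _).trans
    ((isDoubleSchub_doubleSchub (shiftPerm_mem_PermPos hw)).totalDegree_le.trans
      (len_shiftPerm _ _).le)

open Classical in
theorem eps_one_intervalSchub {p q : ℤ} {w : Equiv.Perm ℤ} (hw : w ∈ PermGE p) :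
    eps 1 (intervalSchub p q w) = if w = 1 then 1 else 0 := by
  rw [intervalSchub, eps_one_shiftPoly,
    (isDoubleSchub_doubleSchub (shiftPerm_mem_PermPos hw)).eps_one]
  simp only [shiftPerm_eq_one_iff]
  split_ifs
  · exact map_one _
  · exact map_zero _

/-! ### Double Schubert polynomials of `S_{≠0}` -/

theorem omegaPerm_apply (w : Equiv.Perm ℤ) (i : ℤ) : omegaPerm w i = 1 - w (1 - i) := by
  have h : ((Equiv.subLeft 1 : Equiv.Perm ℤ)⁻¹ : Equiv.Perm ℤ) i = 1 - i := by
    rw [Equiv.Perm.inv_eq_iff_eq, Equiv.subLeft_apply]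
    ring
  rw [omegaPerm, Equiv.Perm.mul_apply, Equiv.Perm.mul_apply, h, Equiv.subLeft_apply]

theorem omegaPerm_mul (u v : Equiv.Perm ℤ) : omegaPerm (u * v) = omegaPerm u * omegaPerm v := by
  unfold omegaPerm
  group

theorem omegaPerm_eq_one_iff {w : Equiv.Perm ℤ} : omegaPerm w = 1 ↔ w = 1 := by
  unfold omegaPerm
  rw [conj_eq_one_iff]

theorem omegaPerm_mem_SZ {w : Equiv.Perm ℤ} (hw : w ∈ SZ) : omegaPerm w ∈ SZ := by
  induction hw using Subgroup.closure_induction with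
  | mem x hx =>
    obtain ⟨i, rfl⟩ := hx
    rw [omegaPerm_s]
    exact s_mem_SZ _
  | one =>
    rw [omegaPerm_eq_one_iff.mpr rfl]
    exact SZ.one_mem
  | mul x y _ _ hx hy => rw [omegaPerm_mul]; exact SZ.mul_mem hx hy
  | inv x _ hx =>
    have : omegaPerm x⁻¹ = (omegaPerm x)⁻¹ := by unfold omegaPerm; group
    rw [this]
    exact SZ.inv_mem hx

theorem mem_PermPos_of_mem_SPlus {v : Equiv.Perm ℤ} (hv : v ∈ SPlus) : v ∈ PermPos :=
  ⟨SPlus_le_SZ hv, SPlus_apply hv⟩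

theorem omegaPerm_mem_PermPos {u : Equiv.Perm ℤ} (hu : u ∈ SMinus) : omegaPerm u ∈ PermPos :=
  ⟨omegaPerm_mem_SZ (SMinus_le_SZ hu), fun i hi => by
    rw [omegaPerm_apply, SMinus_apply hu _ (by omega)]
    ring⟩

theorem omegaPoly_x (i : ℤ) : omegaPoly (x i) = -x (1 - i) := MvPolynomial.eval₂Hom_X' _ _ _

theorem omegaPoly_C (c : Qa) : omegaPoly (MvPolynomial.C c) =
    MvPolynomial.C ((MvPolynomial.aeval fun i => -MvPolynomial.X (1 - i) : Qa →ₐ[ℚ] Qa) c) := by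
  have h : (MvPolynomial.aeval fun i : ℤ => -a (1 - i) : Qa →ₐ[ℚ] Qxa) =
      (IsScalarTower.toAlgHom ℚ Qa Qxa).comp
        (MvPolynomial.aeval fun i => -MvPolynomial.X (1 - i)) := by
    refine MvPolynomial.algHom_ext fun i => ?_
    rw [MvPolynomial.aeval_X, AlgHom.comp_apply, MvPolynomial.aeval_X, map_neg]
    rfl
  refine (MvPolynomial.eval₂Hom_C _ _ _).trans ?_
  change (MvPolynomial.aeval fun i : ℤ => -a (1 - i) : Qa →ₐ[ℚ] Qxa) c = _
  rw [h]
  rfl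

theorem omegaPoly_permX (i : ℤ) (f : Qxa) :
    omegaPoly (permX (s i) f) = permX (s (-i)) (omegaPoly f) := by
  suffices h : omegaPoly.comp (permX (s i)).toRingHom =
      (permX (s (-i))).toRingHom.comp omegaPoly from DFunLike.congr_fun h f
  refine MvPolynomial.ringHom_ext (fun c => ?_) fun j => ?_
  · change omegaPoly (permX (s i) (MvPolynomial.C c)) =
      permX (s (-i)) (omegaPoly (MvPolynomial.C c))
    rw [MvPolynomial.algHom_C, omegaPoly_C, MvPolynomial.algHom_C]
    exact omegaPoly_C c
  · change omegaPoly (permX (s i) (x j)) = permX (s (-i)) (omegaPoly (x j))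
    rw [permX_x, omegaPoly_x, omegaPoly_x, map_neg, permX_x, s_apply, s_apply]
    congr 2
    split_ifs <;> omega

theorem omegaPoly_dividedDiff (i : ℤ) (f : Qxa) :
    omegaPoly (dividedDiff i f) = dividedDiff (-i) (omegaPoly f) :=
  map_dividedDiff _ (omegaPoly_permX i)
    (by
      rw [map_sub, omegaPoly_x, omegaPoly_x]
      have h1 : 1 - (i + 1) = -i := by ring
      have h2 : 1 - i = -i + 1 := by ring
      rw [h1, h2]
      ring) f

theorem eps_one_omegaPoly (f : Qxa) : eps 1 (omegaPoly f) =
    (MvPolynomial.aeval fun i => -MvPolynomial.X (1 - i) : Qa →ₐ[ℚ] Qa) (eps 1 f) := by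
  suffices h : (eps 1).toRingHom.comp omegaPoly =
      (MvPolynomial.aeval fun i => -MvPolynomial.X (1 - i) : Qa →ₐ[ℚ] Qa).toRingHom.comp
        (eps 1).toRingHom from DFunLike.congr_fun h f
  refine MvPolynomial.ringHom_ext (fun c => ?_) fun j => ?_
  · change eps 1 (omegaPoly (MvPolynomial.C c)) =
      MvPolynomial.aeval _ (eps 1 (MvPolynomial.C c))
    rw [omegaPoly_C, eps_C, eps_C]
  · change eps 1 (omegaPoly (x j)) = MvPolynomial.aeval _ (eps 1 (x j))
    rw [omegaPoly_x, map_neg, eps_x, eps_x, MvPolynomial.aeval_X]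
    rfl

theorem dividedDiff_negDoubleSchub {u : Equiv.Perm ℤ} (hu : u ∈ SMinus) {i : ℤ} (hi : i < 0) :
    dividedDiff i (negDoubleSchub u) =
      if u (i + 1) < u i then negDoubleSchub (u * s i) else 0 := by
  have h := dividedDiff_doubleSchub (omegaPerm_mem_PermPos hu) (i := -i) (by omega)
  have h' := omegaPoly_dividedDiff (-i) (doubleSchub (omegaPerm u))
  rw [neg_neg] at h'
  rw [negDoubleSchub, ← h', h, apply_ite omegaPoly, map_zero, negDoubleSchub, omegaPerm_mul,
    omegaPerm_s, omegaPerm_apply, omegaPerm_apply]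
  have e1 : 1 - (-i + 1) = i := by ring
  have e2 : 1 - -i = i + 1 := by ring
  exact if_congr (by rw [e1, e2, sub_lt_sub_iff_left]) rfl rfl

theorem permX_doubleSchub {v : Equiv.Perm ℤ} (hv : v ∈ PermPos) {i : ℤ} (hi : i < 0) :
    permX (s i) (doubleSchub v) = doubleSchub v := by
  rw [← (isDoubleSchub_doubleSchub hv).killBelow_eq]
  suffices h : (permX (s i)).comp (killBelow 1) = killBelow 1 from DFunLike.congr_fun h _
  refine MvPolynomial.algHom_ext fun j => ?_
  change permX (s i) (killBelow 1 (x j)) = killBelow 1 (x j)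
  rw [killBelow_x]
  split_ifs with h
  · rw [permX_x, s_apply_of_ne (by omega) (by omega)]
  · exact map_zero _

theorem permX_negDoubleSchub {u : Equiv.Perm ℤ} (hu : u ∈ SMinus) {i : ℤ} (hi : 0 < i) :
    permX (s i) (negDoubleSchub u) = negDoubleSchub u := by
  have h := omegaPoly_permX (-i) (doubleSchub (omegaPerm u))
  rw [neg_neg, permX_doubleSchub (omegaPerm_mem_PermPos hu) (by omega)] at h
  exact h.symm

theorem eq_one_of_mem_SMinus_of_mem_SPlus {w : Equiv.Perm ℤ} (h₁ : w ∈ SMinus) (h₂ : w ∈ SPlus) :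
    w = 1 := by
  ext i
  rcases le_or_gt i 0 with h | h
  · exact SPlus_apply h₂ i h
  · exact SMinus_apply h₁ i h

theorem SMinus_mul_SPlus_unique {u u' v v' : Equiv.Perm ℤ} (hu : u ∈ SMinus) (hu' : u' ∈ SMinus)
    (hv : v ∈ SPlus) (hv' : v' ∈ SPlus) (h : u * v = u' * v') : u = u' ∧ v = v' := by
  have e : u'⁻¹ * u = v' * v⁻¹ := by
    rw [eq_mul_inv_iff_mul_eq, mul_assoc, h, inv_mul_cancel_left]
  have e1 := eq_one_of_mem_SMinus_of_mem_SPlus (SMinus.mul_mem (SMinus.inv_mem hu') hu)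
    (by rw [e]; exact SPlus.mul_mem hv' (SPlus.inv_mem hv))
  have e2 := (inv_mul_eq_one.mp e1).symm
  exact ⟨e2, by rw [e2] at h; exact mul_left_cancel h⟩

theorem nonzeroDoubleSchub_mul {u v : Equiv.Perm ℤ} (hu : u ∈ SMinus) (hv : v ∈ SPlus) :
    nonzeroDoubleSchub (u * v) = negDoubleSchub u * doubleSchub v := by
  have h : ∃ p : Equiv.Perm ℤ × Equiv.Perm ℤ, p.1 ∈ SMinus ∧ p.2 ∈ SPlus ∧
      u * v = p.1 * p.2 := ⟨(u, v), hu, hv, rfl⟩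
  rw [nonzeroDoubleSchub, dif_pos h]
  obtain ⟨h1, h2, h3⟩ := h.choose_spec
  obtain ⟨e1, e2⟩ := SMinus_mul_SPlus_unique hu h1 hv h2 h3
  rw [← e1, ← e2]

theorem commute_SPlus_s {v : Equiv.Perm ℤ} (hv : v ∈ SPlus) {i : ℤ} (hi : i < 0) :
    v * s i = s i * v := by
  ext j
  simp only [Equiv.Perm.mul_apply]
  rcases le_or_gt j 0 with h | h
  · rw [SPlus_apply hv j h, SPlus_apply hv]
    rw [s_apply]
    split_ifs <;> omega
  · have := pos_apply_of_mem_PermPos (mem_PermPos_of_mem_SPlus hv) (i := j) h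
    rw [s_apply_of_ne (by omega) (by omega), s_apply_of_ne (by omega) (by omega)]

theorem mul_s_mem_SNonzero {w : Equiv.Perm ℤ} (hw : w ∈ SNonzero) {i : ℤ} (hi : i ≠ 0) :
    w * s i ∈ SNonzero := by
  obtain ⟨u, hu, v, hv, rfl⟩ := hw
  rcases lt_or_gt_of_ne hi with h | h
  · exact ⟨u * s i, SMinus.mul_mem hu (Subgroup.subset_closure ⟨i, h, rfl⟩), v, hv, by
      rw [mul_assoc, commute_SPlus_s hv h, mul_assoc]⟩
  · exact ⟨u, hu, v * s i, SPlus.mul_mem hv (Subgroup.subset_closure ⟨i, h, rfl⟩),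
      mul_assoc _ _ _⟩

theorem dividedDiff_nonzeroDoubleSchub {w : Equiv.Perm ℤ} (hw : w ∈ SNonzero) {i : ℤ}
    (hi : i ≠ 0) : dividedDiff i (nonzeroDoubleSchub w) =
      if w (i + 1) < w i then nonzeroDoubleSchub (w * s i) else 0 := by
  obtain ⟨u, hu, v, hv, rfl⟩ := hw
  have hv' := mem_PermPos_of_mem_SPlus hv
  rw [nonzeroDoubleSchub_mul hu hv]
  rcases lt_or_gt_of_ne hi with h | h
  · have hus : u * s i ∈ SMinus := SMinus.mul_mem hu (Subgroup.subset_closure ⟨i, h, rfl⟩)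
    rw [dividedDiff_mul_right (permX_doubleSchub hv' h), dividedDiff_negDoubleSchub hu h,
      mul_assoc, commute_SPlus_s hv h, ← mul_assoc, nonzeroDoubleSchub_mul hus hv, ite_mul,
      zero_mul, Equiv.Perm.mul_apply, Equiv.Perm.mul_apply, SPlus_apply hv i h.le,
      SPlus_apply hv (i + 1) h]
  · have hvs : v * s i ∈ SPlus := SPlus.mul_mem hv (Subgroup.subset_closure ⟨i, h, rfl⟩)
    have h1 := pos_apply_of_mem_PermPos hv' (i := i) h
    have h2 := pos_apply_of_mem_PermPos hv' (i := i + 1) (by omega)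
    rw [dividedDiff_mul_left (permX_negDoubleSchub hu h),
      dividedDiff_doubleSchub hv' (by omega), mul_assoc, nonzeroDoubleSchub_mul hu hvs, mul_ite,
      mul_zero, Equiv.Perm.mul_apply, Equiv.Perm.mul_apply, SMinus_apply hu (v i) h1,
      SMinus_apply hu (v (i + 1)) h2]

open Classical in
theorem eps_one_nonzeroDoubleSchub {w : Equiv.Perm ℤ} (hw : w ∈ SNonzero) :
    eps 1 (nonzeroDoubleSchub w) = if w = 1 then 1 else 0 := by
  obtain ⟨u, hu, v, hv, rfl⟩ := hw
  rw [nonzeroDoubleSchub_mul hu hv, map_mul, negDoubleSchub, eps_one_omegaPoly,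
    (isDoubleSchub_doubleSchub (omegaPerm_mem_PermPos hu)).eps_one,
    (isDoubleSchub_doubleSchub (mem_PermPos_of_mem_SPlus hv)).eps_one]
  have h : u * v = 1 ↔ u = 1 ∧ v = 1 :=
    ⟨fun e => SMinus_mul_SPlus_unique hu SMinus.one_mem hv SPlus.one_mem (by rw [e, one_mul]),
      fun e => by rw [e.1, e.2, one_mul]⟩
  simp only [omegaPerm_eq_one_iff, h]
  by_cases h1 : u = 1 <;> by_cases h2 : v = 1 <;> simp [h1, h2]

/-! ### Divided differences of back symmetric double power series -/

instance : IsDomain BackSym :=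
  (MvPolynomial.algebraTensorAlgEquiv (σ := ℤ) Qa DoubleSym).toMulEquiv.isDomain _

/-- The element `p_k(x||a) ⊗ 1`. -/
def pB (k : ℕ+) : BackSym := p k ⊗ₜ[Qa] 1

/-- The element `1 ⊗ x_i`. -/
def xB (i : ℤ) : BackSym := 1 ⊗ₜ[Qa] x i

/-- The `ℚ[a]`-algebra homomorphism out of `Λ(x||a) ⊗ ℚ[x,a]` with prescribed values on the
`p_k(x||a)` and the `x_i`. -/
def backLift {B : Type*} [CommRing B] [Algebra Qa B] (f : ℕ+ → B) (g : ℤ → B) :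
    BackSym →ₐ[Qa] B :=
  Algebra.TensorProduct.productMap (MvPolynomial.aeval f) (MvPolynomial.aeval g)

section backLift

variable {B : Type*} [CommRing B] [Algebra Qa B] (f : ℕ+ → B) (g : ℤ → B)

theorem backLift_pB (k : ℕ+) : backLift f g (pB k) = f k := by
  rw [backLift, pB, Algebra.TensorProduct.productMap_apply_tmul, map_one, mul_one]
  exact MvPolynomial.aeval_X _ _

theorem backLift_xB (i : ℤ) : backLift f g (xB i) = g i := by
  rw [backLift, xB, Algebra.TensorProduct.productMap_apply_tmul, map_one, one_mul]
  exact MvPolynomial.aeval_X _ _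

theorem backLift_tmul_one (h : DoubleSym) :
    backLift f g (h ⊗ₜ[Qa] 1) = MvPolynomial.aeval f h := by
  rw [backLift, Algebra.TensorProduct.productMap_apply_tmul, map_one, mul_one]

theorem backSym_algHom_ext {φ ψ : BackSym →ₐ[Qa] B} (hp : ∀ k, φ (pB k) = ψ (pB k))
    (hx : ∀ i, φ (xB i) = ψ (xB i)) : φ = ψ :=
  Algebra.TensorProduct.ext (MvPolynomial.algHom_ext hp) (MvPolynomial.algHom_ext hx)

end backLift

/-- The action of `s_i` on back symmetric double power series: it exchanges `x_i` and `x_{i+1}`,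
and as `p_k(x||a)` is the sum of the `x_j^k - a_j^k` with `j ≤ 0`, it moves `p_k(x||a)` only if
`i = 0`. -/
def sB (i : ℤ) : BackSym →ₐ[Qa] BackSym :=
  backLift (fun k => if i = 0 then pB k + (xB 1 ^ (k : ℕ) - xB 0 ^ (k : ℕ)) else pB k)
    fun j => xB (s i j)

theorem sB_pB (i : ℤ) (k : ℕ+) : sB i (pB k) =
    if i = 0 then pB k + (xB 1 ^ (k : ℕ) - xB 0 ^ (k : ℕ)) else pB k := backLift_pB _ _ _

theorem sB_xB (i j : ℤ) : sB i (xB j) = xB (s i j) := backLift_xB _ _ _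

theorem xB_sub_xB_ne_zero (i : ℤ) : xB i - xB (i + 1) ≠ 0 := by
  intro h
  have := congrArg (backLift (fun _ => 0) x) h
  rw [map_sub, backLift_xB, backLift_xB, map_zero] at this
  exact x_sub_x_ne_zero i this

/-- If `σ` is the identity modulo `c`, then `c` divides `f - σ f`; for an algebra homomorphism the
hypothesis has to be checked on generators only. -/
theorem dvd_sub_of_mkₐ_eq {R A : Type*} [CommRing R] [CommRing A] [Algebra R A] {c : A}
    {σ : A →ₐ[R] A} (h : Ideal.Quotient.mkₐ R (Ideal.span {c}) =
      (Ideal.Quotient.mkₐ R (Ideal.span {c})).comp σ) (f : A) : c ∣ f - σ f := by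
  rw [← Ideal.mem_span_singleton, ← Ideal.Quotient.eq]
  exact DFunLike.congr_fun h f

theorem mk_span_sub {A : Type*} [CommRing A] (b c : A) :
    Ideal.Quotient.mk (Ideal.span {b - c}) b = Ideal.Quotient.mk (Ideal.span {b - c}) c :=
  Ideal.Quotient.eq.mpr (Ideal.mem_span_singleton_self _)

theorem sB_sub_dvd (i : ℤ) (f : BackSym) : xB i - xB (i + 1) ∣ f - sB i f := by
  refine dvd_sub_of_mkₐ_eq ?_ f
  have hI := mk_span_sub (xB i) (xB (i + 1))
  refine backSym_algHom_ext (fun k => ?_) fun j => ?_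
  · rw [AlgHom.comp_apply, sB_pB, Ideal.Quotient.mkₐ_eq_mk]
    split_ifs with h
    · subst h
      rw [zero_add] at hI ⊢
      rw [map_add, map_sub, map_pow, map_pow, ← hI, sub_self, add_zero]
    · rfl
  · rw [AlgHom.comp_apply, sB_xB, Ideal.Quotient.mkₐ_eq_mk, s_apply]
    split_ifs with h1 h2
    · rw [h1, hI]
    · rw [h2, hI]
    · rfl

theorem exists_dB (i : ℤ) (f : BackSym) :
    ∃ g, (xB i - xB (i + 1)) * g = f - sB i f :=
  let ⟨g, hg⟩ := sB_sub_dvd i f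
  ⟨g, hg.symm⟩

/-- The divided difference operator `A_i` on back symmetric double power series. -/
def dB (i : ℤ) : BackSym →ₗ[Qa] BackSym where
  toFun f := (exists_dB i f).choose
  map_add' f g := mul_left_cancel₀ (xB_sub_xB_ne_zero i) (by
    rw [mul_add, (exists_dB i _).choose_spec, (exists_dB i _).choose_spec,
      (exists_dB i _).choose_spec, map_add]
    ring)
  map_smul' c f := mul_left_cancel₀ (xB_sub_xB_ne_zero i) (by
    rw [RingHom.id_apply, mul_smul_comm, (exists_dB i _).choose_spec,
      (exists_dB i _).choose_spec, map_smul, smul_sub])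

theorem dB_spec (i : ℤ) (f : BackSym) : (xB i - xB (i + 1)) * dB i f = f - sB i f :=
  (exists_dB i f).choose_spec

theorem dB_eq_of {i : ℤ} {f g : BackSym} (h : (xB i - xB (i + 1)) * g = f - sB i f) :
    dB i f = g :=
  mul_left_cancel₀ (xB_sub_xB_ne_zero i) ((dB_spec i f).trans h.symm)

theorem dB_eq_zero_iff {i : ℤ} {f : BackSym} : dB i f = 0 ↔ sB i f = f := by
  have h := dB_spec i f
  constructor
  · intro e
    rw [e, mul_zero] at h
    exact (sub_eq_zero.mp h.symm).symm
  · intro e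
    exact dB_eq_of (by rw [e, sub_self, mul_zero])

theorem sB_comm {i j : ℤ} (h : j + 1 < i) (f : BackSym) : sB j (sB i f) = sB i (sB j f) := by
  suffices e : (sB j).comp (sB i) = (sB i).comp (sB j) from DFunLike.congr_fun e f
  refine backSym_algHom_ext (B := BackSym) (fun k => ?_) fun l => ?_
  · simp only [AlgHom.comp_apply, sB_pB]
    by_cases hi : i = 0
    · subst hi
      rw [if_pos rfl, if_neg (by omega), map_add, map_sub, map_pow, map_pow, sB_xB, sB_xB,
        sB_pB, sB_pB, if_pos rfl, if_neg (by omega), s_apply_of_ne (by omega) (by omega),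
        s_apply_of_ne (by omega) (by omega)]
    · rw [if_neg hi, sB_pB]
      split_ifs with hj
      · subst hj
        rw [map_add, map_sub, map_pow, map_pow, sB_xB, sB_xB, sB_pB, if_neg hi,
          s_apply_of_ne (by omega) (by omega), s_apply_of_ne (by omega) (by omega)]
      · rw [sB_pB, if_neg hi]
  · simp only [AlgHom.comp_apply, sB_xB]
    rw [← Equiv.Perm.mul_apply, ← Equiv.Perm.mul_apply, s_comm h]

theorem dB_dB_eq_zero {i j : ℤ} (h : j + 1 < i) {f : BackSym} (hf : dB j f = 0) :
    dB j (dB i f) = 0 := by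
  rw [dB_eq_zero_iff] at hf ⊢
  refine (dB_eq_of ?_).symm
  have e := congrArg (sB j) (dB_spec i f)
  rwa [map_mul, map_sub, map_sub, sB_xB, sB_xB, s_apply_of_ne (by omega) (by omega),
    s_apply_of_ne (by omega) (by omega), sB_comm h, hf] at e

theorem sB_tmul {i : ℤ} (hi : i ≠ 0) (g : DoubleSym) (h : Qxa) :
    sB i (g ⊗ₜ[Qa] h) = g ⊗ₜ[Qa] permX (s i) h := by
  suffices e : sB i = Algebra.TensorProduct.map (AlgHom.id Qa DoubleSym) (permX (s i)) by
    rw [e, Algebra.TensorProduct.map_tmul, AlgHom.id_apply]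
  refine backSym_algHom_ext (B := BackSym) (fun k => ?_) fun j => ?_
  · rw [sB_pB, if_neg hi, pB, Algebra.TensorProduct.map_tmul, map_one, AlgHom.id_apply]
  · rw [sB_xB, xB, xB, Algebra.TensorProduct.map_tmul, map_one, permX_x]

theorem dB_tmul {i : ℤ} (hi : i ≠ 0) (g : DoubleSym) (h : Qxa) :
    dB i (g ⊗ₜ[Qa] h) = g ⊗ₜ[Qa] dividedDiff i h :=
  dB_eq_of (by
    rw [xB, xB, ← TensorProduct.tmul_sub, Algebra.TensorProduct.tmul_mul_tmul, one_mul,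
      dividedDiff_spec, sB_tmul hi, TensorProduct.tmul_sub])

theorem lTensor_dividedDiffL {i : ℤ} (hi : i ≠ 0) (f : BackSym) :
    (dividedDiffL i).lTensor DoubleSym f = dB i f := by
  suffices h : (dividedDiffL i).lTensor DoubleSym = dB i from DFunLike.congr_fun h f
  refine TensorProduct.ext' fun g h => ?_
  rw [LinearMap.lTensor_tmul, dividedDiffL_apply, dB_tmul hi]

/-! ### Joint kernels of divided differences -/

/-- As `Λ(x||a)` is free over `ℚ[a]`, joint kernels commute with `Λ(x||a) ⊗ -`. -/
theorem exists_eq_tmul_of_forall_lTensor_eq_zero {M : Type*} [AddCommGroup M] [Module Qa M]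
    {I : Set ℤ} {D : ℤ → M →ₗ[Qa] M} {g : M}
    (hD : ∀ m, (∀ i ∈ I, D i m = 0) → ∃ c : Qa, m = c • g) {y : DoubleSym ⊗[Qa] M}
    (hy : ∀ i ∈ I, (D i).lTensor DoubleSym y = 0) : ∃ h : DoubleSym, y = h ⊗ₜ[Qa] g := by
  set b := MvPolynomial.basisMonomials ℕ+ Qa
  have hcomm : ∀ i j (z : DoubleSym ⊗[Qa] M),
      TensorProduct.equivFinsuppOfBasisLeft b ((D i).lTensor DoubleSym z) j =
        D i (TensorProduct.equivFinsuppOfBasisLeft b z j) := by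
    intro i j z
    induction z using TensorProduct.induction_on with
    | zero => simp
    | tmul f m => simp
    | add z z' hz hz' => simp only [map_add, Finsupp.add_apply, hz, hz']
  have hc : ∀ j, ∃ c : Qa, TensorProduct.equivFinsuppOfBasisLeft b y j = c • g := fun j =>
    hD _ fun i hi => by rw [← hcomm, hy i hi, map_zero, Finsupp.zero_apply]
  choose c hc using hc
  refine ⟨∑ j ∈ (TensorProduct.equivFinsuppOfBasisLeft b y).support, c j • b j, ?_⟩
  conv_lhs => rw [← (TensorProduct.equivFinsuppOfBasisLeft b).symm_apply_apply y,
    TensorProduct.equivFinsuppOfBasisLeft_symm_apply, Finsupp.sum]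
  rw [TensorProduct.sum_tmul]
  refine Finset.sum_congr rfl fun j _ => ?_
  rw [hc, TensorProduct.tmul_smul, TensorProduct.smul_tmul']

theorem mem_vars_imp_pderiv_ne_zero {f : DoubleSym} {k : ℕ+} (hk : k ∈ f.vars) :
    MvPolynomial.pderiv k f ≠ 0 := by
  rw [MvPolynomial.mem_vars_iff_mem_support] at hk
  obtain ⟨d, hd, hkd⟩ := hk
  intro h
  have e := MvPolynomial.coeff_pderiv (i := k) f (d - Finsupp.single k 1)
  have hle : Finsupp.single k 1 ≤ d := by
    rw [Finsupp.single_le_iff]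
    exact Nat.one_le_iff_ne_zero.mpr (Finsupp.mem_support_iff.mp hkd)
  rw [h, tsub_add_cancel_of_le hle, MvPolynomial.coeff_zero, eq_comm, mul_eq_zero] at e
  rcases e with e | e
  · exact MvPolynomial.mem_support_iff.mp hd e
  · exact Nat.cast_add_one_ne_zero _ e

/-- The substitution `p_k ↦ p_k + t^k` for `k ∈ S`. -/
def addPow (S : Finset ℕ+) : DoubleSym →ₐ[Qa] Polynomial DoubleSym :=
  MvPolynomial.aeval fun k : ℕ+ =>
    Polynomial.C (p k) + if k ∈ S then Polynomial.X ^ (k : ℕ) else 0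

theorem addPow_X (S : Finset ℕ+) (k : ℕ+) : addPow S (MvPolynomial.X k) =
    Polynomial.C (p k) + if k ∈ S then Polynomial.X ^ (k : ℕ) else 0 :=
  MvPolynomial.aeval_X _ _

theorem addPow_C (S : Finset ℕ+) (c : Qa) : addPow S (MvPolynomial.C c) =
    Polynomial.C (MvPolynomial.C c) := MvPolynomial.algHom_C _ _

theorem derivative_addPow (S : Finset ℕ+) (g : DoubleSym) :
    Polynomial.derivative (addPow S g) =
      ∑ k ∈ S, ((k : ℕ) : Polynomial DoubleSym) * Polynomial.X ^ ((k : ℕ) - 1) *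
        addPow S (MvPolynomial.pderiv k g) := by
  induction g using MvPolynomial.induction_on with
  | C c =>
    rw [addPow_C, Polynomial.derivative_C]
    refine (Finset.sum_eq_zero fun k _ => ?_).symm
    rw [MvPolynomial.pderiv_C, map_zero, mul_zero]
  | add g g' hg hg' =>
    rw [map_add, Polynomial.derivative_add, hg, hg', ← Finset.sum_add_distrib]
    exact Finset.sum_congr rfl fun k _ => by rw [map_add, map_add, mul_add]
  | mul_X g j hg =>
    have hX : Polynomial.derivative (addPow S (MvPolynomial.X j)) = ∑ k ∈ S,
        ((k : ℕ) : Polynomial DoubleSym) * Polynomial.X ^ ((k : ℕ) - 1) *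
          addPow S (MvPolynomial.pderiv k (MvPolynomial.X j)) := by
      have : ∀ k, addPow S (MvPolynomial.pderiv k (MvPolynomial.X j)) =
          if k = j then 1 else 0 := fun k => by
        rw [MvPolynomial.pderiv_X, Pi.single_apply]
        split_ifs with h1 h2 h2
        · exact map_one _
        · exact absurd h1.symm h2
        · exact absurd h2.symm h1
        · exact map_zero _
      simp only [this, mul_ite, mul_one, mul_zero, Finset.sum_ite_eq', addPow_X]
      rw [Polynomial.derivative_add, Polynomial.derivative_C, zero_add]
      split_ifs with hj
      · rw [Polynomial.derivative_X_pow]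
        simp
      · exact Polynomial.derivative_zero
    rw [map_mul, Polynomial.derivative_mul, hg, hX, Finset.sum_mul, Finset.mul_sum,
      ← Finset.sum_add_distrib]
    refine Finset.sum_congr rfl fun k _ => ?_
    rw [Derivation.leibniz, smul_eq_mul, smul_eq_mul, map_add, map_mul, map_mul]
    ring

theorem coeff_zero_addPow (S : Finset ℕ+) (g : DoubleSym) : (addPow S g).coeff 0 = g := by
  rw [← Polynomial.constantCoeff_apply]
  induction g using MvPolynomial.induction_on with
  | C c => rw [addPow_C, Polynomial.constantCoeff_apply, Polynomial.coeff_C_zero]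
  | add g g' hg hg' => rw [map_add, map_add, hg, hg']
  | mul_X g j hg =>
    rw [map_mul, map_mul, hg, addPow_X, map_add, Polynomial.constantCoeff_apply,
      Polynomial.coeff_C_zero]
    split_ifs
    · rw [map_pow, Polynomial.constantCoeff_apply, Polynomial.coeff_X_zero,
        zero_pow j.ne_zero, add_zero, p]
    · rw [map_zero, add_zero, p]

/-- A polynomial in the `p_k` that is invariant under `p_k ↦ p_k + t^k` is constant: the
derivative with respect to `t` is `∑ k t^(k-1) ∂f/∂p_k` after the substitution, and at the
smallest `k` with `∂f/∂p_k ≠ 0` the coefficient of `t^(k-1)` does not vanish. -/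
theorem eq_C_of_aeval_add_X_pow {f : DoubleSym}
    (h : MvPolynomial.aeval (fun k : ℕ+ => Polynomial.C (p k) + Polynomial.X ^ (k : ℕ)) f =
      Polynomial.C f) : f = MvPolynomial.C (f.coeff 0) := by
  have hf : addPow f.vars f = Polynomial.C f := by
    rw [← h]
    refine MvPolynomial.eval₂Hom_congr' rfl (fun k hk _ => ?_) rfl
    rw [if_pos hk]
  have hsum := derivative_addPow f.vars f
  rw [hf, Polynomial.derivative_C] at hsum
  have key : ∀ n : ℕ, ∀ k : ℕ+, (k : ℕ) = n → k ∈ f.vars → MvPolynomial.pderiv k f = 0 := by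
    intro n
    induction n using Nat.strong_induction_on with
    | _ n ih =>
      intro k hkn hk
      have e := congrArg (fun q => Polynomial.coeff q ((k : ℕ) - 1)) hsum
      simp only [Polynomial.coeff_zero, Polynomial.finsetSum_coeff] at e
      rw [Finset.sum_eq_single_of_mem k hk] at e
      · rw [mul_assoc, Polynomial.coeff_natCast_mul, Polynomial.coeff_X_pow_mul', if_pos le_rfl,
          Nat.sub_self, coeff_zero_addPow, eq_comm, mul_eq_zero] at e
        exact e.resolve_left (Nat.cast_ne_zero.mpr k.ne_zero)
      · intro j hj hjk
        rcases lt_or_gt_of_ne (fun e => hjk (PNat.eq e) : (j : ℕ) ≠ k) with hlt | hlt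
        · rw [ih j (by omega) j rfl hj, map_zero, mul_zero, Polynomial.coeff_zero]
        · have := k.pos
          rw [mul_assoc, Polynomial.coeff_natCast_mul, Polynomial.coeff_X_pow_mul',
            if_neg (by omega), mul_zero]
  rw [← MvPolynomial.vars_eq_empty_iff_eq_C]
  by_contra hne
  obtain ⟨k, hk⟩ := Finset.nonempty_iff_ne_empty.mpr hne
  exact mem_vars_imp_pderiv_ne_zero hk (key k k rfl hk)

theorem exists_smul_one_of_dividedDiff {f : Qxa}
    (h : ∀ i ∈ {i : ℤ | i ≠ 0}, dividedDiffL i f = 0) : ∃ c : Qa, f = c • 1 :=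
  ⟨_, (eq_C_of_dividedDiff_eq_zero_of_ne_zero h).trans (by
    rw [MvPolynomial.smul_eq_C_mul, mul_one])⟩

/-- The joint kernel of all divided differences is `ℚ[a]`: the `dB i` with `i ≠ 0` leave the
elements of `Λ(x||a)`, and for such an element invariance under `s_0`, specialized at `x_1 = t` and
`x_0 = 0`, is invariance under `p_k ↦ p_k + t^k`. -/
theorem exists_smul_one_of_dB {f : BackSym} (h : ∀ i, dB i f = 0) : ∃ c : Qa, f = c • 1 := by
  obtain ⟨g, rfl⟩ := exists_eq_tmul_of_forall_lTensor_eq_zero (y := f) (g := (1 : Qxa))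
    (fun _ => exists_smul_one_of_dividedDiff)
    fun i hi => (lTensor_dividedDiffL hi f).trans (h i)
  have h0 := dB_eq_zero_iff.mp (h 0)
  have h1 := congrArg (backLift (fun k => Polynomial.C (p k)) fun j =>
    if j = 1 then (Polynomial.X : Polynomial DoubleSym) else 0) h0
  have e1 : (backLift (fun k => Polynomial.C (p k)) fun j =>
      if j = 1 then (Polynomial.X : Polynomial DoubleSym) else 0) (g ⊗ₜ[Qa] 1) =
      Polynomial.C g := by
    rw [backLift_tmul_one]
    suffices e : MvPolynomial.aeval (fun k => Polynomial.C (p k)) =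
        (Algebra.ofId DoubleSym (Polynomial DoubleSym)).restrictScalars Qa by
      rw [e]; rfl
    exact MvPolynomial.algHom_ext fun k => MvPolynomial.aeval_X _ _
  have e2 : (backLift (fun k => Polynomial.C (p k)) fun j =>
      if j = 1 then (Polynomial.X : Polynomial DoubleSym) else 0) (sB 0 (g ⊗ₜ[Qa] 1)) =
      MvPolynomial.aeval (fun k : ℕ+ => Polynomial.C (p k) + Polynomial.X ^ (k : ℕ)) g := by
    rw [sB, backLift_tmul_one, ← AlgHom.comp_apply]
    congr 1
    refine MvPolynomial.algHom_ext fun k => ?_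
    rw [AlgHom.comp_apply, MvPolynomial.aeval_X, MvPolynomial.aeval_X, if_pos rfl, map_add,
      map_sub, map_pow, map_pow, backLift_pB, backLift_xB, backLift_xB, if_pos rfl,
      if_neg (by omega), zero_pow k.ne_zero]
    exact congrArg _ (sub_zero (Polynomial.X ^ (k : ℕ) : Polynomial DoubleSym))
  rw [e1, e2] at h1
  have hg := eq_C_of_aeval_add_X_pow h1
  refine ⟨g.coeff 0, ?_⟩
  rw [hg, MvPolynomial.coeff_C, if_pos rfl, Algebra.TensorProduct.one_def,
    TensorProduct.smul_tmul', MvPolynomial.smul_eq_C_mul, mul_one]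

-- needed for the instances on `Polynomial BackSym`
set_option maxSynthPendingDepth 5

/-! ### Degree in the `x`-variables -/

/-- The homomorphism that multiplies `p_k(x||a)` by `t^k` and `x_i` by `t`. -/
def degHom : BackSym →ₐ[Qa] Polynomial BackSym :=
  backLift (fun k => Polynomial.C (pB k) * Polynomial.X ^ (k : ℕ))
    fun j => Polynomial.C (xB j) * Polynomial.X

theorem degHom_pB (k : ℕ+) :
    degHom (pB k) = Polynomial.C (pB k) * Polynomial.X ^ (k : ℕ) := backLift_pB _ _ _

theorem degHom_xB (j : ℤ) : degHom (xB j) = Polynomial.C (xB j) * Polynomial.X :=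
  backLift_xB _ _ _

/-- The degree of a back symmetric double power series, where `x_i` has degree `1`, `p_k(x||a)` has
degree `k`, and the elements of `ℚ[a]` have degree `0`. -/
def wdeg (f : BackSym) : ℕ := (degHom f).natDegree

theorem degHom_injective : Function.Injective degHom := by
  suffices h : ((Polynomial.aeval (1 : BackSym)).restrictScalars Qa).comp degHom =
      AlgHom.id Qa BackSym from
    Function.LeftInverse.injective (g := Polynomial.aeval (1 : BackSym))
      fun f => DFunLike.congr_fun h f
  refine backSym_algHom_ext (B := BackSym) (fun k => ?_) fun j => ?_
  · change Polynomial.aeval (1 : BackSym) (degHom (pB k)) = pB k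
    rw [degHom_pB, map_mul, map_pow, Polynomial.aeval_X, Polynomial.aeval_C, one_pow, mul_one]
    rfl
  · change Polynomial.aeval (1 : BackSym) (degHom (xB j)) = xB j
    rw [degHom_xB, map_mul, Polynomial.aeval_X, Polynomial.aeval_C, mul_one]
    rfl

theorem degHom_sB (i : ℤ) (f : BackSym) :
    degHom (sB i f) = Polynomial.map (sB i).toRingHom (degHom f) := by
  suffices h : degHom.comp (sB i) = (Polynomial.mapAlgHom (sB i)).comp degHom from
    DFunLike.congr_fun h f
  refine backSym_algHom_ext (B := Polynomial BackSym) (fun k => ?_) fun j => ?_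
  · change degHom (sB i (pB k)) = Polynomial.map (sB i).toRingHom (degHom (pB k))
    rw [degHom_pB, Polynomial.map_mul, Polynomial.map_pow, Polynomial.map_X, Polynomial.map_C]
    change _ = Polynomial.C (sB i (pB k)) * _
    rw [sB_pB]
    split_ifs
    · simp only [map_add, map_sub, map_pow, degHom_pB, degHom_xB]
      ring
    · rw [degHom_pB]
  · change degHom (sB i (xB j)) = Polynomial.map (sB i).toRingHom (degHom (xB j))
    rw [degHom_xB, Polynomial.map_mul, Polynomial.map_X, Polynomial.map_C]
    change _ = Polynomial.C (sB i (xB j)) * _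
    rw [sB_xB, degHom_xB]

/-- A nonzero divided difference lowers the degree. -/
theorem wdeg_dB {i : ℤ} {f : BackSym} (h : dB i f ≠ 0) : wdeg (dB i f) + 1 ≤ wdeg f := by
  have e := congrArg degHom (dB_spec i f)
  rw [map_mul, map_sub, map_sub, degHom_xB, degHom_xB, ← sub_mul, ← Polynomial.C_sub,
    degHom_sB] at e
  have h1 : (Polynomial.C (xB i - xB (i + 1)) * Polynomial.X : Polynomial BackSym) ≠ 0 :=
    mul_ne_zero (Polynomial.C_ne_zero.mpr (xB_sub_xB_ne_zero i)) Polynomial.X_ne_zero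
  have h2 : degHom (dB i f) ≠ 0 := fun h0 => h (degHom_injective (h0.trans (map_zero _).symm))
  have e' := congrArg Polynomial.natDegree e
  rw [Polynomial.natDegree_mul h1 h2, Polynomial.natDegree_C_mul_X _ (xB_sub_xB_ne_zero i)] at e'
  have h3 := Polynomial.natDegree_sub_le (degHom f)
    (Polynomial.map (sB i).toRingHom (degHom f))
  have h4 : (Polynomial.map (sB i).toRingHom (degHom f)).natDegree ≤ (degHom f).natDegree :=
    Polynomial.natDegree_map_le
  rw [max_eq_left h4] at h3
  unfold wdeg
  omega

/-! ### Truncation -/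

/-- The truncation that replaces `p_k(x||a)` by the sum of the `x_i^k - a_i^k` with `p ≤ i ≤ 0` and
fixes `ℚ[x,a]`. On an element with no `x_i`, `i < p`, in the second factor, this is the substitution
`x_i ↦ a_i` for `i < p`. -/
def trunc (p : ℤ) : BackSym →ₐ[Qa] Qxa :=
  backLift (fun k => ∑ i ∈ Finset.Icc p 0, (x i ^ (k : ℕ) - a i ^ (k : ℕ))) x

theorem trunc_pB (p : ℤ) (k : ℕ+) :
    trunc p (pB k) = ∑ i ∈ Finset.Icc p 0, (x i ^ (k : ℕ) - a i ^ (k : ℕ)) := backLift_pB _ _ _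

theorem trunc_xB (p j : ℤ) : trunc p (xB j) = x j := backLift_xB _ _ _

theorem permX_a (w : Equiv.Perm ℤ) (j : ℤ) : permX w (a j) = a j := MvPolynomial.algHom_C _ _

theorem sum_permX_s {p i : ℤ} (hp : p ≤ 0) (hi : p ≤ i) (k : ℕ) :
    ∑ j ∈ Finset.Icc p 0, x (s i j) ^ k =
      ∑ j ∈ Finset.Icc p 0, x j ^ k + if i = 0 then x 1 ^ k - x 0 ^ k else 0 := by
  by_cases h : i = 0
  · subst h
    have e : Finset.Icc p 0 = insert 0 (Finset.Icc p (-1)) := by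
      ext j
      simp only [Finset.mem_Icc, Finset.mem_insert]
      omega
    have h0 : (0 : ℤ) ∉ Finset.Icc p (-1) := by simp
    rw [if_pos rfl, e, Finset.sum_insert h0, Finset.sum_insert h0, s_apply_left, zero_add,
      Finset.sum_congr rfl fun j hj => by
        rw [s_apply_of_ne (show j ≠ 0 by rw [Finset.mem_Icc] at hj; omega)
          (by rw [Finset.mem_Icc] at hj; omega)]]
    ring
  · rw [if_neg h, add_zero]
    refine Finset.sum_nbij' (s i) (s i) ?_ ?_ (fun _ _ => s_s_apply _ _)
      (fun _ _ => s_s_apply _ _) fun _ _ => rfl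
    all_goals
      intro j hj
      rw [Finset.mem_Icc] at hj ⊢
      rw [s_apply]
      split_ifs <;> omega

theorem trunc_sB {p i : ℤ} (hp : p ≤ 0) (hi : p ≤ i) (f : BackSym) :
    trunc p (sB i f) = permX (s i) (trunc p f) := by
  suffices h : (trunc p).comp (sB i) = (permX (s i)).comp (trunc p) from DFunLike.congr_fun h f
  refine backSym_algHom_ext (B := Qxa) (fun k => ?_) fun j => ?_
  · rw [AlgHom.comp_apply, AlgHom.comp_apply, sB_pB, trunc_pB, map_sum]
    simp only [map_sub, map_pow, permX_a, permX_x]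
    rw [Finset.sum_sub_distrib, sum_permX_s hp hi]
    split_ifs with h
    · rw [map_add, map_sub, map_pow, map_pow, trunc_xB, trunc_xB, trunc_pB,
        Finset.sum_sub_distrib]
      ring
    · rw [trunc_pB, Finset.sum_sub_distrib, add_zero]
  · rw [AlgHom.comp_apply, AlgHom.comp_apply, sB_xB, trunc_xB, trunc_xB, permX_x]

theorem trunc_dB {p i : ℤ} (hp : p ≤ 0) (hi : p ≤ i) (f : BackSym) :
    trunc p (dB i f) = dividedDiff i (trunc p f) := by
  refine (dividedDiff_eq_of ?_).symm
  have e := congrArg (trunc p) (dB_spec i f)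
  rwa [map_mul, map_sub, map_sub, trunc_xB, trunc_xB, trunc_sB hp hi] at e

/-- The augmentation `p_k(x||a) ↦ 0`, `x_i ↦ a_i`. -/
def epsB : BackSym →ₐ[Qa] Qa := backLift (fun _ => 0) MvPolynomial.X

theorem eps_one_trunc (p : ℤ) (f : BackSym) : eps 1 (trunc p f) = epsB f := by
  suffices h : (eps 1).comp (trunc p) = epsB from DFunLike.congr_fun h f
  refine backSym_algHom_ext (B := Qa) (fun k => ?_) fun j => ?_
  · rw [AlgHom.comp_apply, trunc_pB, map_sum, epsB, backLift_pB]
    refine Finset.sum_eq_zero fun i _ => ?_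
    rw [map_sub, map_pow, map_pow, eps_x, eps_a, Equiv.Perm.one_apply, sub_self]
  · rw [AlgHom.comp_apply, trunc_xB, eps_x, epsB, backLift_xB, Equiv.Perm.one_apply]

/-- Truncation to sufficiently many variables is injective on elements of bounded degree: a nonzero
element of the kernel would have a nonzero divided difference in the kernel, of smaller degree. -/
theorem eq_zero_of_trunc_eq_zero {p : ℤ} (hp : p ≤ 0) (d : ℕ) {m : ℤ} {f : BackSym}
    (hf : ∀ j < m, dB j f = 0) (hd : wdeg f ≤ d) (hm : (d : ℤ) ≤ m - p + 1)
    (h : trunc p f = 0) : f = 0 := by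
  induction d generalizing m f with
  | zero =>
    obtain ⟨c, rfl⟩ := exists_smul_one_of_dB (f := f) fun i => by
      by_contra hne
      have := wdeg_dB hne
      omega
    rw [map_smul, map_one, MvPolynomial.smul_eq_C_mul, mul_one, MvPolynomial.C_eq_zero] at h
    rw [h, zero_smul]
  | succ d ih =>
    obtain ⟨c, rfl⟩ := exists_smul_one_of_dB (f := f) fun i => by
      by_contra hne
      have hdeg := wdeg_dB hne
      have hmi : m ≤ i := by
        by_contra hc
        exact hne (hf i (by omega))
      refine hne (ih (m := m - 1) (fun j hj => dB_dB_eq_zero (by omega) (hf j (by omega)))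
        (by omega) (by push_cast at hm; omega) ?_)
      rw [trunc_dB hp (by push_cast at hm; omega), h]
      exact dividedDiff_eq_zero_iff.mpr (map_zero _)
    rw [map_smul, map_one, MvPolynomial.smul_eq_C_mul, mul_one, MvPolynomial.C_eq_zero] at h
    rw [h, zero_smul]

/-! ### Lifting symmetric polynomials -/

/-- The elementary symmetric polynomials are polynomials in the power sums, by Newton's
identities. -/
theorem esymm_mem_adjoin_psum (σ K : Type*) [Fintype σ] [CommRing K] [Algebra ℚ K] (n : ℕ) :
    MvPolynomial.esymm σ K n ∈
      Algebra.adjoin K (Set.range fun k : ℕ+ => MvPolynomial.psum σ K k) := by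
  induction n using Nat.strong_induction_on with
  | _ n ih =>
    rcases Nat.eq_zero_or_pos n with rfl | hn
    · rw [MvPolynomial.esymm_zero]
      exact one_mem _
    · set A := Algebra.adjoin K (Set.range fun k : ℕ+ => MvPolynomial.psum σ K k)
      have h : (n : MvPolynomial σ K) * MvPolynomial.esymm σ K n ∈ A := by
        rw [MvPolynomial.mul_esymm_eq_sum]
        refine mul_mem (pow_mem (neg_mem (one_mem _)) _) (sum_mem fun q hq => ?_)
        rw [Finset.mem_filter, Finset.HasAntidiagonal.mem_antidiagonal] at hq
        refine mul_mem (mul_mem (pow_mem (neg_mem (one_mem _)) _) (ih _ hq.2)) ?_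
        exact Algebra.subset_adjoin ⟨⟨q.2, by omega⟩, rfl⟩
      have h' := A.smul_mem h (algebraMap ℚ K (n : ℚ)⁻¹)
      have e : algebraMap ℚ K (n : ℚ)⁻¹ * (n : K) = 1 := by
        rw [← map_natCast (algebraMap ℚ K), ← map_mul,
          inv_mul_cancel₀ (Nat.cast_ne_zero.mpr hn.ne'), map_one]
      rwa [MvPolynomial.smul_eq_C_mul, ← mul_assoc,
        ← map_natCast (MvPolynomial.C (σ := σ) (R := K)), ← map_mul, e, map_one, one_mul] at h'

/-- Symmetric polynomials over a `ℚ`-algebra are polynomials in the power sums. -/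
theorem mem_adjoin_psum_of_isSymmetric {σ K : Type*} [Fintype σ] [CommRing K] [Algebra ℚ K]
    {f : MvPolynomial σ K} (hf : f.IsSymmetric) :
    f ∈ Algebra.adjoin K (Set.range fun k : ℕ+ => MvPolynomial.psum σ K k) := by
  obtain ⟨g, hg⟩ := MvPolynomial.esymmAlgHom_surjective (σ := σ) K le_rfl ⟨f, hf⟩
  have h := congrArg Subtype.val hg
  change (MvPolynomial.esymmAlgHom σ K _ g).val = f at h
  rw [MvPolynomial.esymmAlgHom_apply] at h
  rw [← h]
  clear hg h
  induction g using MvPolynomial.induction_on with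
  | C c => rw [MvPolynomial.algHom_C]; exact Subalgebra.algebraMap_mem _ c
  | add g g' hg hg' => rw [map_add]; exact add_mem hg hg'
  | mul_X g j hg =>
    rw [map_mul, MvPolynomial.aeval_X]
    exact mul_mem hg (esymm_mem_adjoin_psum σ K _)

theorem isSymmetric_of_forall_swap {K : Type*} [CommRing K] {n : ℕ}
    {f : MvPolynomial (Fin (n + 1)) K}
    (hf : ∀ i : Fin n, MvPolynomial.rename (Equiv.swap i.castSucc i.succ) f = f) :
    f.IsSymmetric := by
  intro σ
  have hσ : σ ∈ Submonoid.closure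
      (Set.range fun i : Fin n => Equiv.swap i.castSucc i.succ) := by
    rw [Equiv.Perm.mclosure_swap_castSucc_succ]
    exact Submonoid.mem_top σ
  induction hσ using Submonoid.closure_induction with
  | mem σ hσ =>
    obtain ⟨i, rfl⟩ := hσ
    exact hf i
  | one => exact MvPolynomial.rename_id_apply f
  | mul σ τ _ _ hσ hτ =>
    rw [Equiv.Perm.coe_mul, ← MvPolynomial.rename_rename, hτ, hσ]

/-- The polynomial ring on power sums `P_k` (index `inl k`) and further variables `y_j`
(index `inr j`). -/
abbrev PsumPoly : Type := MvPolynomial (ℕ+ ⊕ ℕ) Qa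

/-- The weight of the variables: `P_k` has weight `k` and `y_j` has weight `1`. -/
def psumWeight : ℕ+ ⊕ ℕ → ℕ := Sum.elim (fun k => k) fun _ => 1

/-- The substitution `P_k ↦ ∑ x_i^k`, the sum being over `p ≤ i ≤ p + n`, and
`y_j ↦ x_{p + n + 1 + j}`. -/
def psumEval (p : ℤ) (n : ℕ) : PsumPoly →ₐ[Qa] Qxa :=
  MvPolynomial.aeval (Sum.elim (fun k : ℕ+ => ∑ i : Fin (n + 1), x (p + (i : ℕ)) ^ (k : ℕ))
    fun j => x (p + n + 1 + j))

theorem psumEval_inl (p : ℤ) (n : ℕ) (k : ℕ+) : psumEval p n (MvPolynomial.X (Sum.inl k)) =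
    ∑ i : Fin (n + 1), x (p + (i : ℕ)) ^ (k : ℕ) := MvPolynomial.aeval_X _ _

theorem psumEval_inr (p : ℤ) (n j : ℕ) :
    psumEval p n (MvPolynomial.X (Sum.inr j)) = x (p + n + 1 + j) := MvPolynomial.aeval_X _ _

/-- The variables `x_i` with `p ≤ i`, split into those with `i ≤ p + n` and the others. -/
def splitIndex (p : ℤ) (n : ℕ) : Fin (n + 1) ⊕ ℕ → ℤ :=
  Sum.elim (fun i => p + (i : ℕ)) fun j => p + n + 1 + j

theorem splitIndex_injective (p : ℤ) (n : ℕ) : Function.Injective (splitIndex p n) := by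
  rintro (i | i) (j | j) h <;> simp only [splitIndex, Sum.elim_inl, Sum.elim_inr] at h
  · congr 1; ext; omega
  · have := i.2; omega
  · have := j.2; omega
  · congr 1; omega

theorem psumEval_rename_inr (p : ℤ) (n : ℕ) (c : MvPolynomial ℕ Qa) :
    psumEval p n (MvPolynomial.rename Sum.inr c) = MvPolynomial.rename (splitIndex p n)
      ((MvPolynomial.sumAlgEquiv Qa (Fin (n + 1)) ℕ).symm (MvPolynomial.C c)) := by
  induction c using MvPolynomial.induction_on with
  | C c =>
    rw [MvPolynomial.rename_C, MvPolynomial.sumAlgEquiv_symm_C_C, MvPolynomial.rename_C]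
    exact MvPolynomial.algHom_C _ _
  | add c c' hc hc' => simp only [map_add, hc, hc']
  | mul_X c j hc =>
    rw [map_mul, map_mul, map_mul, map_mul, map_mul, hc, MvPolynomial.rename_X,
      MvPolynomial.sumAlgEquiv_symm_C_X, MvPolynomial.rename_X, psumEval_inr]
    rfl

/-- A polynomial in the `x_i`, `p ≤ i`, that is symmetric in the `x_i` with `i ≤ p + n` is a
polynomial in the power sums of these and the remaining variables. -/
theorem exists_psumEval_eq {p : ℤ} {n : ℕ} {g : Qxa} (hg : killBelow p g = g)
    (hs : ∀ i, p ≤ i → i < p + n → dividedDiff i g = 0) : ∃ G, psumEval p n G = g := by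
  obtain ⟨F, rfl⟩ := MvPolynomial.exists_rename_eq_of_vars_subset_range g (splitIndex p n)
    (splitIndex_injective p n) fun j hj => by
      have h := le_of_mem_vars_of_killBelow hg hj
      rcases le_or_gt j (p + n) with h' | h'
      · exact ⟨Sum.inl ⟨(j - p).toNat, by omega⟩, by simp only [splitIndex, Sum.elim_inl]; omega⟩
      · exact ⟨Sum.inr (j - p - n - 1).toNat, by simp only [splitIndex, Sum.elim_inr]; omega⟩
  set F' := MvPolynomial.sumAlgEquiv Qa (Fin (n + 1)) ℕ F with hF'
  have hsymm : F'.IsSymmetric := by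
    refine isSymmetric_of_forall_swap fun i => ?_
    have h1 := dividedDiff_eq_zero_iff.mp (hs (p + (i : ℕ)) (by omega) (by omega))
    have h2 : MvPolynomial.rename (Sum.map (Equiv.swap i.castSucc i.succ) id) F = F := by
      apply MvPolynomial.rename_injective _ (splitIndex_injective p n)
      rw [MvPolynomial.rename_rename]
      refine Eq.trans ?_ h1
      rw [permX, MvPolynomial.rename_rename]
      congr 2
      funext j
      rcases j with j | j
      · simp only [Function.comp_apply, Sum.map_inl, splitIndex, Sum.elim_inl, s_apply,
          Equiv.swap_apply_def, Fin.ext_iff, Fin.val_castSucc, Fin.val_succ]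
        split_ifs <;> first | omega | (simp only [Fin.val_castSucc, Fin.val_succ]; omega) |
          simp only [Fin.val_castSucc]
      · have hj : s (p + (i : ℕ)) (p + n + 1 + j) = p + n + 1 + j :=
          s_apply_of_ne (by omega) (by omega)
        exact hj.symm
    have h3 : ∀ H : MvPolynomial (Fin (n + 1) ⊕ ℕ) Qa,
        MvPolynomial.sumAlgEquiv Qa (Fin (n + 1)) ℕ
          (MvPolynomial.rename (Sum.map (Equiv.swap i.castSucc i.succ) id) H) =
        MvPolynomial.rename (Equiv.swap i.castSucc i.succ)
          (MvPolynomial.sumAlgEquiv Qa (Fin (n + 1)) ℕ H) := by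
      intro H
      induction H using MvPolynomial.induction_on with
      | C c =>
        rw [MvPolynomial.rename_C, MvPolynomial.sumAlgEquiv_C_inl, MvPolynomial.rename_C]
      | add H H' hH hH' => simp only [map_add, hH, hH']
      | mul_X H j hH =>
        rw [map_mul, map_mul, map_mul, map_mul, hH, MvPolynomial.rename_X]
        rcases j with j | j
        · rw [Sum.map_inl, MvPolynomial.sumAlgEquiv_X_inl, MvPolynomial.sumAlgEquiv_X_inl,
            MvPolynomial.rename_X]
        · rw [Sum.map_inr, MvPolynomial.sumAlgEquiv_X_inr, MvPolynomial.sumAlgEquiv_X_inr,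
            MvPolynomial.rename_C, id]
    rw [hF', ← h3, h2]
  have hadj := mem_adjoin_psum_of_isSymmetric hsymm
  have hFF : F = (MvPolynomial.sumAlgEquiv Qa (Fin (n + 1)) ℕ).symm F' := by
    rw [hF', AlgEquiv.symm_apply_apply]
  rw [hFF]
  clear hF' hsymm hFF
  clear_value F'
  induction hadj using Algebra.adjoin_induction with
  | mem f hf =>
    obtain ⟨k, rfl⟩ := hf
    refine ⟨MvPolynomial.X (Sum.inl k), ?_⟩
    simp only [MvPolynomial.psum, map_sum, map_pow, MvPolynomial.sumAlgEquiv_symm_X,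
      MvPolynomial.rename_X]
    exact psumEval_inl _ _ _
  | algebraMap c =>
    refine ⟨MvPolynomial.rename Sum.inr c, ?_⟩
    rw [MvPolynomial.algebraMap_eq, psumEval_rename_inr]
  | add f f' _ _ hf hf' =>
    obtain ⟨G, hG⟩ := hf
    obtain ⟨G', hG'⟩ := hf'
    exact ⟨G + G', by rw [map_add, map_add, map_add, hG, hG']⟩
  | mul f f' _ _ hf hf' =>
    obtain ⟨G, hG⟩ := hf
    obtain ⟨G', hG'⟩ := hf'
    exact ⟨G * G', by rw [map_mul, map_mul, map_mul, hG, hG']⟩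

/-- The weight of a monomial in the `P_k` and `y_j`. -/
def monoWeight (d : ℕ+ ⊕ ℕ →₀ ℕ) : ℕ := ∑ v ∈ d.support, psumWeight v * d v

theorem isHomogeneous_psumEval_monomial (p : ℤ) (n : ℕ) (d : ℕ+ ⊕ ℕ →₀ ℕ) (c : Qa) :
    (psumEval p n (MvPolynomial.monomial d c)).IsHomogeneous (monoWeight d) := by
  rw [MvPolynomial.monomial_eq, map_mul, MvPolynomial.algHom_C, Finsupp.prod, map_prod,
    ← zero_add (monoWeight d)]
  refine (MvPolynomial.isHomogeneous_C _ _).mul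
    (MvPolynomial.IsHomogeneous.prod _ _ _ fun v _ => ?_)
  rw [map_pow]
  refine MvPolynomial.IsHomogeneous.pow ?_ _
  rcases v with k | j
  · rw [psumEval_inl]
    exact MvPolynomial.IsHomogeneous.sum _ _ _ fun i _ => MvPolynomial.isHomogeneous_X_pow _ _
  · rw [psumEval_inr]
    exact MvPolynomial.isHomogeneous_X _ _

/-- Monomials whose weight exceeds the degree of the value can be omitted. -/
theorem exists_psumEval_eq_of_weight_le {p : ℤ} {n : ℕ} {g : Qxa} (h : ∃ G, psumEval p n G = g) :
    ∃ G, psumEval p n G = g ∧ ∀ d ∈ G.support, monoWeight d ≤ g.totalDegree := by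
  obtain ⟨G, hG⟩ := h
  refine ⟨∑ d ∈ G.support with monoWeight d ≤ g.totalDegree,
    MvPolynomial.monomial d (G.coeff d), ?_, fun d hd => ?_⟩
  · rw [map_sum, Finset.sum_filter]
    conv_rhs => rw [← MvPolynomial.sum_homogeneousComponent g]
    have hcomp : ∀ j, MvPolynomial.homogeneousComponent j g = ∑ d ∈ G.support,
        if j = monoWeight d then psumEval p n (MvPolynomial.monomial d (G.coeff d)) else 0 := by
      intro j
      conv_lhs => rw [← hG, G.as_sum, map_sum, map_sum]
      exact Finset.sum_congr rfl fun d _ =>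
        MvPolynomial.homogeneousComponent_of_mem (isHomogeneous_psumEval_monomial p n d _)
    simp only [hcomp]
    rw [Finset.sum_comm]
    refine Finset.sum_congr rfl fun d _ => ?_
    rw [Finset.sum_ite_eq']
    simp only [Finset.mem_range, Nat.lt_succ_iff]
  · have := MvPolynomial.support_sum hd
    rw [Finset.mem_biUnion] at this
    obtain ⟨d', hd', h⟩ := this
    have e := Finset.mem_singleton.mp (MvPolynomial.support_monomial_subset h)
    rw [e]
    exact (Finset.mem_filter.mp hd').2

/-- The sum of the `a_i^k` with `p ≤ i ≤ 0`. -/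
def psumA (p : ℤ) (k : ℕ) : Qa := ∑ i ∈ Finset.Icc p 0, MvPolynomial.X i ^ k

/-- The substitution that replaces the power sum `P_k` of `x_p, …, x_{p+n}` by the element
`∑ x_i^k` with `i ≤ p + n`, corrected by a constant so that it truncates to `P_k`. -/
def psumLift (p : ℤ) (n : ℕ) : PsumPoly →ₐ[Qa] BackSym :=
  MvPolynomial.aeval (Sum.elim
    (fun k : ℕ+ => pB k + algebraMap Qa BackSym (psumA p k) -
      ∑ i ∈ Finset.Icc (p + n + 1) 0, xB i ^ (k : ℕ))
    fun j => xB (p + n + 1 + j))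

theorem psumLift_inl (p : ℤ) (n : ℕ) (k : ℕ+) : psumLift p n (MvPolynomial.X (Sum.inl k)) =
    pB k + algebraMap Qa BackSym (psumA p k) -
      ∑ i ∈ Finset.Icc (p + n + 1) 0, xB i ^ (k : ℕ) := MvPolynomial.aeval_X _ _

theorem psumLift_inr (p : ℤ) (n j : ℕ) :
    psumLift p n (MvPolynomial.X (Sum.inr j)) = xB (p + n + 1 + j) := MvPolynomial.aeval_X _ _

theorem sum_Icc_eq {p : ℤ} {n : ℕ} (h : p + n ≤ 0) (f : ℤ → Qxa) :
    ∑ i ∈ Finset.Icc p 0, f i =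
      ∑ i : Fin (n + 1), f (p + (i : ℕ)) + ∑ i ∈ Finset.Icc (p + n + 1) 0, f i := by
  have e : Finset.Icc p 0 = Finset.Icc p (p + n) ∪ Finset.Icc (p + n + 1) 0 := by
    ext j
    simp only [Finset.mem_union, Finset.mem_Icc]
    omega
  have hd : Disjoint (Finset.Icc p (p + n)) (Finset.Icc (p + n + 1) 0) := by
    rw [Finset.disjoint_left]
    intro j
    simp only [Finset.mem_Icc]
    omega
  rw [e, Finset.sum_union hd]
  congr 1
  symm
  refine Finset.sum_bij (fun i _ => p + (i : ℕ)) (fun i _ => ?_) (fun i _ j _ h => ?_)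
    (fun j hj => ?_) fun _ _ => rfl
  · have := i.2
    rw [Finset.mem_Icc]
    omega
  · ext
    omega
  · rw [Finset.mem_Icc] at hj
    exact ⟨⟨(j - p).toNat, by omega⟩, Finset.mem_univ _, by simp only; omega⟩

theorem trunc_psumLift {p : ℤ} {n : ℕ} (h : p + n ≤ 0) (G : PsumPoly) :
    trunc p (psumLift p n G) = psumEval p n G := by
  suffices e : (trunc p).comp (psumLift p n) = psumEval p n from DFunLike.congr_fun e G
  refine MvPolynomial.algHom_ext fun v => ?_
  rcases v with k | j
  · have ha : algebraMap Qa Qxa (psumA p k) = ∑ i ∈ Finset.Icc p 0, a i ^ (k : ℕ) := by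
      rw [psumA, map_sum]
      exact Finset.sum_congr rfl fun i _ => map_pow _ _ _
    rw [psumEval_inl, AlgHom.comp_apply, psumLift_inl, map_sub, map_add, trunc_pB,
      AlgHom.commutes, ha, map_sum, Finset.sum_sub_distrib, sub_add_cancel, sum_Icc_eq h]
    simp only [map_pow, trunc_xB]
    rw [add_sub_cancel_right]
  · rw [psumEval_inr, AlgHom.comp_apply, psumLift_inr, trunc_xB]

theorem dB_psumLift {p : ℤ} {n : ℕ} (h : p + n ≤ 0) {i : ℤ} (hi : i < p + n) (G : PsumPoly) :
    dB i (psumLift p n G) = 0 := by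
  rw [dB_eq_zero_iff]
  suffices e : (sB i).comp (psumLift p n) = psumLift p n from DFunLike.congr_fun e G
  refine MvPolynomial.algHom_ext fun v => ?_
  rcases v with k | j
  · rw [AlgHom.comp_apply, psumLift_inl, map_sub, map_add, sB_pB, if_neg (by omega),
      AlgHom.commutes, map_sum, Finset.sum_congr rfl fun j hj => ?_]
    rw [Finset.mem_Icc] at hj
    rw [map_pow, sB_xB, s_apply_of_ne (by omega) (by omega)]
  · rw [AlgHom.comp_apply, psumLift_inr, sB_xB, s_apply_of_ne (by omega) (by omega)]

theorem natDegree_degHom_algebraMap (c : Qa) :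
    (degHom (algebraMap Qa BackSym c)).natDegree = 0 := by
  rw [AlgHom.commutes]
  exact Polynomial.natDegree_C _

theorem natDegree_degHom_psumLift_X_le (p : ℤ) (n : ℕ) (v : ℕ+ ⊕ ℕ) :
    (degHom (psumLift p n (MvPolynomial.X v))).natDegree ≤ psumWeight v := by
  rcases v with k | j
  · rw [psumLift_inl, map_sub, map_add, degHom_pB, map_sum degHom]
    refine (Polynomial.natDegree_sub_le _ _).trans (max_le
      ((Polynomial.natDegree_add_le _ _).trans (max_le ?_ ?_)) ?_)
    · exact Polynomial.natDegree_C_mul_X_pow_le _ _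
    · rw [natDegree_degHom_algebraMap]
      exact Nat.zero_le _
    · refine Polynomial.natDegree_sum_le_of_forall_le _ _ fun i _ => ?_
      rw [map_pow, degHom_xB]
      refine Polynomial.natDegree_pow_le.trans ?_
      have h1 : (Polynomial.C (xB i) * Polynomial.X).natDegree ≤ 1 := by
        simpa using Polynomial.natDegree_C_mul_X_pow_le (xB i) 1
      exact (Nat.mul_le_mul_left _ h1).trans (Nat.mul_one _).le
  · rw [psumLift_inr, degHom_xB]
    change _ ≤ 1
    simpa using Polynomial.natDegree_C_mul_X_pow_le (xB _) 1

theorem wdeg_psumLift_le {p : ℤ} {n D : ℕ} {G : PsumPoly}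
    (hG : ∀ d ∈ G.support, monoWeight d ≤ D) : wdeg (psumLift p n G) ≤ D := by
  rw [wdeg]
  conv_lhs => rw [G.as_sum, map_sum, map_sum]
  refine Polynomial.natDegree_sum_le_of_forall_le _ _ fun d hd => le_trans ?_ (hG d hd)
  rw [MvPolynomial.monomial_eq, map_mul, map_mul, MvPolynomial.algHom_C, Finsupp.prod, map_prod,
    map_prod]
  refine Polynomial.natDegree_mul_le.trans ?_
  rw [natDegree_degHom_algebraMap, zero_add]
  refine (Polynomial.natDegree_prod_le _ _).trans (Finset.sum_le_sum fun v _ => ?_)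
  rw [map_pow, map_pow]
  refine Polynomial.natDegree_pow_le.trans ?_
  rw [mul_comm]
  exact Nat.mul_le_mul_right _ (natDegree_degHom_psumLift_X_le p n v)

/-- A polynomial in the `x_i`, `p ≤ i`, that is symmetric in the `x_i` with `i ≤ m ≤ 0` is the
truncation of an element that is symmetric in all `x_i` with `i ≤ m` and whose degree is
not larger. -/
theorem exists_trunc_eq {p m : ℤ} (hpm : p ≤ m) (hm : m ≤ 0) {g : Qxa} (hg : killBelow p g = g)
    (hs : ∀ i, p ≤ i → i < m → dividedDiff i g = 0) :
    ∃ f, (∀ j < m, dB j f = 0) ∧ trunc p f = g ∧ wdeg f ≤ g.totalDegree := by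
  obtain ⟨n, rfl⟩ : ∃ n : ℕ, m = p + n := ⟨(m - p).toNat, by omega⟩
  obtain ⟨G, hG, hd⟩ := exists_psumEval_eq_of_weight_le (exists_psumEval_eq hg hs)
  exact ⟨psumLift p n G, fun j hj => dB_psumLift hm hj G, by rw [trunc_psumLift hm, hG],
    wdeg_psumLift_le hd⟩

/-! ### Lifts of double Schubert polynomials to back symmetric power series -/

/-- `f` is a back symmetric double power series with truncation `𝔖_w^{[p,q]}`, where the interval
starts so far to the left of `m`, and hence of the integers moved by `w`, that `f` is determined by
this truncation. -/
structure IsLift (m p : ℤ) (w : Equiv.Perm ℤ) (f : BackSym) : Prop where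
  nonpos : p ≤ 0
  mem_left : w ∈ PermGE m
  mem : w ∈ PermGE p
  len_le : (len w : ℤ) ≤ m - p + 1
  ker : ∀ j < m, dB j f = 0
  trunc_eq : trunc p f = intervalSchub p 0 w
  wdeg_le : wdeg f ≤ len w

theorem le_of_descent {m i : ℤ} {w : Equiv.Perm ℤ} (hw : w ∈ PermGE m) (h : w (i + 1) < w i) :
    m ≤ i := by
  by_contra hc
  have h1 := hw.2 i (by omega)
  have h2 := hw.2 (w (i + 1)) (by omega)
  have h3 := w.injective h2
  omega

theorem IsLift.dB_of_descent {m p i : ℤ} {w : Equiv.Perm ℤ} {f : BackSym} (hf : IsLift m p w f)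
    (h : w (i + 1) < w i) : IsLift (m - 1) p (w * s i) (dB i f) := by
  have hmi := le_of_descent hf.mem_left h
  have hpi := le_of_descent hf.mem h
  have hlen := len_mul_s_of_gt hf.mem.1 h
  have h1 := hf.len_le
  refine ⟨hf.nonpos, PermGE_anti (by omega) (mul_s_mem_PermGE hf.mem_left hmi),
    mul_s_mem_PermGE hf.mem hpi, by omega,
    fun j hj => dB_dB_eq_zero (by omega) (hf.ker j (by omega)), ?_, ?_⟩
  · rw [trunc_dB hf.nonpos hpi, hf.trunc_eq, dividedDiff_intervalSchub hf.mem hpi, if_pos h]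
  · by_cases h0 : dB i f = 0
    · rw [h0, wdeg, map_zero, Polynomial.natDegree_zero]
      exact Nat.zero_le _
    · have h2 := wdeg_dB h0
      have h3 := hf.wdeg_le
      omega

/-- At an ascent, `dB i f` has degree less than `ℓ(w)` and truncates to `0`. -/
theorem IsLift.dB_of_ascent {m p i : ℤ} {w : Equiv.Perm ℤ} {f : BackSym} (hf : IsLift m p w f)
    (h : ¬ w (i + 1) < w i) : dB i f = 0 := by
  by_contra hne
  have hmi : m ≤ i := by
    by_contra hc
    exact hne (hf.ker i (by omega))
  have h1 := wdeg_dB hne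
  have h2 := hf.wdeg_le
  have h3 := hf.len_le
  refine hne (eq_zero_of_trunc_eq_zero hf.nonpos (len w - 1) (m := m - 1)
    (fun j hj => dB_dB_eq_zero (by omega) (hf.ker j (by omega))) (by omega) (by omega) ?_)
  rw [trunc_dB hf.nonpos (by omega), hf.trunc_eq, dividedDiff_intervalSchub hf.mem (by omega),
    if_neg h]

open Classical in
theorem IsLift.epsB_eq {m p : ℤ} {w : Equiv.Perm ℤ} {f : BackSym} (hf : IsLift m p w f) :
    epsB f = if w = 1 then 1 else 0 := by
  rw [← eps_one_trunc p, hf.trunc_eq]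
  exact eps_one_intervalSchub hf.mem

/-- The lift depends neither on the interval nor on `m`: the divided differences of two lifts agree
by induction, and so do their augmentations. -/
theorem IsLift.unique {m p m' p' : ℤ} {w : Equiv.Perm ℤ} {f f' : BackSym} (hf : IsLift m p w f)
    (hf' : IsLift m' p' w f') : f = f' := by
  induction hn : len w generalizing m p m' p' w f f' with
  | zero =>
    have key : ∀ g, wdeg g ≤ 0 → ∀ i, dB i g = 0 := fun g hg i => by
      by_contra hne
      have := wdeg_dB hne
      omega
    obtain ⟨c, hc⟩ := exists_smul_one_of_dB (f := f - f') fun i => by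
      rw [map_sub, key f (hf.wdeg_le.trans hn.le), key f' (hf'.wdeg_le.trans hn.le), sub_zero]
    have h := congrArg epsB hc
    rw [map_sub, hf.epsB_eq, hf'.epsB_eq, sub_self, map_smul, map_one, smul_eq_mul,
      mul_one] at h
    rw [← h, zero_smul] at hc
    exact sub_eq_zero.mp hc
  | succ n ih =>
    obtain ⟨c, hc⟩ := exists_smul_one_of_dB (f := f - f') fun i => by
      rw [map_sub, sub_eq_zero]
      by_cases h : w (i + 1) < w i
      · have hlen := len_mul_s_of_gt hf.mem.1 h
        exact ih (hf.dB_of_descent h) (hf'.dB_of_descent h) (by omega)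
      · rw [hf.dB_of_ascent h, hf'.dB_of_ascent h]
    have h := congrArg epsB hc
    rw [map_sub, hf.epsB_eq, hf'.epsB_eq, sub_self, map_smul, map_one, smul_eq_mul,
      mul_one] at h
    rw [← h, zero_smul] at hc
    exact sub_eq_zero.mp hc

theorem exists_isLift {w : Equiv.Perm ℤ} (hw : w ∈ SZ) :
    ∃ f, ∃ p₀ : ℤ, ∀ p ≤ p₀, ∃ m, IsLift m p w f := by
  obtain ⟨N, hN⟩ := exists_bound hw
  have hN' := le_abs_self N
  have hN0 := abs_nonneg N
  have hm : w ∈ PermGE (-|N|) := ⟨hw, fun i hi => hN i (Or.inl (by omega))⟩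
  have key : ∀ p ≤ -|N| - len w, ∃ f, IsLift (-|N|) p w f := by
    intro p hp
    have hpw : w ∈ PermGE p := PermGE_anti (by omega) hm
    obtain ⟨f, h1, h2, h3⟩ := exists_trunc_eq (p := p) (m := -|N|) (g := intervalSchub p 0 w)
      (by omega) (by omega) (killBelow_intervalSchub hpw) fun i hpi hi => by
        rw [dividedDiff_intervalSchub hpw hpi, if_neg fun h => by
          have := le_of_descent hm h
          omega]
    exact ⟨f, by omega, hm, hpw, by omega, h1, h2, h3.trans (totalDegree_intervalSchub_le hpw)⟩
  obtain ⟨f, hf⟩ := key _ le_rfl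
  refine ⟨f, -|N| - len w, fun p hp => ⟨-|N|, ?_⟩⟩
  obtain ⟨f', hf'⟩ := key p hp
  rwa [hf.unique hf']

open Classical in
/-- The back symmetric double power series with truncations `𝔖_w^{[p,q]}` for all sufficiently
small `p`, if `w ∈ S_ℤ`. -/
def backLimit (w : Equiv.Perm ℤ) : BackSym :=
  if hw : w ∈ SZ then (exists_isLift hw).choose else 0

theorem exists_forall_isLift_backLimit {w : Equiv.Perm ℤ} (hw : w ∈ SZ) :
    ∃ p₀ : ℤ, ∀ p ≤ p₀, ∃ m, IsLift m p w (backLimit w) := by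
  rw [backLimit, dif_pos hw]
  exact (exists_isLift hw).choose_spec

theorem exists_isLift_backLimit {w : Equiv.Perm ℤ} (hw : w ∈ SZ) :
    ∃ m p, IsLift m p w (backLimit w) :=
  let ⟨p₀, h⟩ := exists_forall_isLift_backLimit hw
  let ⟨m, hm⟩ := h p₀ le_rfl
  ⟨m, p₀, hm⟩

theorem dB_backLimit {w : Equiv.Perm ℤ} (hw : w ∈ SZ) (i : ℤ) :
    dB i (backLimit w) = if w (i + 1) < w i then backLimit (w * s i) else 0 := by
  obtain ⟨m, p, h⟩ := exists_isLift_backLimit hw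
  split_ifs with hi
  · obtain ⟨m', p', h'⟩ := exists_isLift_backLimit (mul_s_mem_SZ hw i)
    exact (h.dB_of_descent hi).unique h'
  · exact h.dB_of_ascent hi

open Classical in
theorem epsB_backLimit {w : Equiv.Perm ℤ} (hw : w ∈ SZ) :
    epsB (backLimit w) = if w = 1 then 1 else 0 :=
  let ⟨_, _, h⟩ := exists_isLift_backLimit hw
  h.epsB_eq

/-! ### Realization by formal power series -/

/-- `Λ(x||a) ⊗ ℚ[x,a]` is generated by the `p_k(x||a)` and the `x_i` as a `ℚ[a]`-algebra. -/
theorem backSym_induction {P : BackSym → Prop} (hC : ∀ c : Qa, P (algebraMap Qa BackSym c))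
    (hadd : ∀ f g, P f → P g → P (f + g)) (hmul : ∀ f g, P f → P g → P (f * g))
    (hp : ∀ k, P (pB k)) (hx : ∀ i, P (xB i)) (f : BackSym) : P f := by
  induction f using TensorProduct.induction_on with
  | zero => simpa using hC 0
  | add f g hf hg => exact hadd f g hf hg
  | tmul g h =>
    have e : g ⊗ₜ[Qa] h = (g ⊗ₜ[Qa] (1 : Qxa)) * ((1 : DoubleSym) ⊗ₜ[Qa] h) := by
      rw [Algebra.TensorProduct.tmul_mul_tmul, mul_one, one_mul]
    rw [e]
    refine hmul _ _ ?_ ?_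
    · induction g using MvPolynomial.induction_on with
      | C c => exact hC c
      | add g g' hg hg' =>
        rw [TensorProduct.add_tmul]
        exact hadd _ _ (hg (by rw [Algebra.TensorProduct.tmul_mul_tmul, mul_one, one_mul]))
          (hg' (by rw [Algebra.TensorProduct.tmul_mul_tmul, mul_one, one_mul]))
      | mul_X g k hg =>
        have e' : (g * MvPolynomial.X k) ⊗ₜ[Qa] (1 : Qxa) = (g ⊗ₜ[Qa] (1 : Qxa)) * pB k := by
          rw [pB, Algebra.TensorProduct.tmul_mul_tmul, mul_one, p]
        rw [e']
        exact hmul _ _ (hg (by rw [Algebra.TensorProduct.tmul_mul_tmul, mul_one, one_mul])) (hp k)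
    · clear e
      induction h using MvPolynomial.induction_on with
      | C c =>
        rw [← MvPolynomial.algebraMap_eq, Algebra.algebraMap_eq_smul_one, TensorProduct.tmul_smul,
          ← Algebra.TensorProduct.one_def, ← Algebra.algebraMap_eq_smul_one]
        exact hC c
      | add h h' hh hh' =>
        rw [TensorProduct.tmul_add]
        exact hadd _ _ hh hh'
      | mul_X h i hh =>
        have e' : (1 : DoubleSym) ⊗ₜ[Qa] (h * MvPolynomial.X i) =
            ((1 : DoubleSym) ⊗ₜ[Qa] h) * xB i := by
          rw [xB, Algebra.TensorProduct.tmul_mul_tmul, mul_one, x]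
        rw [e']
        exact hmul _ _ hh (hx i)

theorem toSeries_pB (k : ℕ+) : toSeries (pB k) = pSeries k := by
  rw [toSeries, pB, Algebra.TensorProduct.productMap_apply_tmul, map_one, mul_one]
  exact MvPolynomial.aeval_X _ _

theorem polyToSeries_x (i : ℤ) : polyToSeries (x i) = MvPowerSeries.X (Sum.inl i) :=
  MvPolynomial.aeval_X _ _

theorem polyToSeries_a (i : ℤ) : polyToSeries (a i) = MvPowerSeries.X (Sum.inr i) :=
  (MvPolynomial.algHom_C _ _).trans (MvPolynomial.aeval_X _ _)

theorem toSeries_xB (i : ℤ) : toSeries (xB i) = MvPowerSeries.X (Sum.inl i) := by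
  rw [toSeries, xB, Algebra.TensorProduct.productMap_apply_tmul, map_one, one_mul, polyToSeries_x]

/-- The monomial `m` in the `x_i` and `a_i` involves only indices `i ≥ p`. -/
def IsMonoGE (p : ℤ) (m : (ℤ ⊕ ℤ) →₀ ℕ) : Prop := ∀ v ∈ m.support, p ≤ Sum.elim id id v

theorem IsMonoGE.of_add {p : ℤ} {m n : (ℤ ⊕ ℤ) →₀ ℕ} (h : IsMonoGE p (m + n)) :
    IsMonoGE p m ∧ IsMonoGE p n := by
  constructor <;> intro v hv <;> refine h v ?_ <;>
    rw [Finsupp.mem_support_iff] at hv ⊢ <;> rw [Finsupp.add_apply] <;> omega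

theorem IsMonoGE.add {p : ℤ} {m n : (ℤ ⊕ ℤ) →₀ ℕ} (hm : IsMonoGE p m) (hn : IsMonoGE p n) :
    IsMonoGE p (m + n) := fun v hv =>
  (Finset.mem_union.mp (Finsupp.support_add hv)).elim (hm v) (hn v)

theorem exists_isMonoGE (m : (ℤ ⊕ ℤ) →₀ ℕ) : ∃ p₀ : ℤ, ∀ p ≤ p₀, IsMonoGE p m := by
  obtain ⟨b, hb⟩ := (m.support.image (Sum.elim id id)).bddBelow
  exact ⟨b, fun p hp v hv => hp.trans (hb (Finset.mem_coe.mpr (Finset.mem_image_of_mem _ hv)))⟩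

theorem isMonoGE_single {p : ℤ} {v : ℤ ⊕ ℤ} {k : ℕ} (hk : k ≠ 0) :
    IsMonoGE p (Finsupp.single v k) ↔ p ≤ Sum.elim id id v := by
  rw [IsMonoGE, Finsupp.support_single _ hk]
  simp

open Classical in
theorem coeff_pSeries_eq {p : ℤ} {m : (ℤ ⊕ ℤ) →₀ ℕ} (hm : IsMonoGE p m) (k : ℕ+) :
    MvPowerSeries.coeff m (pSeries k) =
      MvPowerSeries.coeff m (polyToSeries
        (∑ i ∈ Finset.Icc p 0, (x i ^ (k : ℕ) - a i ^ (k : ℕ)))) := by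
  have hk : (k : ℕ) ≠ 0 := k.ne_zero
  simp only [map_sum, map_sub, map_pow, polyToSeries_x, polyToSeries_a,
    MvPowerSeries.coeff_X_pow]
  change (if _ then _ else if _ then _ else _ : ℚ) = _
  rw [Finset.sum_sub_distrib]
  have hinj : ∀ v v' : ℤ ⊕ ℤ, Finsupp.single v (k : ℕ) = Finsupp.single v' (k : ℕ) → v = v' :=
    fun v v' h => Finsupp.single_left_injective hk h
  split_ifs with h1 h2
  · obtain ⟨i, hi, rfl⟩ := h1
    have hpi : p ≤ i := (isMonoGE_single hk).mp hm
    rw [Finset.sum_eq_single_of_mem i (Finset.mem_Icc.mpr ⟨hpi, hi⟩) fun j _ hj =>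
      if_neg fun h => hj (Sum.inl_injective (hinj _ _ h)).symm, if_pos rfl,
      Finset.sum_eq_zero fun j _ => if_neg fun h => Sum.inl_ne_inr (hinj _ _ h), sub_zero]
  · obtain ⟨i, hi, rfl⟩ := h2
    have hpi : p ≤ i := (isMonoGE_single hk).mp hm
    rw [Finset.sum_eq_zero fun j _ => if_neg fun h => Sum.inr_ne_inl (hinj _ _ h),
      Finset.sum_eq_single_of_mem i (Finset.mem_Icc.mpr ⟨hpi, hi⟩) fun j _ hj =>
      if_neg fun h => hj (Sum.inr_injective (hinj _ _ h)).symm, if_pos rfl, zero_sub]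
  · rw [Finset.sum_eq_zero fun j hj => if_neg fun h => h1 ⟨j, (Finset.mem_Icc.mp hj).2, h⟩,
      Finset.sum_eq_zero fun j hj => if_neg fun h => h2 ⟨j, (Finset.mem_Icc.mp hj).2, h⟩,
      sub_zero]

/-- Truncation does not change the coefficients at the monomials without indices below `p`. -/
theorem coeff_toSeries_eq {p : ℤ} (f : BackSym) :
    ∀ m, IsMonoGE p m →
      MvPowerSeries.coeff m (toSeries f) = MvPowerSeries.coeff m (polyToSeries (trunc p f)) := by
  induction f using backSym_induction with
  | hC c => intro m _; rw [AlgHom.commutes, AlgHom.commutes, AlgHom.commutes]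
  | hadd f g hf hg => intro m hm; simp only [map_add, hf m hm, hg m hm]
  | hmul f g hf hg =>
    intro m hm
    classical
    rw [map_mul toSeries, map_mul (trunc p), map_mul polyToSeries, MvPowerSeries.coeff_mul,
      MvPowerSeries.coeff_mul]
    refine Finset.sum_congr rfl fun q hq => ?_
    rw [Finset.HasAntidiagonal.mem_antidiagonal] at hq
    have h := IsMonoGE.of_add (hq ▸ hm)
    rw [hf _ h.1, hg _ h.2]
  | hp k => intro m hm; rw [toSeries_pB, trunc_pB, coeff_pSeries_eq hm]
  | hx i => intro m _; rw [toSeries_xB, trunc_xB, polyToSeries_x]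

theorem polyToSeries_eq_coe (g : Qxa) :
    polyToSeries g = ((MvPolynomial.sumAlgEquiv ℚ ℤ ℤ).symm g : MvPolynomial (ℤ ⊕ ℤ) ℚ) := by
  suffices h : (polyToSeries : Qxa →+* Series) = (MvPolynomial.coeToMvPowerSeries.ringHom).comp
      ((MvPolynomial.sumAlgEquiv ℚ ℤ ℤ).symm : Qxa →+* MvPolynomial (ℤ ⊕ ℤ) ℚ) from
    DFunLike.congr_fun h g
  refine MvPolynomial.ringHom_ext' (MvPolynomial.ringHom_ext' (RingHom.ext_rat _ _)
    fun i => ?_) fun i => ?_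
  · change polyToSeries (a i) = ((MvPolynomial.sumAlgEquiv ℚ ℤ ℤ).symm (a i) :
      MvPolynomial (ℤ ⊕ ℤ) ℚ)
    have : (MvPolynomial.sumAlgEquiv ℚ ℤ ℤ).symm (a i) = MvPolynomial.X (Sum.inr i) := by
      rw [AlgEquiv.symm_apply_eq]
      simp [a]
    rw [this, polyToSeries_a, MvPolynomial.coe_X]
  · change polyToSeries (x i) = ((MvPolynomial.sumAlgEquiv ℚ ℤ ℤ).symm (x i) :
      MvPolynomial (ℤ ⊕ ℤ) ℚ)
    have : (MvPolynomial.sumAlgEquiv ℚ ℤ ℤ).symm (x i) = MvPolynomial.X (Sum.inl i) := by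
      rw [AlgEquiv.symm_apply_eq]
      simp [x]
    rw [this, polyToSeries_x, MvPolynomial.coe_X]

theorem polyToSeries_injective : Function.Injective polyToSeries := fun f g h => by
  rw [polyToSeries_eq_coe, polyToSeries_eq_coe] at h
  exact (MvPolynomial.sumAlgEquiv ℚ ℤ ℤ).symm.injective (MvPolynomial.coe_injective _ _ h)

theorem exists_isMonoGE_polyToSeries (g : Qxa) : ∃ p₀ : ℤ, ∀ p ≤ p₀, ∀ m,
    MvPowerSeries.coeff m (polyToSeries g) ≠ 0 → IsMonoGE p m := by
  set G := (MvPolynomial.sumAlgEquiv ℚ ℤ ℤ).symm g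
  choose b hb using exists_isMonoGE
  obtain ⟨c, hc⟩ := (G.support.image b).bddBelow
  refine ⟨c, fun p hp m hm => hb m p (hp.trans (hc ?_))⟩
  rw [polyToSeries_eq_coe, MvPolynomial.coeff_coe] at hm
  exact Finset.mem_coe.mpr (Finset.mem_image_of_mem b (MvPolynomial.mem_support_iff.mpr hm))

/-- For small `p` the truncation involves no `x_i` or `a_i` with `i < p`. -/
theorem exists_isMonoGE_trunc (f : BackSym) : ∃ p₀ : ℤ, ∀ p ≤ p₀, ∀ m,
    MvPowerSeries.coeff m (polyToSeries (trunc p f)) ≠ 0 → IsMonoGE p m := by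
  induction f using backSym_induction with
  | hC c =>
    obtain ⟨p₀, h⟩ := exists_isMonoGE_polyToSeries (algebraMap Qa Qxa c)
    exact ⟨p₀, fun p hp => by rw [AlgHom.commutes]; exact h p hp⟩
  | hadd f g hf hg =>
    obtain ⟨b, hb⟩ := hf
    obtain ⟨c, hc⟩ := hg
    refine ⟨min b c, fun p hp m hm => ?_⟩
    rw [map_add, map_add, map_add] at hm
    by_cases h : MvPowerSeries.coeff m (polyToSeries (trunc p f)) = 0
    · rw [h, zero_add] at hm
      exact hc p (hp.trans (min_le_right _ _)) m hm
    · exact hb p (hp.trans (min_le_left _ _)) m h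
  | hmul f g hf hg =>
    obtain ⟨b, hb⟩ := hf
    obtain ⟨c, hc⟩ := hg
    refine ⟨min b c, fun p hp m hm => ?_⟩
    classical
    rw [map_mul (trunc p), map_mul polyToSeries, MvPowerSeries.coeff_mul] at hm
    obtain ⟨q, hq, hne⟩ := Finset.exists_ne_zero_of_sum_ne_zero hm
    rw [Finset.HasAntidiagonal.mem_antidiagonal] at hq
    rw [← hq]
    exact (hb p (hp.trans (min_le_left _ _)) _ (left_ne_zero_of_mul hne)).add
      (hc p (hp.trans (min_le_right _ _)) _ (right_ne_zero_of_mul hne))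
  | hp k =>
    refine ⟨0, fun p _ m hm => ?_⟩
    classical
    rw [trunc_pB, map_sum, map_sum] at hm
    obtain ⟨i, hi, hne⟩ := Finset.exists_ne_zero_of_sum_ne_zero hm
    rw [Finset.mem_Icc] at hi
    rw [map_sub polyToSeries, map_sub, map_pow polyToSeries, map_pow polyToSeries, polyToSeries_x,
      polyToSeries_a,
      MvPowerSeries.coeff_X_pow, MvPowerSeries.coeff_X_pow] at hne
    by_cases h1 : m = Finsupp.single (Sum.inl i) (k : ℕ)
    · rw [h1, isMonoGE_single k.ne_zero]
      exact hi.1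
    by_cases h2 : m = Finsupp.single (Sum.inr i) (k : ℕ)
    · rw [h2, isMonoGE_single k.ne_zero]
      exact hi.1
    · rw [if_neg h1, if_neg h2, sub_zero] at hne
      exact absurd rfl hne
  | hx i =>
    obtain ⟨p₀, h⟩ := exists_isMonoGE_polyToSeries (x i)
    exact ⟨p₀, fun p hp => by rw [trunc_xB]; exact h p hp⟩

/-- The elements of `Λ(x||a) ⊗ ℚ[x,a]` are back symmetric. -/
theorem exists_forall_dB_eq_zero (f : BackSym) : ∃ m : ℤ, ∀ j < m, dB j f = 0 := by
  simp only [dB_eq_zero_iff]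
  induction f using backSym_induction with
  | hC c => exact ⟨0, fun j _ => AlgHom.commutes _ _⟩
  | hadd f g hf hg =>
    obtain ⟨b, hb⟩ := hf
    obtain ⟨c, hc⟩ := hg
    exact ⟨min b c, fun j hj => by
      rw [map_add, hb j (hj.trans_le (min_le_left _ _)), hc j (hj.trans_le (min_le_right _ _))]⟩
  | hmul f g hf hg =>
    obtain ⟨b, hb⟩ := hf
    obtain ⟨c, hc⟩ := hg
    exact ⟨min b c, fun j hj => by
      rw [map_mul, hb j (hj.trans_le (min_le_left _ _)), hc j (hj.trans_le (min_le_right _ _))]⟩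
  | hp k => exact ⟨0, fun j hj => by rw [sB_pB, if_neg hj.ne]⟩
  | hx i => exact ⟨i - 1, fun j hj => by rw [sB_xB, s_apply_of_ne (by omega) (by omega)]⟩

/-- If `f` maps to `0`, then so does its truncation at any sufficiently small `p`, as all monomials
of the truncation have indices `≥ p` only; and truncation is injective on `f`. -/
theorem toSeries_injective : Function.Injective toSeries := by
  rw [injective_iff_map_eq_zero]
  intro f hf
  obtain ⟨m, hm⟩ := exists_forall_dB_eq_zero f
  obtain ⟨b, hb⟩ := exists_isMonoGE_trunc f
  set p := min (min 0 b) (m - wdeg f)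
  have hp1 : p ≤ min 0 b := min_le_left _ _
  have hp2 : p ≤ m - wdeg f := min_le_right _ _
  refine eq_zero_of_trunc_eq_zero (hp1.trans (min_le_left _ _)) (wdeg f) hm le_rfl (by omega) ?_
  refine polyToSeries_injective (MvPowerSeries.ext fun d => ?_)
  rw [map_zero, map_zero]
  by_contra hne
  refine hne ?_
  rw [← coeff_toSeries_eq f d (hb p (hp1.trans (min_le_right _ _)) d hne), hf, map_zero]

theorem isBackStableLimit_backLimit {w : Equiv.Perm ℤ} (hw : w ∈ SZ) :
    IsBackStableLimit w (toSeries (backLimit w)) := by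
  intro m
  obtain ⟨b, hb⟩ := exists_isMonoGE m
  obtain ⟨c, hc⟩ := exists_forall_isLift_backLimit hw
  have h : ∀ᶠ p : ℤ in atBot, p ≤ min b c := eventually_le_atBot _
  filter_upwards [h.prod_inl (atTop : Filter ℤ)] with pq hpq
  obtain ⟨_, hl⟩ := hc pq.1 (hpq.trans (min_le_right _ _))
  rw [coeff_toSeries_eq _ m (hb pq.1 (hpq.trans (min_le_left _ _))), hl.trunc_eq]
  rfl

theorem backStable_eq_backLimit {w : Equiv.Perm ℤ} (hw : w ∈ SZ) : backStable w = backLimit w := by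
  have h : ∃ f, IsBackStableLimit w (toSeries f) := ⟨_, isBackStableLimit_backLimit hw⟩
  rw [backStable, dif_pos h]
  refine toSeries_injective (MvPowerSeries.ext fun m => ?_)
  obtain ⟨_, h1, h2⟩ := ((h.choose_spec m).and (isBackStableLimit_backLimit hw m)).exists
  exact h1.symm.trans h2

/-! ### Expansions determined by divided differences -/

open Classical in
/-- A family in `Λ(x||a) ⊗ M` indexed by `S_ℤ`, on which divided differences act as on back stable
double Schubert polynomials, is determined by its images `E (Y w)` in `Λ(x||a)`. Here `G` is a family
in `M` indexed by `V` of the same kind, and `E` contracts `M` by an augmentation that maps `G 1` to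
`1` and the other `G v` to `0`. -/
theorem eq_sum_factorizations {M : Type*} [AddCommGroup M] [Module Qa M] {I : Set ℤ}
    {D : ℤ → M →ₗ[Qa] M} {V : Set (Equiv.Perm ℤ)} {G : Equiv.Perm ℤ → M} (hV : 1 ∈ V)
    (hVs : ∀ v ∈ V, ∀ i ∈ I, v * s i ∈ V)
    (hG : ∀ v ∈ V, ∀ i ∈ I, D i (G v) = if v (i + 1) < v i then G (v * s i) else 0)
    (hD : ∀ m, (∀ i ∈ I, D i m = 0) → ∃ c : Qa, m = c • G 1)
    {E : DoubleSym ⊗[Qa] M →ₗ[Qa] DoubleSym}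
    (hE : ∀ h, ∀ v ∈ V, E (h ⊗ₜ G v) = if v = 1 then h else 0)
    {Y : Equiv.Perm ℤ → DoubleSym ⊗[Qa] M}
    (hY : ∀ w ∈ SZ, ∀ i ∈ I,
      (D i).lTensor DoubleSym (Y w) = if w (i + 1) < w i then Y (w * s i) else 0)
    {w : Equiv.Perm ℤ} (hw : w ∈ SZ) :
    Y w = ∑ uv ∈ (factorizations w).filter fun uv => uv.2 ∈ V, E (Y uv.1) ⊗ₜ G uv.2 := by
  induction hn : len w using Nat.strong_induction_on generalizing w with
  | _ n ih =>
    have hZ : ∀ i ∈ I, (D i).lTensor DoubleSym (Y w -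
        ∑ uv ∈ (factorizations w).filter fun uv => uv.2 ∈ V, E (Y uv.1) ⊗ₜ G uv.2) = 0 := by
      intro i hi
      rw [map_sub, hY w hw i hi, map_sum, sub_eq_zero]
      have e : ∀ uv ∈ (factorizations w).filter fun uv => uv.2 ∈ V,
          (D i).lTensor DoubleSym (E (Y uv.1) ⊗ₜ[Qa] G uv.2) =
            if uv.2 (i + 1) < uv.2 i then E (Y uv.1) ⊗ₜ[Qa] G (uv.2 * s i) else 0 := by
        intro uv huv
        rw [LinearMap.lTensor_tmul, hG _ (Finset.mem_filter.mp huv).2 i hi]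
        split_ifs
        · rfl
        · exact TensorProduct.tmul_zero _ _
      rw [Finset.sum_congr rfl e, ← Finset.sum_filter]
      split_ifs with hd
      · have hlen := len_mul_s_of_gt hw hd
        rw [ih (len (w * s i)) (by omega) (mul_s_mem_SZ hw i) rfl]
        refine Finset.sum_nbij' (fun uv => (uv.1, uv.2 * s i)) (fun uv => (uv.1, uv.2 * s i))
          ?_ ?_ ?_ ?_ ?_
        · rintro ⟨u, v⟩ huv
          rw [Finset.mem_filter] at huv
          have hm := mem_factorizations_mul_s hw (i := i) u (v * s i)
          rw [mul_s_mul_s] at hm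
          have := hm.mpr ⟨huv.1, hd⟩
          exact Finset.mem_filter.mpr
            ⟨Finset.mem_filter.mpr ⟨this.1, hVs v huv.2 i hi⟩, this.2⟩
        · rintro ⟨u, v⟩ huv
          rw [Finset.mem_filter, Finset.mem_filter] at huv
          exact Finset.mem_filter.mpr
            ⟨((mem_factorizations_mul_s hw u v).mp ⟨huv.1.1, huv.2⟩).1, hVs v huv.1.2 i hi⟩
        · rintro ⟨u, v⟩ _
          simp only [mul_s_mul_s]
        · rintro ⟨u, v⟩ _
          simp only [mul_s_mul_s]
        · rintro ⟨u, v⟩ _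
          simp only [mul_s_mul_s]
      · refine (Finset.sum_eq_zero fun uv huv => absurd ?_ hd).symm
        rw [Finset.mem_filter, Finset.mem_filter] at huv
        exact ((mem_factorizations_mul_s hw uv.1 uv.2).mp ⟨huv.1.1, huv.2⟩).2
    obtain ⟨h, hh⟩ := exists_eq_tmul_of_forall_lTensor_eq_zero hD hZ
    -- both sides have the same image under `E`, as `(w, 1)` is the only factorization with `v = 1`
    have h0 := congrArg E hh
    rw [hE h 1 hV, if_pos rfl, map_sub, map_sum, Finset.sum_eq_single (w, 1), hE _ 1 hV, if_pos rfl,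
      sub_self] at h0
    · rw [← h0, TensorProduct.zero_tmul] at hh
      exact sub_eq_zero.mp hh
    · rintro ⟨u, v⟩ huv hne
      rw [Finset.mem_filter, mem_factorizations] at huv
      rw [hE _ v huv.2, if_neg]
      rintro rfl
      exact hne (by rw [huv.1.2.2.1, mul_one])
    · intro hnot
      exact absurd (Finset.mem_filter.mpr ⟨mem_factorizations.mpr
        ⟨hw, SZ.one_mem, (mul_one w).symm, by rw [len_one, add_zero]⟩, hV⟩) hnot

/-! ### The coaction -/

instance : IsDomain (DoubleSym ⊗[Qa] BackSym) :=
  ((Algebra.TensorProduct.comm Qa DoubleSym BackSym).trans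
    ((MvPolynomial.algebraTensorAlgEquiv (σ := ℕ+) Qa BackSym).restrictScalars
      Qa)).toMulEquiv.isDomain _

theorem coaction_pB (k : ℕ+) : coaction (pB k) = p k ⊗ₜ[Qa] 1 + 1 ⊗ₜ[Qa] pB k := by
  change Algebra.TensorProduct.assoc Qa Qa Qa DoubleSym DoubleSym Qxa
    (Algebra.TensorProduct.map comul (AlgHom.id Qa Qxa) (p k ⊗ₜ[Qa] 1)) = _
  have : comul (p k) = p k ⊗ₜ[Qa] 1 + 1 ⊗ₜ[Qa] p k := MvPolynomial.aeval_X _ _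
  rw [Algebra.TensorProduct.map_tmul, this, map_one, TensorProduct.add_tmul, map_add,
    Algebra.TensorProduct.assoc_tmul, Algebra.TensorProduct.assoc_tmul]
  rfl

theorem coaction_xB (i : ℤ) : coaction (xB i) = 1 ⊗ₜ[Qa] xB i := by
  change Algebra.TensorProduct.assoc Qa Qa Qa DoubleSym DoubleSym Qxa
    (Algebra.TensorProduct.map comul (AlgHom.id Qa Qxa) (1 ⊗ₜ[Qa] x i)) = _
  rw [Algebra.TensorProduct.map_tmul, map_one, AlgHom.id_apply, Algebra.TensorProduct.one_def,
    Algebra.TensorProduct.assoc_tmul]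
  rfl

theorem coaction_sB (i : ℤ) (f : BackSym) :
    coaction (sB i f) = (sB i).toLinearMap.lTensor DoubleSym (coaction f) := by
  suffices h : coaction.comp (sB i) =
      (Algebra.TensorProduct.map (AlgHom.id Qa DoubleSym) (sB i)).comp coaction from
    DFunLike.congr_fun h f
  refine backSym_algHom_ext (B := DoubleSym ⊗[Qa] BackSym) (fun k => ?_) fun j => ?_
  · rw [AlgHom.comp_apply, AlgHom.comp_apply, coaction_pB, map_add,
      Algebra.TensorProduct.map_tmul, Algebra.TensorProduct.map_tmul, map_one, map_one, sB_pB,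
      AlgHom.id_apply]
    split_ifs
    · rw [map_add, map_sub, map_pow, map_pow, coaction_pB, coaction_xB, coaction_xB,
        Algebra.TensorProduct.tmul_pow, Algebra.TensorProduct.tmul_pow, one_pow,
        TensorProduct.tmul_add, TensorProduct.tmul_sub, add_assoc]
    · rw [coaction_pB]
  · rw [AlgHom.comp_apply, AlgHom.comp_apply, coaction_xB, Algebra.TensorProduct.map_tmul,
      map_one, sB_xB, coaction_xB]

theorem one_tmul_xB_sub_ne_zero (i : ℤ) :
    (1 : DoubleSym) ⊗ₜ[Qa] (xB i - xB (i + 1)) ≠ 0 := by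
  intro h
  have := congrArg (Algebra.TensorProduct.productMap
    (MvPolynomial.aeval pB : DoubleSym →ₐ[Qa] BackSym) (AlgHom.id Qa BackSym)) h
  rw [Algebra.TensorProduct.productMap_apply_tmul, map_one, one_mul, map_zero] at this
  exact xB_sub_xB_ne_zero i this

theorem one_tmul_mul_lTensor_dB (i : ℤ) (y : DoubleSym ⊗[Qa] BackSym) :
    ((1 : DoubleSym) ⊗ₜ[Qa] (xB i - xB (i + 1))) * (dB i).lTensor DoubleSym y =
      y - (sB i).toLinearMap.lTensor DoubleSym y := by
  induction y using TensorProduct.induction_on with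
  | zero => simp only [map_zero, mul_zero, sub_zero]
  | add y z hy hz => rw [map_add, map_add, mul_add, hy, hz]; abel
  | tmul g f =>
    rw [LinearMap.lTensor_tmul, LinearMap.lTensor_tmul, Algebra.TensorProduct.tmul_mul_tmul,
      one_mul, dB_spec, TensorProduct.tmul_sub]
    rfl

theorem lTensor_dB_coaction (i : ℤ) (f : BackSym) :
    (dB i).lTensor DoubleSym (coaction f) = coaction (dB i f) := by
  refine mul_left_cancel₀ (one_tmul_xB_sub_ne_zero i) ?_
  rw [one_tmul_mul_lTensor_dB, ← coaction_sB, ← map_sub, ← dB_spec, map_mul, map_sub,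
    coaction_xB, coaction_xB, TensorProduct.tmul_sub]

/-- The contraction of the second factor of `Λ(x||a) ⊗ R` by the augmentation. -/
def contract : DoubleSym ⊗[Qa] BackSym →ₐ[Qa] DoubleSym :=
  Algebra.TensorProduct.productMap (AlgHom.id Qa DoubleSym)
    ((Algebra.ofId Qa DoubleSym).comp epsB)

theorem contract_tmul (h : DoubleSym) (f : BackSym) :
    contract (h ⊗ₜ f) = h * algebraMap Qa DoubleSym (epsB f) :=
  Algebra.TensorProduct.productMap_apply_tmul _ _ _ _

theorem eta_tmul (h : DoubleSym) (g : Qxa) :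
    eta (h ⊗ₜ g) = h * algebraMap Qa DoubleSym (eps 1 g) := by
  rw [eta, Algebra.TensorProduct.productMap_apply_tmul, AlgHom.id_apply]
  congr 1
  suffices e : MvPolynomial.aeval (fun i => algebraMap Qa DoubleSym (MvPolynomial.X i)) =
      (Algebra.ofId Qa DoubleSym).comp (eps 1) from DFunLike.congr_fun e g
  refine MvPolynomial.algHom_ext fun i => ?_
  rw [MvPolynomial.aeval_X, AlgHom.comp_apply]
  change _ = Algebra.ofId Qa DoubleSym (eps 1 (x i))
  rw [eps_x]
  rfl

theorem contract_coaction (f : BackSym) : contract (coaction f) = eta f := by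
  suffices h : contract.comp coaction = eta from DFunLike.congr_fun h f
  refine backSym_algHom_ext (B := DoubleSym) (fun k => ?_) fun j => ?_
  · rw [AlgHom.comp_apply, coaction_pB, map_add, contract_tmul, contract_tmul, pB, eta_tmul,
      map_one, map_one (eps 1),
      map_one (algebraMap Qa DoubleSym), epsB, ← pB, backLift_pB, map_zero, mul_zero, add_zero]
  · rw [AlgHom.comp_apply, coaction_xB, contract_tmul, xB, eta_tmul, eps_x, epsB, ← xB,
      backLift_xB]
    rfl

theorem backLimit_one : backLimit 1 = 1 := by
  obtain ⟨c, hc⟩ := exists_smul_one_of_dB (f := backLimit 1) fun i => by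
    rw [dB_backLimit SZ.one_mem, if_neg (by simp)]
  have h := congrArg epsB hc
  rw [epsB_backLimit SZ.one_mem, if_pos rfl, map_smul, map_one, smul_eq_mul, mul_one] at h
  rw [hc, ← h, one_smul]

theorem one_mem_SNonzero : 1 ∈ SNonzero :=
  ⟨1, SMinus.one_mem, 1, SPlus.one_mem, (mul_one 1).symm⟩

theorem nonzeroDoubleSchub_one : nonzeroDoubleSchub 1 = 1 := by
  obtain ⟨c, hc⟩ := exists_smul_one_of_dividedDiff (f := nonzeroDoubleSchub 1) fun i hi => by
    rw [dividedDiffL_apply, dividedDiff_nonzeroDoubleSchub one_mem_SNonzero hi, if_neg (by simp)]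
  have h := congrArg (eps 1) hc
  rw [eps_one_nonzeroDoubleSchub one_mem_SNonzero, if_pos rfl, map_smul, map_one, smul_eq_mul,
    mul_one] at h
  rw [hc, ← h, one_smul]

theorem coaction_backLimit {w : Equiv.Perm ℤ} (hw : w ∈ SZ) :
    coaction (backLimit w) =
      ∑ uv ∈ factorizations w, eta (backLimit uv.1) ⊗ₜ[Qa] backLimit uv.2 := by
  classical
  have h := eq_sum_factorizations (I := Set.univ) (D := dB) (V := SZ) (G := backLimit)
    (E := contract.toLinearMap) (Y := fun w => coaction (backLimit w)) SZ.one_mem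
    (fun v hv i _ => mul_s_mem_SZ hv i) (fun v hv i _ => dB_backLimit hv i)
    (fun f hf => by
      rw [backLimit_one]
      exact exists_smul_one_of_dB fun i => hf i trivial)
    (fun h v hv => by
      rw [AlgHom.toLinearMap_apply, contract_tmul, epsB_backLimit hv]
      split_ifs
      · rw [map_one, mul_one]
      · rw [map_zero, mul_zero])
    (fun w hw i _ => by
      rw [lTensor_dB_coaction, dB_backLimit hw]
      split_ifs
      · rfl
      · exact map_zero _) hw
  rw [Finset.filter_true_of_mem (p := fun uv => uv.2 ∈ (SZ : Set (Equiv.Perm ℤ)))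
    fun uv huv => (mem_factorizations.mp huv).2.1] at h
  simpa only [AlgHom.toLinearMap_apply, contract_coaction] using h

theorem backLimit_eq_sum {w : Equiv.Perm ℤ} (hw : w ∈ SZ) :
    backLimit w =
      ∑ uv ∈ factorizationsNonzero w, eta (backLimit uv.1) ⊗ₜ[Qa] nonzeroDoubleSchub uv.2 :=
  eq_sum_factorizations (I := {i | i ≠ 0}) (D := dividedDiffL) (V := SNonzero)
    (G := nonzeroDoubleSchub) (E := eta.toLinearMap) (Y := backLimit) one_mem_SNonzero
    (fun v hv i hi => mul_s_mem_SNonzero hv hi)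
    (fun v hv i hi => by rw [dividedDiffL_apply, dividedDiff_nonzeroDoubleSchub hv hi])
    (fun f hf => by
      rw [nonzeroDoubleSchub_one]
      exact exists_smul_one_of_dividedDiff hf)
    (fun h v hv => by
      rw [AlgHom.toLinearMap_apply, eta_tmul, eps_one_nonzeroDoubleSchub hv]
      split_ifs
      · rw [map_one, mul_one]
      · rw [map_zero, mul_zero])
    (fun w hw i hi => by rw [lTensor_dividedDiffL hi, dB_backLimit hw]) hw

end

end BackStable

theorem mainTheorem2 :
    Function.Injective BackStable.toSeries ∧
    ∀ w ∈ BackStable.SZ,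
      BackStable.IsBackStableLimit w (BackStable.toSeries (BackStable.backStable w)) ∧
      BackStable.coaction (BackStable.backStable w) =
        ∑ uv ∈ BackStable.factorizations w,
          BackStable.doubleStanley uv.1 ⊗ₜ[BackStable.Qa] BackStable.backStable uv.2 ∧
      BackStable.backStable w =
        ∑ uv ∈ BackStable.factorizationsNonzero w,
          BackStable.doubleStanley uv.1 ⊗ₜ[BackStable.Qa] BackStable.nonzeroDoubleSchub uv.2 := by
  refine ⟨BackStable.toSeries_injective, fun w hw => ?_⟩
  have hb := fun {v} hv => BackStable.backStable_eq_backLimit (w := v) hv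
  rw [hb hw]
  refine ⟨BackStable.isBackStableLimit_backLimit hw,
    (BackStable.coaction_backLimit hw).trans (Finset.sum_congr rfl fun uv huv => ?_),
    (BackStable.backLimit_eq_sum hw).trans (Finset.sum_congr rfl fun uv huv => ?_)⟩
  · have h := BackStable.mem_factorizations.mp huv
    rw [BackStable.doubleStanley, hb h.1, hb h.2.1]
  · classical
    rw [BackStable.factorizationsNonzero, Finset.mem_filter] at huv
    have h := BackStable.mem_factorizations.mp huv.1
    rw [BackStable.doubleStanley, hb h.1]
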